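/- **Setting.** Let $\omega=\{1,2,\dots\}$ and let $\mathcal M$ be the monoid of injective self-maps of $\omega$. *Permutative categories.* $\mathbf{PermCat}$ is the category of small permutative categories (symmetric monoidal categories whose associativity and unit isomorphisms are identities; unit $\mathbf 1$, symmetry $\tau$) and strict symmetric monoidal functors. *Parsummable categories.* Let $E\mathcal M$ be the strict monoidal category with object monoid $\mathcal M$ and exactly one morphism $u\to v$ for all $u,v\in\mathcal M$. For a category with a strict $E\mathcal M$-action, write $u_*$ for the action of $u\in\mathcal M$ and $[v,u]_X\colon u_*X\to v_*X$ for the action of the morphism $u\to v$. An object $X$ is supported on a finite set $A\subset\omega$ if $u_*X=X$ for all $u\in\mathcal M$ fixing $A$ pointwise; $\mathrm{supp}(X)$ is the intersection of all such $A$. $\mathbf{ParSumCat}$ is the category of small parsummable categories: $E\mathcal M$-categories in which every object is supported on some finite set, with a zero object of empty support and a strictly unital, associative and commutative $E\mathcal M$-equivariant sum functor $+$ defined on the full subcategory of pairs of objects with disjoint supports. Its morphisms are the $E\mathcal M$-equivariant functors strictly preserving $0$ and $+$. *The functor $\Phi\colon\mathbf{PermCat}\to\mathbf{ParSumCat}$.*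 Objects of $\Phi\mathscr C$ are sequences $X=(X_1,X_2,\dots)$ of objects of $\mathscr C$ with $X_i=\mathbf 1$ for almost all $i$; $\mathrm{Hom}_{\Phi\mathscr C}(X,Y)=\mathrm{Hom}_{\mathscr C}(\bigotimes_{i\in\omega}X_i,\bigotimes_{i\in\omega}Y_i)$ (ordered tensor products of the non-unit entries). For $u\in\mathcal M$, $(u_*X)_{u(j)}=X_j$ and $(u_*X)_i=\mathbf 1$ for $i\notin\mathrm{im}(u)$; the isomorphism $u_\circ\colon X\to u_*X$ is the coherence isomorphism associated to the bijection $u\colon\mathrm{supp}(X)\to u(\mathrm{supp}(X))$; $u_*f=u_\circ\circ f\circ u_\circ^{-1}$ and $[v,u]=v_\circ\circ u_\circ^{-1}$. The sum of disjointly supported objects is formed entrywise, and $f+g$ is the conjugate of $f\otimes g$ by the coherence isomorphisms $\bigotimes_i(X+Y)_i\cong\bigotimes_iX_i\otimes\bigotimes_iY_i$. A strict symmetric monoidal functor $F$ is sent to the functor applying $F$ entrywise to objects and to the underlying morphisms. *The functor $\Sigma\colon\mathbf{ParSumCat}\to\mathbf{PermCat}$.* Objects of $\Sigma\mathcal C$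 are finite (possibly empty) tuples $X=(X^{(1)},\dots,X^{(m)})$ of objects of $\mathcal C$. For an injection $\phi\colon\{1,\dots,m\}\times\omega\to\omega$ put $\phi_*(X)=\sum_i\phi(i,-)_*X^{(i)}$ and let $[\phi',\phi]_X\colon\phi_*(X)\to\phi'_*(X)$ be the sum of the morphisms $[\phi'(i,-),\phi(i,-)]_{X^{(i)}}$. Morphisms $X\to Y$ in $\Sigma\mathcal C$ are classes $[\psi,f,\phi]$ of triples with $\phi,\psi$ injections and $f\colon\phi_*(X)\to\psi_*(Y)$ in $\mathcal C$, where $(\psi,f,\phi)\sim(\psi',f',\phi')$ iff $f'=[\psi',\psi]_Y\circ f\circ[\phi,\phi']_X$; $[\rho,g,\theta]\circ[\psi,f,\phi]=[\rho,g\circ[\theta,\psi]\circ f,\phi]$. The tensor product is concatenation on objects and $[\psi,f,\phi]\otimes[\rho,g,\theta]=[\psi+\rho,f+g,\phi+\theta]$ on morphisms, for representatives such that $\phi,\theta$ as well as $\psi,\rho$ have disjoint images (here $\phi+\theta$ is $\phi$ on the first block and $\theta$ on the second). The symmetry $X\otimes Y\to Y\otimes X$ is $[\theta+\phi,\mathrm{id},\phi+\theta]$.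 $\Sigma(G)$ is given by applying $G$ entrywise and by $[\psi,f,\phi]\mapsto[\psi,Gf,\phi]$. *The functor $T_{\mathscr C}$.* Let $X=(X^{(1)},\dots,X^{(m)})$ be a tuple of objects of $\Phi\mathscr C$. An injection $\phi\colon\{1,\dots,m\}\times\omega\to\omega$ is $X$-monotone if $\phi(i,j)<\phi(i',j')$ whenever $(i,j)$ is lexicographically smaller than $(i',j')$ and $X^{(i)}_j\neq\mathbf 1\neq X^{(i')}_{j'}$. Define $T_{\mathscr C}\colon\Sigma\Phi\mathscr C\to\mathscr C$ by $T_{\mathscr C}(X)=\bigotimes_{i=1}^m\bigotimes_{j\in\omega}X^{(i)}_j$ and, for a morphism $\alpha\colon X\to Y$, by $T_{\mathscr C}(\alpha)=f$, viewed as a morphism of $\mathscr C$, where $(\psi,f,\phi)$ is any representative of $\alpha$ such that $\phi$ is $X$-monotone and $\psi$ is $Y$-monotone. **Proposition.** For every small permutative category $\mathscr C$, $T_{\mathscr C}$ is well defined: every morphism $\alpha\colon X\to Y$ of $\Sigma\Phi\mathscr C$ has such a representative $(\psi,f,\phi)$; for every such representative, $f$ is, as a morphism of $\mathscr C$, a morphism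 $T_{\mathscr C}(X)\to T_{\mathscr C}(Y)$; and it does not depend on the choice of the representative. Moreover, $T_{\mathscr C}$ is a strict symmetric monoidal functor $\Sigma\Phi\mathscr C\to\mathscr C$. For varying $\mathscr C$, the $T_{\mathscr C}$ assemble into a natural transformation $\Sigma\Phi\Rightarrow\mathrm{id}_{\mathbf{PermCat}}$, and each $T_{\mathscr C}$ is an equivalence of underlying categories. -/

import Mathlib

open CategoryTheory

universe v u

namespace ParPerm

/-! ### Arrows up to strict equality -/

section ArrowAlgebra
variable {C : Type u} [Category.{v} C]

open Classical in
/-- Composition of arrows of a category, extended by a junk value to non-composable pairs. It is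
only a bookkeeping device for computing with equalities in the set of all morphisms. -/
noncomputable def acomp (a b : Arrow C) : Arrow C :=
  if h : a.right = b.left then Arrow.mk (a.hom ≫ eqToHom h ≫ b.hom) else a

infixr:65 " ⋄ " => acomp

/-- The identity of `X`, as an element of the set of all morphisms. -/
abbrev ia (X : C) : Arrow C := Arrow.mk (𝟙 X)

theorem mk_comp {X Y Z : C} (f : X ⟶ Y) (g : Y ⟶ Z) :
    Arrow.mk (f ≫ g) = Arrow.mk f ⋄ Arrow.mk g := by
  simp [acomp]

theorem mk_eqToHom {X Y : C} (h : X = Y) : Arrow.mk (eqToHom h) = ia X := by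
  subst h; rfl

theorem acomp_eq {a b : Arrow C} (h : a.right = b.left) :
    a ⋄ b = Arrow.mk (a.hom ≫ eqToHom h ≫ b.hom) := by
  simp [acomp, h]

theorem acomp_left (a b : Arrow C) : (a ⋄ b).left = a.left := by
  unfold acomp; split_ifs <;> rfl

theorem acomp_right {a b : Arrow C} (h : a.right = b.left) : (a ⋄ b).right = b.right := by
  rw [acomp_eq h]; rfl

theorem acomp_assoc {a b c : Arrow C} (h : a.right = b.left) (h' : b.right = c.left) :
    (a ⋄ b) ⋄ c = a ⋄ b ⋄ c := by
  obtain ⟨X, Y, f, rfl⟩ := Arrow.mk_surjective a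
  obtain ⟨Y', Z, g, rfl⟩ := Arrow.mk_surjective b
  obtain ⟨Z', W, k, rfl⟩ := Arrow.mk_surjective c
  obtain rfl : Y = Y' := h
  obtain rfl : Z = Z' := h'
  simp only [← mk_comp, Category.assoc]

theorem ia_acomp {X : C} {a : Arrow C} (h : X = a.left) : ia X ⋄ a = a := by
  subst h
  obtain ⟨X, Y, f, rfl⟩ := Arrow.mk_surjective a
  exact (mk_comp _ _).symm.trans (by simp)

theorem acomp_ia {X : C} {a : Arrow C} (h : a.right = X) : a ⋄ ia X = a := by
  subst h
  obtain ⟨X, Y, f, rfl⟩ := Arrow.mk_surjective a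
  exact (mk_comp _ _).symm.trans (by simp)

theorem left_eq {X Y X' Y' : C} {f : X ⟶ Y} {g : X' ⟶ Y'} (h : Arrow.mk f = Arrow.mk g) :
    X = X' := congrArg (fun a : Arrow C => a.left) h

theorem right_eq {X Y X' Y' : C} {f : X ⟶ Y} {g : X' ⟶ Y'} (h : Arrow.mk f = Arrow.mk g) :
    Y = Y' := congrArg (fun a : Arrow C => a.right) h

theorem hom_eq {X Y : C} {f g : X ⟶ Y} (h : Arrow.mk f = Arrow.mk g) : f = g :=
  Arrow.mk_injective _ _ h

theorem map_mk_congr {D : Type*} [Category D] (F : C ⥤ D) {X Y X' Y' : C} {f : X ⟶ Y}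
    {g : X' ⟶ Y'} (h : Arrow.mk f = Arrow.mk g) : Arrow.mk (F.map f) = Arrow.mk (F.map g) := by
  cases h; rfl

end ArrowAlgebra

/-! ### Permutative categories -/

/-- A permutative category: a category with a strictly associative and strictly unital tensor
product functor (on objects: the multiplication of a monoid with unit `1`; on morphisms:
`tensorHom`) and a symmetry `τ` that is natural, unital, self-inverse and associative.
Strict equalities between morphisms whose sources and targets agree only propositionally are
equalities in the set `Arrow C` of all morphisms. -/
class PermutativeCategory (C : Type u) [Category.{v} C] extends Monoid C where
  tensorHom {X Y X' Y' : C} (f : X ⟶ Y) (g : X' ⟶ Y') : X * X' ⟶ Y * Y'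
  tensorHom_id (X Y : C) : tensorHom (𝟙 X) (𝟙 Y) = 𝟙 (X * Y)
  tensorHom_comp {X Y Z X' Y' Z' : C} (f : X ⟶ Y) (g : Y ⟶ Z) (f' : X' ⟶ Y') (g' : Y' ⟶ Z') :
    tensorHom (f ≫ g) (f' ≫ g') = tensorHom f f' ≫ tensorHom g g'
  tensorHom_assoc {X Y X' Y' X'' Y'' : C} (f : X ⟶ Y) (g : X' ⟶ Y') (h : X'' ⟶ Y'') :
    Arrow.mk (tensorHom (tensorHom f g) h) = Arrow.mk (tensorHom f (tensorHom g h))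
  id_tensorHom {X Y : C} (f : X ⟶ Y) : Arrow.mk (tensorHom (𝟙 1) f) = Arrow.mk f
  tensorHom_id_one {X Y : C} (f : X ⟶ Y) : Arrow.mk (tensorHom f (𝟙 1)) = Arrow.mk f
  τ (X Y : C) : X * Y ⟶ Y * X
  τ_natural {X Y X' Y' : C} (f : X ⟶ Y) (g : X' ⟶ Y') :
    tensorHom f g ≫ τ Y Y' = τ X X' ≫ tensorHom g f
  τ_one_left (X : C) : Arrow.mk (τ 1 X) = Arrow.mk (𝟙 X)
  τ_one_right (X : C) : Arrow.mk (τ X 1) = Arrow.mk (𝟙 X)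
  τ_τ (X Y : C) : τ X Y ≫ τ Y X = 𝟙 (X * Y)
  τ_mul (X Y Z : C) :
    τ (X * Y) Z = eqToHom (mul_assoc X Y Z) ≫ tensorHom (𝟙 X) (τ Y Z) ≫
      eqToHom (mul_assoc X Z Y).symm ≫ tensorHom (τ X Z) (𝟙 Y) ≫ eqToHom (mul_assoc Z X Y)

namespace PermutativeCategory

infixr:70 " ⊗ₚ " => PermutativeCategory.tensorHom

section
variable {C : Type u} [Category.{v} C] [PermutativeCategory.{v} C]

/-- The tensor product makes the set of all morphisms into a monoid. -/
instance arrowMonoid : Monoid (Arrow C) where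
  mul a b := Arrow.mk (a.hom ⊗ₚ b.hom)
  one := Arrow.mk (𝟙 1)
  mul_assoc a b c := tensorHom_assoc a.hom b.hom c.hom
  one_mul a := id_tensorHom a.hom
  mul_one a := tensorHom_id_one a.hom

theorem mk_tensor {X Y X' Y' : C} (f : X ⟶ Y) (g : X' ⟶ Y') :
    Arrow.mk (f ⊗ₚ g) = Arrow.mk f * Arrow.mk g := rfl

@[simp] theorem mul_left' (a b : Arrow C) : (a * b).left = a.left * b.left := rfl
@[simp] theorem mul_right' (a b : Arrow C) : (a * b).right = a.right * b.right := rfl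

theorem ia_mul (X Y : C) : ia (X * Y) = ia X * ia Y := by
  rw [← mk_tensor, tensorHom_id]

theorem ia_one : ia (1 : C) = 1 := rfl

theorem acomp_mul {a b c d : Arrow C} (h : a.right = b.left) (h' : c.right = d.left) :
    (a ⋄ b) * (c ⋄ d) = (a * c) ⋄ (b * d) := by
  obtain ⟨X, Y, f, rfl⟩ := Arrow.mk_surjective a
  obtain ⟨Y', Z, g, rfl⟩ := Arrow.mk_surjective b
  obtain ⟨P, Q, f', rfl⟩ := Arrow.mk_surjective c
  obtain ⟨Q', W, g', rfl⟩ := Arrow.mk_surjective d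
  obtain rfl : Y = Y' := h
  obtain rfl : Q = Q' := h'
  simp only [← mk_comp, ← mk_tensor, tensorHom_comp]

theorem ia_mul_acomp {X : C} {a b : Arrow C} (h : a.right = b.left) :
    ia X * (a ⋄ b) = (ia X * a) ⋄ (ia X * b) := by
  rw [← acomp_mul rfl h, ia_acomp (X := X) rfl]

theorem acomp_mul_ia {X : C} {a b : Arrow C} (h : a.right = b.left) :
    (a ⋄ b) * ia X = (a * ia X) ⋄ (b * ia X) := by
  rw [← acomp_mul h rfl, ia_acomp (X := X) rfl]

/-- The symmetry, as an element of the set of all morphisms. -/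
abbrev ta (X Y : C) : Arrow C := Arrow.mk (τ X Y)

theorem ta_natural (a b : Arrow C) :
    (a * b) ⋄ ta a.right b.right = ta a.left b.left ⋄ (b * a) := by
  obtain ⟨X, Y, f, rfl⟩ := Arrow.mk_surjective a
  obtain ⟨Y', Z, g, rfl⟩ := Arrow.mk_surjective b
  exact (mk_comp _ _).symm.trans ((congrArg Arrow.mk (τ_natural f g)).trans (mk_comp _ _))

theorem ta_ta (X Y : C) : ta X Y ⋄ ta Y X = ia (X * Y) := by
  rw [← mk_comp, τ_τ]

theorem ta_one_left (X : C) : ta 1 X = ia X := τ_one_left X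
theorem ta_one_right (X : C) : ta X 1 = ia X := τ_one_right X

theorem ta_mul_left (X Y Z : C) : ta (X * Y) Z = (ia X * ta Y Z) ⋄ (ta X Z * ia Y) := by
  unfold ta
  rw [τ_mul]
  simp only [mk_comp, mk_eqToHom, mk_tensor]
  rw [ia_acomp, ia_acomp, acomp_ia]
  all_goals simp [acomp_left, mul_assoc]

theorem ta_mul_right (X Y Z : C) : ta X (Y * Z) = (ta X Y * ia Z) ⋄ (ia Y * ta X Z) := by
  have h : ((ta X Y * ia Z) ⋄ (ia Y * ta X Z)) ⋄ ta (Y * Z) X = ia (X * (Y * Z)) := by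
    rw [ta_mul_left, acomp_assoc (by simp [mul_assoc]) (by simp [mul_assoc, acomp_left]),
      ← acomp_assoc (a := ia Y * ta X Z) (by simp) (by simp [mul_assoc]), ← ia_mul_acomp (by simp),
      ta_ta, ← ia_mul, ia_acomp (by simp [mul_assoc]), ← acomp_mul_ia (by simp), ta_ta, ← ia_mul,
      mul_assoc]
  have h' : ta (Y * Z) X ⋄ ta X (Y * Z) = ia (Y * Z * X) := ta_ta _ _
  have e := acomp_assoc (a := (ta X Y * ia Z) ⋄ (ia Y * ta X Z)) (b := ta (Y * Z) X)
    (c := ta X (Y * Z)) (by rw [acomp_right (by simp [mul_assoc])]; simp [mul_assoc]) (by simp)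
  rw [h, h', ia_acomp (by simp), acomp_ia] at e
  · exact e
  · rw [acomp_right (by simp [mul_assoc])]; simp [mul_assoc]

/-- The braid relation for the symmetry. -/
theorem braid (A B D : C) :
    (ta A B * ia D) ⋄ (ia B * ta A D) ⋄ (ta B D * ia A) =
      (ia A * ta B D) ⋄ (ta A D * ia B) ⋄ (ia D * ta A B) := by
  rw [← acomp_assoc (by simp [mul_assoc]) (by simp [mul_assoc]), ← ta_mul_right, ← ta_mul_right]
  exact (ta_natural (ia A) (ta B D)).symm

end

/-! ### Coherence isomorphisms -/

section Coherence
variable {C : Type u} [Category.{v} C] [PermutativeCategory.{v} C] {ι : Type*} [DecidableEq ι]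

/-- The tensor product of the family `X` along a list of indices. -/
def lprod {ι : Type*} (X : ι → C) (l : List ι) : C := (l.map X).prod

theorem lprod_nil {ι : Type*} (X : ι → C) : lprod X [] = 1 := by simp [lprod]

theorem lprod_cons {ι : Type*} (X : ι → C) (a : ι) (l : List ι) : lprod X (a :: l) = X a * lprod X l := by
  simp [lprod]

theorem lprod_append {ι : Type*} (X : ι → C) (l m : List ι) : lprod X (l ++ m) = lprod X l * lprod X m := by
  simp [lprod]

/-- `τ ⊗ id`, exchanging the first two of three tensor factors. -/
def sw (A B P : C) : A * (B * P) ⟶ B * (A * P) :=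
  eqToHom (mul_assoc A B P).symm ≫ (τ A B ⊗ₚ 𝟙 P) ≫ eqToHom (mul_assoc B A P)

theorem lprod_cons_erase (X : ι → C) {a b : ι} (hb : b ≠ a) (l : List ι) :
    lprod X ((b :: l).erase a) = X b * lprod X (l.erase a) := by
  rw [List.erase_cons_tail (by simpa using hb), lprod_cons]

/-- Move the (first) factor with label `a` to the front of the tensor product, by successively
exchanging it with its left neighbours. -/
def front (X : ι → C) (a : ι) : (l : List ι) → a ∈ l → (lprod X l ⟶ X a * lprod X (l.erase a))
  | [], h => absurd h List.not_mem_nil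
  | b :: l, h =>
    if hb : b = a then eqToHom (by subst hb; simp [lprod])
    else eqToHom (lprod_cons X b l) ≫
      (𝟙 (X b) ⊗ₚ front X a l (by simpa [Ne.symm hb] using h)) ≫
      sw (X b) (X a) (lprod X (l.erase a)) ≫
      (𝟙 (X a) ⊗ₚ eqToHom (lprod_cons_erase X hb l).symm)

/-- The coherence isomorphism permuting the factors of a tensor product: here the tensor factors
are labelled by the entries of the lists `l` and `l'`, which are permutations of each other, and the
factor with label `a` of the source is sent to the factor with label `a` of the target. It is a
composite of morphisms of the form `id ⊗ ... ⊗ τ ⊗ ... ⊗ id` exchanging two adjacent factors. -/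
def coh (X : ι → C) : (l l' : List ι) → l.Perm l' → (lprod X l ⟶ lprod X l')
  | l, [], h => eqToHom (by rw [List.perm_nil.mp h])
  | l, a :: t, h =>
    front X a l (h.mem_iff.mpr (by simp)) ≫
      (𝟙 (X a) ⊗ₚ coh X (l.erase a) t (by simpa using h.erase a)) ≫
      eqToHom (lprod_cons X a t).symm

variable (X : ι → C)

/-- `front` in the set of all morphisms. -/
abbrev fa (a : ι) (l : List ι) (h : a ∈ l) : Arrow C := Arrow.mk (front X a l h)
/-- `coh` in the set of all morphisms. -/
abbrev ca (l l' : List ι) (h : l.Perm l') : Arrow C := Arrow.mk (coh X l l' h)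

theorem fa_self (a : ι) (l : List ι) (h : a ∈ a :: l) :
    fa X a (a :: l) h = ia (lprod X (a :: l)) := by
  simp [fa, front, mk_eqToHom]

theorem mk_sw (A B P : C) : Arrow.mk (sw A B P) = ta A B * ia P := by
  rw [sw, mk_comp, mk_eqToHom, mk_comp, mk_eqToHom, mk_tensor, ia_acomp, acomp_ia] <;>
    simp [acomp_left, mul_assoc]

theorem fa_ne {a b : ι} (hb : b ≠ a) (l : List ι) (h : a ∈ b :: l) (h' : a ∈ l) :
    fa X a (b :: l) h = (ia (X b) * fa X a l h') ⋄ (ta (X b) (X a) * ia (lprod X (l.erase a))) := by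
  simp only [fa, front, dif_neg hb]
  rw [mk_comp, mk_comp, mk_comp, mk_tensor, mk_tensor, mk_eqToHom, mk_eqToHom, mk_sw, ← ia_mul,
    ia_acomp, acomp_ia]
  all_goals simp [acomp_left, lprod_cons, lprod_cons_erase X hb, mul_assoc]

theorem ca_nil (h : List.Perm [] []) : ca X [] [] h = 1 := by
  simp [ca, coh]; rw [lprod_nil]; rfl

theorem ca_cons (l : List ι) (a : ι) (t : List ι) (h : l.Perm (a :: t)) (h' : a ∈ l)
    (h'' : (l.erase a).Perm t) :
    ca X l (a :: t) h = fa X a l h' ⋄ (ia (X a) * ca X (l.erase a) t h'') := by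
  simp only [ca, coh]
  rw [mk_comp, mk_comp, mk_tensor, mk_eqToHom, acomp_ia]
  rfl

theorem fa_congr {a : ι} {l m : List ι} (e : l = m) (h : a ∈ l) :
    fa X a l h = fa X a m (e ▸ h) := by subst e; rfl

theorem ca_congr {l l' m m' : List ι} (e : l = m) (e' : l' = m') (h : l.Perm l') :
    ca X l l' h = ca X m m' (e ▸ e' ▸ h) := by subst e; subst e'; rfl

@[simp] theorem fa_left (a : ι) (l : List ι) (h : a ∈ l) : (fa X a l h).left = lprod X l := rfl
@[simp] theorem fa_right (a : ι) (l : List ι) (h : a ∈ l) :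
    (fa X a l h).right = X a * lprod X (l.erase a) := rfl
@[simp] theorem ca_left (l l' : List ι) (h : l.Perm l') : (ca X l l' h).left = lprod X l := rfl
@[simp] theorem ca_right (l l' : List ι) (h : l.Perm l') : (ca X l l' h).right = lprod X l' := rfl

end Coherence

set_option linter.unusedSimpArgs false

section CoherenceTheorems
variable {C : Type u} [Category.{v} C] [PermutativeCategory.{v} C]

theorem mul_swap (a : Arrow C) (b : Arrow C) :
    (a * ia b.left) ⋄ (ia a.right * b) = (ia a.left * b) ⋄ (a * ia b.right) := by
  rw [← acomp_mul rfl rfl, ← acomp_mul rfl rfl, ia_acomp rfl, ia_acomp rfl, acomp_ia rfl,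
    acomp_ia rfl]

/-- The inductive step in the comparison of the two ways to move two factors to the front. -/
theorem front_step {A B D P L M N : C} (f₁ : L ⟶ B * M) (f₂ : M ⟶ A * P) (g₁ : L ⟶ A * N)
    (g₂ : N ⟶ B * P)
    (H : Arrow.mk f₁ ⋄ (ia B * Arrow.mk f₂) ⋄ (ta B A * ia P) = Arrow.mk g₁ ⋄ (ia A * Arrow.mk g₂)) :
    ((ia D * Arrow.mk f₁) ⋄ (ta D B * ia M)) ⋄ (ia B * ((ia D * Arrow.mk f₂) ⋄ (ta D A * ia P))) ⋄
        (ta B A * ia (D * P)) =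
      ((ia D * Arrow.mk g₁) ⋄ (ta D A * ia N)) ⋄
        (ia A * ((ia D * Arrow.mk g₂) ⋄ (ta D B * ia P))) := by
  have e₁ := mul_swap (ta D B) (Arrow.mk f₂)
  have e₂ := mul_swap (ta D A) (Arrow.mk g₂)
  have e₃ := congrArg (fun x => ia D * x) H
  have e₄ := congrArg (fun x => x * ia P) (braid D B A)
  simp only [Arrow.mk_left, Arrow.mk_right, ia_mul, mul_assoc] at e₁ e₂
  rw [ia_mul_acomp (by simp [acomp_left, acomp_right, mul_assoc]), ia_mul_acomp (by simp [acomp_left, acomp_right, mul_assoc]),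
    ia_mul_acomp (by simp [acomp_left, acomp_right, mul_assoc])] at e₃
  rw [acomp_mul_ia (by simp [acomp_left, acomp_right, mul_assoc]), acomp_mul_ia (by simp [acomp_left, acomp_right, mul_assoc]),
    acomp_mul_ia (by simp [acomp_left, acomp_right, mul_assoc]), acomp_mul_ia (by simp [acomp_left, acomp_right, mul_assoc])] at e₄
  rw [ia_mul_acomp (by simp [acomp_left, acomp_right, mul_assoc]), ia_mul_acomp (by simp [acomp_left, acomp_right, mul_assoc]), ia_mul]
  simp only [mul_assoc] at e₃ e₄ ⊢
  rw [acomp_assoc (by simp [acomp_left, acomp_right, mul_assoc]) (by simp [acomp_left, acomp_right, mul_assoc]),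
    acomp_assoc (a := ia B * _) (by simp [acomp_left, acomp_right, mul_assoc]) (by simp [acomp_left, acomp_right, mul_assoc]),
    ← acomp_assoc (a := ta D B * ia M) (by simp [acomp_left, acomp_right, mul_assoc]) (by simp [acomp_left, acomp_right, mul_assoc]), e₁,
    acomp_assoc (by simp [acomp_left, acomp_right, mul_assoc]) (by simp [acomp_left, acomp_right, mul_assoc]), e₄,
    ← acomp_assoc (a := ia D * (ia B * _)) (by simp [acomp_left, acomp_right, mul_assoc]) (by simp [acomp_left, acomp_right, mul_assoc]),
    ← acomp_assoc (by simp [acomp_left, acomp_right, mul_assoc]) (by simp [acomp_left, acomp_right, mul_assoc]), e₃,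
    acomp_assoc (by simp [acomp_left, acomp_right, mul_assoc]) (by simp [acomp_left, acomp_right, mul_assoc]),
    acomp_assoc (by simp [acomp_left, acomp_right, mul_assoc]) (by simp [acomp_left, acomp_right, mul_assoc]),
    ← acomp_assoc (a := ta D A * ia N) (by simp [acomp_left, acomp_right, mul_assoc]) (by simp [acomp_left, acomp_right, mul_assoc]), e₂,
    acomp_assoc (by simp [acomp_left, acomp_right, mul_assoc]) (by simp [acomp_left, acomp_right, mul_assoc])]

variable {ι : Type*} [DecidableEq ι] (X : ι → C)

theorem front_comm {a b : ι} (hab : a ≠ b) (l : List ι) (ha : a ∈ l) (hb : b ∈ l)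
    (ha' : a ∈ l.erase b) (hb' : b ∈ l.erase a) :
    fa X b l hb ⋄ (ia (X b) * fa X a (l.erase b) ha') ⋄
        (ta (X b) (X a) * ia (lprod X ((l.erase b).erase a))) =
      fa X a l ha ⋄ (ia (X a) * fa X b (l.erase a) hb') := by
  induction l with
  | nil => simp at ha
  | cons c l ih =>
    by_cases hcb : c = b
    · subst hcb
      have ea : (c :: l).erase a = c :: l.erase a := by simp [Ne.symm hab]
      have ec : (c :: l).erase c = l := by simp
      rw [fa_congr X ec, fa_self, fa_congr X ea hb', fa_self, fa_ne X (Ne.symm hab) l _ (ec ▸ ha')]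
      have e1 : lprod X (((c :: l).erase c).erase a) = lprod X (l.erase a) := by rw [ec]
      rw [e1, ia_acomp (by simp [acomp_left, lprod_cons]), ← ia_mul,
        acomp_ia (by rw [acomp_right] <;> simp [lprod_cons, mul_assoc])]
    · by_cases hca : c = a
      · subst hca
        have ea : (c :: l).erase b = c :: l.erase b := by simp [hab]
        have ec : (c :: l).erase c = l := by simp
        rw [fa_congr X ea ha', fa_self, fa_congr X ec, fa_self, fa_ne X hab l _ (ec ▸ hb')]
        have e1 : lprod X (((c :: l).erase b).erase c) = lprod X (l.erase b) := by rw [ea]; simp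
        rw [e1, ia_acomp (X := lprod X (c :: l)) (by simp [lprod_cons]), ← ia_mul,
          ia_acomp (by simp [acomp_left, lprod_cons, mul_assoc]),
          acomp_assoc (by simp [mul_assoc]) (by simp),
          ← acomp_mul_ia (by simp), ta_ta, ← ia_mul, acomp_ia (by simp [mul_assoc])]

      · have ea : (c :: l).erase b = c :: l.erase b := by simp [hcb]
        have eb : (c :: l).erase a = c :: l.erase a := by simp [hca]
        have ha1 : a ∈ l := by simpa [Ne.symm hca] using ha
        have hb1 : b ∈ l := by simpa [Ne.symm hcb] using hb
        have ha2 : a ∈ l.erase b := by simpa [hab] using ha1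
        have hb2 : b ∈ l.erase a := by simpa [Ne.symm hab] using hb1
        have e2 : lprod X (((c :: l).erase b).erase a) = X c * lprod X ((l.erase b).erase a) := by
          rw [ea, lprod_cons_erase X hca]
        rw [fa_congr X ea ha', fa_congr X eb hb', fa_ne X hcb l _ hb1, fa_ne X hca l _ ha1,
          fa_ne X hca _ _ ha2, fa_ne X hcb _ _ hb2, e2]
        have ee : (l.erase a).erase b = (l.erase b).erase a := List.erase_comm _ _
        have := front_step (D := X c) (front X b l hb1) (front X a (l.erase b) ha2)
          (front X a l ha1) (front X b (l.erase a) hb2 ≫ eqToHom (by rw [ee]))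
          (by have := ih ha1 hb1 ha2 hb2
              rwa [Arrow.arrow_mk_comp_eqToHom])
        rw [Arrow.arrow_mk_comp_eqToHom] at this
        rw [ee]
        exact this

theorem coh_front (l l' : List ι) (h : l.Perm l') (a : ι) (ha : a ∈ l) (ha' : a ∈ l')
    (h' : (l.erase a).Perm (l'.erase a)) :
    ca X l l' h ⋄ fa X a l' ha' = fa X a l ha ⋄ (ia (X a) * ca X (l.erase a) (l'.erase a) h') := by
  induction l' generalizing l with
  | nil => simp at ha'
  | cons b t ih =>
    have hb : b ∈ l := h.mem_iff.mpr (by simp)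
    have ht : (l.erase b).Perm t := by simpa using h.erase b
    rw [ca_cons X l b t h hb ht]
    by_cases hba : b = a
    · subst hba
      rw [fa_self, acomp_ia]
      · rw [ca_congr X rfl (show (b :: t).erase b = t by simp)]
      · simp [acomp_right, lprod_cons]
    · have e1 : (b :: t).erase a = b :: t.erase a := by simp [hba]
      have ha1 : a ∈ t := by simpa [Ne.symm hba] using ha'
      have ha2 : a ∈ l.erase b := ht.mem_iff.mpr ha1
      have hb2 : b ∈ l.erase a := by simpa [hba] using hb
      have ee : (l.erase a).erase b = (l.erase b).erase a := List.erase_comm _ _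
      have h3 : ((l.erase b).erase a).Perm (t.erase a) := ht.erase a
      rw [fa_ne X hba t _ ha1, ca_congr X rfl e1, ca_cons X _ b _ _ hb2 (ee ▸ h3),
        ca_congr X ee rfl]
      have e := ih (l.erase b) ht ha2 ha1 h3
      have e' := front_comm X (Ne.symm hba) l ha hb ha2 hb2
      have e3 : ta (X b) (X a) * ia (lprod X ((l.erase b).erase a)) ⋄
          (ia (X a) * (ia (X b) * ca X ((l.erase b).erase a) (t.erase a) h3)) =
          (ia (X b) * (ia (X a) * ca X ((l.erase b).erase a) (t.erase a) h3)) ⋄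
          ta (X b) (X a) * ia (lprod X (t.erase a)) := by
        have := mul_swap (ta (X b) (X a)) (ca X ((l.erase b).erase a) (t.erase a) h3)
        simpa only [Arrow.mk_left, Arrow.mk_right, ia_mul, mul_assoc] using this
      have er : lprod X ((l.erase a).erase b) = lprod X ((l.erase b).erase a) := by rw [ee]
      rw [acomp_assoc (by simp) (by simp [acomp_left]),
        ← acomp_assoc (a := ia (X b) * _) (by simp) (by simp [mul_assoc]), ← ia_mul_acomp (by simp),
        e, ia_mul_acomp (by simp), acomp_assoc (by simp) (by simp [mul_assoc]), ← e3,
        ← acomp_assoc (a := ia (X b) * _) (by simp [mul_assoc]) (by simp [mul_assoc]),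
        ← acomp_assoc (by simp [acomp_left]) (by simp [acomp_right, mul_assoc]), e',
        ia_mul_acomp (by simp [er]), acomp_assoc (by simp) (by simp [er])]

/-- Coherence: coherence isomorphisms are closed under composition. -/
theorem coh_trans (l l' l'' : List ι) (h : l.Perm l') (h' : l'.Perm l'') :
    coh X l l' h ≫ coh X l' l'' h' = coh X l l'' (h.trans h') := by
  apply hom_eq
  rw [mk_comp]
  change ca X l l' h ⋄ ca X l' l'' h' = ca X l l'' _
  induction l'' generalizing l l' with
  | nil =>
    obtain rfl := List.perm_nil.mp h'
    obtain rfl := List.perm_nil.mp h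
    rw [ca_nil]; exact ia_acomp rfl
  | cons a t ih =>
    have ha' : a ∈ l' := h'.mem_iff.mpr (by simp)
    have ha : a ∈ l := h.mem_iff.mpr ha'
    have ht : (l'.erase a).Perm t := by simpa using h'.erase a
    rw [ca_cons X _ a t _ ha' ht, ca_cons X _ a t _ ha ((h.erase a).trans ht),
      ← acomp_assoc (by simp) (by simp), coh_front X l l' h a ha ha' (h.erase a),
      acomp_assoc (by simp) (by simp), ← ia_mul_acomp (by simp), ih]

theorem coh_self (l : List ι) (h : l.Perm l) : coh X l l h = 𝟙 _ := by
  apply hom_eq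
  change ca X l l h = ia _
  induction l with
  | nil => rw [ca_nil, lprod_nil]; rfl
  | cons a t ih =>
    have ht : ((a :: t).erase a).Perm t := by simp
    rw [ca_cons X _ a t _ (by simp) ht, fa_self, ca_congr X (show (a :: t).erase a = t by simp) rfl,
      ih, ← ia_mul, ia_acomp (by simp [lprod_cons]), lprod_cons]

theorem fa_append (l m : List ι) (a : ι) (h : a ∈ l) (h' : a ∈ l ++ m) :
    fa X a (l ++ m) h' = fa X a l h * ia (lprod X m) := by
  induction l with
  | nil => simp at h
  | cons b l ih =>
    by_cases hb : b = a
    · subst hb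
      rw [fa_self X b l, fa_congr X (List.cons_append), fa_self, ← ia_mul, ← lprod_append]
      rfl
    · have h1 : a ∈ l := by simpa [Ne.symm hb] using h
      rw [fa_congr X (List.cons_append), fa_ne X hb _ _ (by simp [h1]), fa_ne X hb _ _ h1,
        ih h1, acomp_mul_ia (by simp [mul_assoc]), List.erase_append_left m h1, lprod_append, ia_mul,
        mul_assoc, mul_assoc]

/-- Coherence isomorphisms of concatenated lists. -/
theorem coh_append (l l' m m' : List ι) (h : l.Perm l') (h' : m.Perm m') (h'' : (l ++ m).Perm (l' ++ m')) :
    ca X (l ++ m) (l' ++ m') h'' = ca X l l' h * ca X m m' h' := by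
  induction l' generalizing l with
  | nil =>
    obtain rfl := List.perm_nil.mp h
    rw [ca_nil, one_mul]; rfl
  | cons a t ih =>
    have ha : a ∈ l := h.mem_iff.mpr (by simp)
    have e : (l ++ m).erase a = l.erase a ++ m := List.erase_append_left m ha
    have ht : (l.erase a).Perm t := by simpa using h.erase a
    rw [ca_congr X rfl (List.cons_append), ca_cons X l a t h ha ht,
      ca_cons X _ a _ _ (by simp [ha]) (by rw [e]; exact ht.append h'), ca_congr X e rfl,
      ih _ ht, fa_append X _ _ _ ha, ← mul_assoc]
    have := acomp_mul (a := fa X a l ha) (b := ia (X a) * ca X (l.erase a) t ht)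
      (c := ia (lprod X m)) (d := ca X m m' h') (by simp) (by simp)
    rw [← this, ia_acomp (by simp)]

theorem fa_append_cons (l m : List ι) (a : ι) (h : a ∉ l) (h' : a ∈ l ++ a :: m) :
    fa X a (l ++ a :: m) h' = ta (lprod X l) (X a) * ia (lprod X m) := by
  induction l with
  | nil =>
    rw [fa_congr X (List.nil_append _), fa_self, lprod_nil, ta_one_left, ← ia_mul, lprod_cons]
  | cons b l ih =>
    have hb : b ≠ a := by rintro rfl; simp at h
    have hl : a ∉ l := fun h1 => h (by simp [h1])
    have e : (l ++ a :: m).erase a = l ++ m := by rw [List.erase_append_right _ hl]; simp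
    rw [fa_congr X List.cons_append, fa_ne X hb _ _ (by simp), ih hl, e, lprod_append, lprod_cons,
      ta_mul_left, acomp_mul_ia (by simp [mul_assoc]), ia_mul, mul_assoc, mul_assoc]

/-- The symmetry isomorphism is the coherence isomorphism associated to a block permutation. -/
theorem coh_swap (l m : List ι) (h : ∀ a ∈ l, a ∉ m) (h' : (l ++ m).Perm (m ++ l)) :
    ca X (l ++ m) (m ++ l) h' = ta (lprod X l) (lprod X m) := by
  induction m with
  | nil =>
    rw [lprod_nil, ta_one_right, ca_congr X (List.append_nil l) (List.nil_append l)]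
    exact congrArg Arrow.mk (coh_self X l _)
  | cons a m ih =>
    have ha : a ∉ l := fun h1 => h a h1 (by simp)
    have e : (l ++ a :: m).erase a = l ++ m := by rw [List.erase_append_right _ ha]; simp
    rw [ca_congr X rfl List.cons_append, ca_cons X _ a _ _ (by simp) (by rw [e]; exact List.perm_append_comm),
      ca_congr X e rfl, ih (fun b hb hb' => h b hb (by simp [hb'])), fa_append_cons X _ _ _ ha,
      lprod_cons, ta_mul_right]

theorem fa_congr_fun {Y : ι → C} (l : List ι) (a : ι) (h : a ∈ l) (e : ∀ b ∈ l, X b = Y b) :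
    fa X a l h = fa Y a l h := by
  induction l with
  | nil => simp at h
  | cons b l ih =>
    by_cases hb : b = a
    · subst hb
      rw [fa_self, fa_self, lprod, lprod, List.map_congr_left e]
    · have h1 : a ∈ l := by simpa [Ne.symm hb] using h
      have e1 : lprod X (l.erase a) = lprod Y (l.erase a) := by
        rw [lprod, lprod, List.map_congr_left fun c hc => e c (by simp [List.mem_of_mem_erase hc])]
      rw [fa_ne X hb _ _ h1, fa_ne Y hb _ _ h1, ih h1 fun c hc => e c (by simp [hc]), e b (by simp),
        e a h, e1]

theorem ca_congr_fun {Y : ι → C} (l l' : List ι) (h : l.Perm l') (e : ∀ b ∈ l, X b = Y b) :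
    ca X l l' h = ca Y l l' h := by
  induction l' generalizing l with
  | nil =>
    obtain rfl := List.perm_nil.mp h
    rw [ca_nil, ca_nil]
  | cons a t ih =>
    have ha : a ∈ l := h.mem_iff.mpr (by simp)
    have ht : (l.erase a).Perm t := by simpa using h.erase a
    rw [ca_cons X l a t h ha ht, ca_cons Y l a t h ha ht, fa_congr_fun X l a ha e, e a ha,
      ih _ ht fun b hb => e b (List.mem_of_mem_erase hb)]

theorem lprod_map {ι κ : Type*} (u : ι → κ) (Y : κ → C) (l : List ι) :
    lprod Y (l.map u) = lprod (fun i => Y (u i)) l := by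
  simp [lprod, Function.comp_def]

theorem fa_map {κ : Type*} [DecidableEq κ] (u : ι → κ) (hu : u.Injective) (Y : κ → C) (l : List ι)
    (a : ι) (h : a ∈ l) (h' : u a ∈ l.map u) :
    fa Y (u a) (l.map u) h' = fa (fun i => Y (u i)) a l h := by
  induction l with
  | nil => simp at h
  | cons b l ih =>
    by_cases hb : b = a
    · subst hb
      rw [fa_self, fa_congr Y (List.map_cons), fa_self, ← List.map_cons, lprod_map]
    · have h1 : a ∈ l := by simpa [Ne.symm hb] using h
      rw [fa_congr Y (List.map_cons), fa_ne _ hb _ _ h1, fa_ne Y (hu.ne hb) _ _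
        (List.mem_map_of_mem h1), ih h1, ← List.map_erase hu, lprod_map]

theorem ca_map {κ : Type*} [DecidableEq κ] (u : ι → κ) (hu : u.Injective) (Y : κ → C)
    (l l' : List ι) (h : l.Perm l') (h' : (l.map u).Perm (l'.map u)) :
    ca Y (l.map u) (l'.map u) h' = ca (fun i => Y (u i)) l l' h := by
  induction l' generalizing l with
  | nil =>
    obtain rfl := List.perm_nil.mp h
    rw [ca_nil, ca_congr Y List.map_nil List.map_nil, ca_nil]
  | cons a t ih =>
    have ha : a ∈ l := h.mem_iff.mpr (by simp)
    have ht : (l.erase a).Perm t := by simpa using h.erase a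
    have e : (l.map u).erase (u a) = (l.erase a).map u := (List.map_erase hu _).symm
    rw [ca_congr Y rfl List.map_cons, ca_cons _ l a t h ha ht,
      ca_cons Y _ (u a) _ _ (List.mem_map_of_mem ha) (by rw [e]; exact ht.map u),
      ca_congr Y e rfl, ih _ ht, fa_map u hu Y l a ha]

theorem lprod_filter {ι : Type*} (X : ι → C) (p : ι → Bool) (hp : ∀ i, p i = false → X i = 1) (l : List ι) :
    lprod X (l.filter p) = lprod X l := by
  induction l with
  | nil => simp
  | cons a l ih =>
    cases h : p a with
    | true => rw [List.filter_cons_of_pos h, lprod_cons, lprod_cons, ih]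
    | false => rw [List.filter_cons_of_neg (by simp [h]), lprod_cons, ih, hp a h, one_mul]

theorem fa_filter (p : ι → Bool) (hp : ∀ i, p i = false → X i = 1) (l : List ι)
    (a : ι) (h : a ∈ l) (ha : p a = true) (h' : a ∈ l.filter p) :
    fa X a (l.filter p) h' = fa X a l h := by
  induction l with
  | nil => simp at h
  | cons b l ih =>
    by_cases hb : b = a
    · subst hb
      rw [fa_self, fa_congr X (List.filter_cons_of_pos ha), fa_self,
        ← List.filter_cons_of_pos ha, lprod_filter X p hp]
    · have h1 : a ∈ l := by simpa [Ne.symm hb] using h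
      have h2 : a ∈ l.filter p := by simp [h1, ha]
      have e1 : lprod X ((l.filter p).erase a) = lprod X (l.erase a) := by
        rw [← lprod_filter X p hp (l.erase a), List.erase_filter]
      rw [fa_ne X hb _ _ h1]
      cases h3 : p b with
      | true => rw [fa_congr X (List.filter_cons_of_pos h3), fa_ne X hb _ _ h2, ih h1, e1]
      | false =>
        rw [fa_congr X (List.filter_cons_of_neg (by simp [h3])), ih h1 h2, hp b h3, ta_one_left,
          ia_one, one_mul, ← ia_mul, acomp_ia (by simp)]

theorem fa_unit (l : List ι)
    (a : ι) (h : a ∈ l) (ha : X a = 1) : fa X a l h = ia (lprod X l) := by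
  induction l with
  | nil => simp at h
  | cons b l ih =>
    by_cases hb : b = a
    · subst hb; rw [fa_self]
    · have h1 : a ∈ l := by simpa [Ne.symm hb] using h
      have e : lprod X (l.erase a) = lprod X l := by
        have := congrArg (fun z : Arrow C => z.right) (ih h1)
        simpa [ha] using this
      rw [fa_ne X hb _ _ h1, ih h1, ha, ta_one_right, e, ← ia_mul, lprod_cons]
      exact ia_acomp rfl

/-- Tensor factors that are equal to the unit may be dropped from a coherence isomorphism. -/
theorem ca_filter (p : ι → Bool) (hp : ∀ i, p i = false → X i = 1) (l l' : List ι)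
    (h : l.Perm l') (h' : (l.filter p).Perm (l'.filter p)) :
    ca X (l.filter p) (l'.filter p) h' = ca X l l' h := by
  induction l' generalizing l with
  | nil =>
    obtain rfl := List.perm_nil.mp h
    rfl
  | cons a t ih =>
    have ha : a ∈ l := h.mem_iff.mpr (by simp)
    have ht : (l.erase a).Perm t := by simpa using h.erase a
    have e : (l.filter p).erase a = (l.erase a).filter p := by rw [List.erase_filter]
    rw [ca_cons X l a t h ha ht]
    cases h3 : p a with
    | true =>
      have ha2 : a ∈ l.filter p := by simp [ha, h3]
      rw [ca_congr X rfl (List.filter_cons_of_pos h3), ca_cons X _ a _ _ ha2 (by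
        rw [e]; exact ht.filter p), ca_congr X e rfl, ih _ ht, fa_filter X p hp l a ha h3]
    | false =>
      have e' : l.filter p = (l.erase a).filter p := by
        rw [← List.erase_filter, List.erase_of_not_mem]; simp [h3]
      rw [ca_congr X e' (List.filter_cons_of_neg (by simp [h3])), ih _ ht,
        fa_unit X l a ha (hp a h3), hp a h3, ia_one, one_mul, ia_acomp]
      have := congrArg (fun z : Arrow C => z.right) (fa_unit X l a ha (hp a h3))
      simpa [hp a h3] using this.symm

end CoherenceTheorems

end PermutativeCategory

/-! ### The category of small permutative categories -/

/-- A strict symmetric monoidal functor between permutative categories: it preserves the unit, the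
tensor product of objects and of morphisms, and the symmetry isomorphisms strictly. -/
structure StrictFunctor (C : Type*) (D : Type*) [Category C] [PermutativeCategory C] [Category D]
    [PermutativeCategory D] extends C ⥤ D where
  obj_one : obj 1 = 1
  obj_mul (X Y : C) : obj (X * Y) = obj X * obj Y
  map_tensor {X Y X' Y' : C} (f : X ⟶ Y) (g : X' ⟶ Y') :
    Arrow.mk (map (f ⊗ₚ g)) = Arrow.mk (map f ⊗ₚ map g)
  map_τ (X Y : C) : Arrow.mk (map (PermutativeCategory.τ X Y)) =
    Arrow.mk (PermutativeCategory.τ (obj X) (obj Y))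

namespace StrictFunctor
variable {C D E : Type*} [Category C] [PermutativeCategory C] [Category D]
    [PermutativeCategory D] [Category E] [PermutativeCategory E]

theorem ext_functor {F G : StrictFunctor C D} (h : F.toFunctor = G.toFunctor) : F = G := by
  cases F; cases G; cases h; rfl

/-- The identity. -/
def id (C : Type*) [Category C] [PermutativeCategory C] : StrictFunctor C C where
  toFunctor := 𝟭 C
  obj_one := rfl
  obj_mul _ _ := rfl
  map_tensor _ _ := rfl
  map_τ _ _ := rfl

theorem tensor_congr {X Y X' Y' Z W Z' W' : C} {f : X ⟶ Y} {g : X' ⟶ Y'} {f' : Z ⟶ W}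
    {g' : Z' ⟶ W'} (h : Arrow.mk f = Arrow.mk f') (h' : Arrow.mk g = Arrow.mk g') :
    Arrow.mk (f ⊗ₚ g) = Arrow.mk (f' ⊗ₚ g') := by
  cases h; cases h'; rfl

/-- Composition. -/
def comp (F : StrictFunctor C D) (G : StrictFunctor D E) : StrictFunctor C E where
  toFunctor := F.toFunctor ⋙ G.toFunctor
  obj_one := (congrArg G.obj F.obj_one).trans G.obj_one
  obj_mul X Y := (congrArg G.obj (F.obj_mul X Y)).trans (G.obj_mul _ _)
  map_tensor f g := (map_mk_congr G.toFunctor (F.map_tensor f g)).trans (G.map_tensor _ _)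
  map_τ X Y := (map_mk_congr G.toFunctor (F.map_τ X Y)).trans (G.map_τ _ _)

end StrictFunctor

/-- Bundled small permutative categories. -/
structure PermCat : Type (max (u + 1) (v + 1)) where
  carrier : Type u
  [cat : Category.{v} carrier]
  [perm : PermutativeCategory.{v} carrier]

attribute [instance] PermCat.cat PermCat.perm

/-- The category `PermCat` of small permutative categories and strict symmetric monoidal functors. -/
instance : Category PermCat.{v, u} where
  Hom C D := StrictFunctor C.carrier D.carrier
  id C := StrictFunctor.id C.carrier
  comp F G := F.comp G

/-! ### Categories with an action of `EM` -/

/-- The monoid `M` of injective self maps of `ω = {1, 2, ...}`. -/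
def Inj : Type := {u : ℕ+ → ℕ+ // Function.Injective u}

namespace Inj

instance : CoeFun Inj fun _ => ℕ+ → ℕ+ := ⟨fun u => u.1⟩

theorem injective (u : Inj) : Function.Injective u := u.2

@[ext] theorem ext {u v : Inj} (h : ∀ i, u i = v i) : u = v := Subtype.ext (funext h)

instance : Monoid Inj where
  mul u v := ⟨fun i => u (v i), u.injective.comp v.injective⟩
  one := ⟨fun i => i, Function.injective_id⟩
  mul_assoc _ _ _ := rfl
  one_mul _ := rfl
  mul_one _ := rfl

@[simp] theorem mul_apply (u v : Inj) (i : ℕ+) : (u * v) i = u (v i) := rfl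
@[simp] theorem one_apply (i : ℕ+) : (1 : Inj) i = i := rfl

/-- Finite partial injections extend to invertible elements of `M`. -/
theorem exists_unit (u : Inj) (A : Finset ℕ+) : ∃ s t : Inj, t * s = 1 ∧ s * t = 1 ∧ ∀ a ∈ A, s a = u a := by
  classical
  let B : Finset ℕ+ := A ∪ A.image u
  let e : {x : B // x.1 ∈ A} ≃ {x : B // x.1 ∈ A.image u} := Equiv.ofBijective
    (fun x => ⟨⟨u x.1.1, Finset.mem_union_right _ (Finset.mem_image_of_mem _ x.2)⟩,
      Finset.mem_image_of_mem _ x.2⟩) (by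
      constructor
      · intro x y h
        have h1 : u x.1.1 = u y.1.1 := congrArg (fun z => z.1.1) h
        exact Subtype.ext (Subtype.ext (u.injective h1))
      · rintro ⟨⟨y, hy⟩, hy'⟩
        obtain ⟨a, ha, rfl⟩ := Finset.mem_image.mp hy'
        exact ⟨⟨⟨a, Finset.mem_union_left _ ha⟩, ha⟩, rfl⟩)
  let s : Equiv.Perm ℕ+ := Equiv.Perm.ofSubtype e.extendSubtype
  refine ⟨⟨s, s.injective⟩, ⟨s.symm, s.symm.injective⟩, ext fun i => s.symm_apply_apply i,
    ext fun i => s.apply_symm_apply i, fun a ha => ?_⟩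
  have hB : a ∈ B := Finset.mem_union_left _ ha
  change s a = u a
  have h1 : s a = e.extendSubtype ⟨a, hB⟩ :=
    Equiv.Perm.ofSubtype_apply_of_mem (f := e.extendSubtype) (a := a) hB
  rw [h1, Equiv.extendSubtype_apply_of_mem e ⟨a, hB⟩ ha]
  rfl

/-- An injection fixing a finite set pointwise and avoiding another finite set elsewhere. -/
theorem exists_avoid (A B : Finset ℕ+) : ∃ u : Inj, (∀ a ∈ A, u a = a) ∧ ∀ i ∉ A, u i ∉ A ∪ B := by
  classical
  obtain ⟨N, hN⟩ := (A ∪ B).exists_le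
  refine ⟨⟨fun i => if i ∈ A then i else i + N, ?_⟩, fun a ha => if_pos ha, fun i hi h => ?_⟩
  · intro i j h
    have key : ∀ i j : ℕ+, i ∈ A → i ≠ j + N := fun i j hi h => by
      have := hN i (Finset.mem_union_left _ hi)
      rw [h] at this
      exact absurd this (not_le.mpr (by simpa [add_comm] using PNat.lt_add_right N j))
    dsimp only at h
    split_ifs at h with h1 h2 h2
    · exact h
    · exact absurd h (key _ _ h1)
    · exact absurd h.symm (key _ _ h2)
    · exact add_right_cancel h
  · have : (if i ∈ A then i else i + N) = i + N := if_neg hi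
    have h' := hN _ h
    change (if i ∈ A then i else i + N) ≤ N at h'
    rw [this] at h'
    exact absurd h' (not_le.mpr (by simpa [add_comm] using PNat.lt_add_right N i))

end Inj

/-- A category with a strict action of the monoidal category `EM`, where `EM` is the category with
set of objects `M` and a unique morphism `(v, u) : u ⟶ v` for all `u v : M`. Here `act u` is the
action of `u : M`, and `br v u = [v, u]` is the action of the morphism `(v, u)`. -/
class EMCategory (C : Type u) [Category.{v} C] where
  act : Inj → C ⥤ C
  act_one : act 1 = 𝟭 C
  act_mul (u v : Inj) : act (u * v) = act v ⋙ act u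
  br (v u : Inj) : act u ⟶ act v
  br_self (u : Inj) : br u u = 𝟙 (act u)
  br_comp (w v u : Inj) : br v u ≫ br w v = br w u
  br_mul (v v' u u' : Inj) (X : C) : Arrow.mk ((br (v * v') (u * u')).app X) =
    Arrow.mk ((act u).map ((br v' u').app X) ≫ (br v u).app ((act v').obj X))

namespace EMCategory

section
variable {C : Type u} [Category.{v} C] [EMCategory C]

/-- The object `X` is supported on the finite set `A`. -/
def SupportedOn (X : C) (A : Finset ℕ+) : Prop :=
  ∀ u : Inj, (∀ a ∈ A, u a = a) → (act u).obj X = X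

/-- The support of a finitely supported object: the intersection of all finite sets on which it is
supported. -/
def supp (X : C) : Set ℕ+ := {i | ∀ A : Finset ℕ+, SupportedOn X A → i ∈ A}

theorem act_mul_obj (u v : Inj) (X : C) : (act (u * v)).obj X = (act u).obj ((act v).obj X) := by
  rw [act_mul]; rfl

theorem act_one_obj (X : C) : (act 1).obj X = X := by
  rw [act_one]; rfl

theorem SupportedOn.act_eq {X : C} {A : Finset ℕ+} (h : SupportedOn X A) {u v : Inj}
    (e : ∀ a ∈ A, u a = v a) : (act u).obj X = (act v).obj X := by
  obtain ⟨s, t, ts, st, hs⟩ := u.exists_unit A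
  have key : ∀ w : Inj, (∀ a ∈ A, s a = w a) → (act w).obj X = (act s).obj X := fun w hw => by
    have h1 : (act (t * w)).obj X = X := h _ fun a ha => by
      rw [Inj.mul_apply, ← hw a ha, ← Inj.mul_apply, ts]; rfl
    have h2 : w = s * (t * w) := by rw [← mul_assoc, st, one_mul]
    rw [h2, act_mul_obj, h1]
  rw [key u hs, key v fun a ha => (hs a ha).trans (e a ha)]

theorem SupportedOn.inter {X : C} {A B : Finset ℕ+} (hA : SupportedOn X A) (hB : SupportedOn X B) :
    SupportedOn X (A ∩ B) := by
  classical
  intro u hu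
  obtain ⟨s, t, ts, st, hs⟩ := u.exists_unit B
  have h1 : (act u).obj X = (act s).obj X := hB.act_eq fun a ha => (hs a ha).symm
  obtain ⟨v, hv, hv'⟩ := Inj.exists_avoid A (A.image t)
  have hfix : ∀ a ∈ A ∩ B, s a = a := fun a ha => (hs a (Finset.mem_inter.mp ha).2).trans (hu a ha)
  obtain ⟨w, hw⟩ : ∃ w : Inj, ∀ i, w i = if i ∈ A then i else s (v i) := by
    refine ⟨⟨fun i => if i ∈ A then i else s (v i), fun i j h => ?_⟩, fun i => rfl⟩
    have key : ∀ i j, i ∈ A → j ∉ A → i ≠ s (v j) := fun i j hi hj h => by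
      apply hv' j hj
      refine Finset.mem_union_right _ (Finset.mem_image.mpr ⟨i, hi, ?_⟩)
      rw [h, ← Inj.mul_apply, ts]; rfl
    dsimp only at h
    split_ifs at h with h1 h2 h2
    · exact h
    · exact absurd h (key _ _ h1 h2)
    · exact absurd h.symm (key _ _ h2 h1)
    · exact v.injective (s.injective h)
  have h2 : (act v).obj X = X := hA v hv
  have h3 : (act w).obj X = X := hA w fun a ha => by rw [hw, if_pos ha]
  have h4 : (act (s * v)).obj X = (act w).obj X := hB.act_eq fun b hb => by
    rw [hw, Inj.mul_apply]
    split_ifs with hbA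
    · rw [hv b hbA, hfix b (Finset.mem_inter.mpr ⟨hbA, hb⟩)]
    · rfl
  rw [h3, act_mul_obj, h2] at h4
  rw [h1, h4]

/-- A finitely supported object is supported on its support. -/
theorem exists_supp {X : C} (h : ∃ A, SupportedOn X A) :
    ∃ A : Finset ℕ+, SupportedOn X A ∧ (A : Set ℕ+) = supp X := by
  classical
  obtain ⟨A, hA, hmin⟩ := WellFounded.has_min (measure (fun A : Finset ℕ+ => A.card)).wf
    {A | SupportedOn X A} h
  refine ⟨A, hA, Set.Subset.antisymm (fun i hi B hB => ?_) fun i hi => hi A hA⟩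
  by_contra hiB
  exact hmin (A ∩ B) (hA.inter hB) (Finset.card_lt_card ((Finset.ssubset_iff_of_subset
    Finset.inter_subset_left).mpr ⟨i, hi, fun h => hiB (Finset.mem_inter.mp h).2⟩))

theorem SupportedOn.act {X : C} {A : Finset ℕ+} (h : SupportedOn X A) (u : Inj) :
    SupportedOn ((act u).obj X) (A.image u) := by
  intro w hw
  rw [← act_mul_obj]
  exact h.act_eq fun a ha => hw _ (Finset.mem_image_of_mem _ ha)

theorem SupportedOn.supp_subset {X : C} {A : Finset ℕ+} (h : SupportedOn X A) :
    supp X ⊆ A := fun _ hi => hi A h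

end

end EMCategory

/-! ### Parsummable categories -/

open EMCategory

/-- A parsummable category: a tame `EM`-category with an object `zero` of empty support and an
`EM`-equivariant, strictly unital, commutative and associative sum functor, which is defined on the
full subcategory of those pairs of objects that have disjoint supports. -/
class ParSummable (C : Type u) [Category.{v} C] extends EMCategory C where
  tame (X : C) : ∃ A, SupportedOn X A
  zero : C
  supp_zero : supp zero = ∅
  add (X Y : C) (h : Disjoint (supp X) (supp Y)) : C
  addHom {X Y X' Y' : C} (f : X ⟶ Y) (g : X' ⟶ Y') (h : Disjoint (supp X) (supp X'))
    (h' : Disjoint (supp Y) (supp Y')) : add X X' h ⟶ add Y Y' h'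
  addHom_id (X X' : C) (h : Disjoint (supp X) (supp X')) :
    addHom (𝟙 X) (𝟙 X') h h = 𝟙 (add X X' h)
  addHom_comp {X Y Z X' Y' Z' : C} (f : X ⟶ Y) (g : Y ⟶ Z) (f' : X' ⟶ Y') (g' : Y' ⟶ Z')
    (h : Disjoint (supp X) (supp X')) (h' : Disjoint (supp Y) (supp Y'))
    (h'' : Disjoint (supp Z) (supp Z')) :
    addHom (f ≫ g) (f' ≫ g') h h'' = addHom f f' h h' ≫ addHom g g' h' h''
  act_add (u : Inj) (X Y : C) (h : Disjoint (supp X) (supp Y))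
    (h' : Disjoint (supp ((act u).obj X)) (supp ((act u).obj Y))) :
    (act u).obj (add X Y h) = add ((act u).obj X) ((act u).obj Y) h'
  act_addHom (u : Inj) {X Y X' Y' : C} (f : X ⟶ Y) (g : X' ⟶ Y')
    (h : Disjoint (supp X) (supp X')) (h' : Disjoint (supp Y) (supp Y'))
    (hu : Disjoint (supp ((act u).obj X)) (supp ((act u).obj X')))
    (hu' : Disjoint (supp ((act u).obj Y)) (supp ((act u).obj Y'))) :
    Arrow.mk ((act u).map (addHom f g h h')) =
      Arrow.mk (addHom ((act u).map f) ((act u).map g) hu hu')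
  br_add (v u : Inj) (X Y : C) (h : Disjoint (supp X) (supp Y))
    (hu : Disjoint (supp ((act u).obj X)) (supp ((act u).obj Y)))
    (hv : Disjoint (supp ((act v).obj X)) (supp ((act v).obj Y))) :
    Arrow.mk ((br v u).app (add X Y h)) = Arrow.mk (addHom ((br v u).app X) ((br v u).app Y) hu hv)
  zero_add (X : C) (h : Disjoint (supp zero) (supp X)) : add zero X h = X
  zero_addHom {X Y : C} (f : X ⟶ Y) (h : Disjoint (supp zero) (supp X))
    (h' : Disjoint (supp zero) (supp Y)) : Arrow.mk (addHom (𝟙 zero) f h h') = Arrow.mk f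
  add_comm (X Y : C) (h : Disjoint (supp X) (supp Y)) : add X Y h = add Y X h.symm
  addHom_comm {X Y X' Y' : C} (f : X ⟶ Y) (g : X' ⟶ Y') (h : Disjoint (supp X) (supp X'))
    (h' : Disjoint (supp Y) (supp Y')) :
    Arrow.mk (addHom f g h h') = Arrow.mk (addHom g f h.symm h'.symm)
  add_assoc (X Y Z : C) (hXY : Disjoint (supp X) (supp Y)) (hXZ : Disjoint (supp X) (supp Z))
    (hYZ : Disjoint (supp Y) (supp Z)) (h : Disjoint (supp (add X Y hXY)) (supp Z))
    (h' : Disjoint (supp X) (supp (add Y Z hYZ))) :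
    add (add X Y hXY) Z h = add X (add Y Z hYZ) h'
  addHom_assoc {X Y Z X' Y' Z' : C} (f : X ⟶ X') (g : Y ⟶ Y') (k : Z ⟶ Z')
    (hXY : Disjoint (supp X) (supp Y)) (hXZ : Disjoint (supp X) (supp Z))
    (hYZ : Disjoint (supp Y) (supp Z)) (h : Disjoint (supp (add X Y hXY)) (supp Z))
    (h' : Disjoint (supp X) (supp (add Y Z hYZ)))
    (hXY' : Disjoint (supp X') (supp Y')) (hXZ' : Disjoint (supp X') (supp Z'))
    (hYZ' : Disjoint (supp Y') (supp Z')) (k₁ : Disjoint (supp (add X' Y' hXY')) (supp Z'))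
    (k₂ : Disjoint (supp X') (supp (add Y' Z' hYZ'))) :
    Arrow.mk (addHom (addHom f g hXY hXY') k h k₁) =
      Arrow.mk (addHom f (addHom g k hYZ hYZ') h' k₂)

namespace ParSummable

section
variable {C : Type u} [Category.{v} C] [ParSummable C]

theorem supportedOn_supp (X : C) : ∃ A : Finset ℕ+, SupportedOn X A ∧ (A : Set ℕ+) = supp X :=
  exists_supp (tame X)

theorem supp_act_subset (u : Inj) (X : C) : supp ((act u).obj X) ⊆ Set.range u := by
  classical
  obtain ⟨A, hA, -⟩ := supportedOn_supp X
  refine (hA.act u).supp_subset.trans fun i hi => ?_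
  simp only [Finset.coe_image, Set.mem_image] at hi
  obtain ⟨j, -, rfl⟩ := hi
  exact ⟨j, rfl⟩

theorem disjoint_act (u : Inj) {X Y : C} (h : Disjoint (supp X) (supp Y)) :
    Disjoint (supp ((act u).obj X)) (supp ((act u).obj Y)) := by
  classical
  obtain ⟨A, hA, eA⟩ := supportedOn_supp X
  obtain ⟨B, hB, eB⟩ := supportedOn_supp Y
  refine Set.disjoint_of_subset (hA.act u).supp_subset (hB.act u).supp_subset ?_
  rw [Finset.coe_image, Finset.coe_image, eA, eB]
  exact (Set.disjoint_image_iff u.injective).mpr h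

theorem supp_add_subset (X Y : C) (h : Disjoint (supp X) (supp Y)) :
    supp (add X Y h) ⊆ supp X ∪ supp Y := by
  classical
  obtain ⟨A, hA, eA⟩ := supportedOn_supp X
  obtain ⟨B, hB, eB⟩ := supportedOn_supp Y
  rw [← eA, ← eB, ← Finset.coe_union]
  refine SupportedOn.supp_subset fun u hu => ?_
  rw [act_add u X Y h (disjoint_act u h)]
  have h1 := hA u fun a ha => hu a (Finset.mem_union_left _ ha)
  have h2 := hB u fun a ha => hu a (Finset.mem_union_right _ ha)
  congr 1

end

end ParSummable

/-- A morphism of parsummable categories: an `EM`-equivariant functor strictly preserving the unit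
and the sum. -/
structure ParFunctor (C : Type*) (D : Type*) [Category C] [ParSummable C] [Category D]
    [ParSummable D] extends C ⥤ D where
  act_comp (u : Inj) : act u ⋙ toFunctor = toFunctor ⋙ act u
  map_br (v u : Inj) (X : C) :
    Arrow.mk (map ((br v u).app X)) = Arrow.mk ((br v u).app (obj X))
  obj_zero : obj ParSummable.zero = ParSummable.zero
  obj_add (X Y : C) (h : Disjoint (supp X) (supp Y)) (h' : Disjoint (supp (obj X)) (supp (obj Y))) :
    obj (ParSummable.add X Y h) = ParSummable.add (obj X) (obj Y) h'
  map_addHom {X Y X' Y' : C} (f : X ⟶ Y) (g : X' ⟶ Y') (h : Disjoint (supp X) (supp X'))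
    (h' : Disjoint (supp Y) (supp Y')) (k : Disjoint (supp (obj X)) (supp (obj X')))
    (k' : Disjoint (supp (obj Y)) (supp (obj Y'))) :
    Arrow.mk (map (ParSummable.addHom f g h h')) =
      Arrow.mk (ParSummable.addHom (map f) (map g) k k')

namespace ParFunctor
variable {C D E : Type*} [Category C] [ParSummable C] [Category D]
    [ParSummable D] [Category E] [ParSummable E]

theorem ext_functor {F G : ParFunctor C D} (h : F.toFunctor = G.toFunctor) : F = G := by
  cases F; cases G; cases h; rfl

theorem obj_act (F : ParFunctor C D) (u : Inj) (X : C) :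
    F.obj ((act u).obj X) = (act u).obj (F.obj X) :=
  Functor.congr_obj (F.act_comp u) X

theorem supp_obj_subset (F : ParFunctor C D) (X : C) : supp (F.obj X) ⊆ supp X := by
  obtain ⟨A, hA, eA⟩ := ParSummable.supportedOn_supp X
  rw [← eA]
  exact SupportedOn.supp_subset fun u hu => by rw [← F.obj_act, hA u hu]

theorem disjoint_obj (F : ParFunctor C D) {X Y : C} (h : Disjoint (supp X) (supp Y)) :
    Disjoint (supp (F.obj X)) (supp (F.obj Y)) :=
  Set.disjoint_of_subset (F.supp_obj_subset X) (F.supp_obj_subset Y) h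

/-- The identity. -/
def id (C : Type*) [Category C] [ParSummable C] : ParFunctor C C where
  toFunctor := 𝟭 C
  act_comp _ := rfl
  map_br _ _ _ := rfl
  obj_zero := rfl
  obj_add _ _ _ _ := rfl
  map_addHom _ _ _ _ _ _ := rfl

/-- Composition. -/
def comp (F : ParFunctor C D) (G : ParFunctor D E) : ParFunctor C E where
  toFunctor := F.toFunctor ⋙ G.toFunctor
  act_comp u := by
    rw [← Functor.assoc, F.act_comp, Functor.assoc, G.act_comp, Functor.assoc]
  map_br v u X := (map_mk_congr G.toFunctor (F.map_br v u X)).trans (G.map_br _ _ _)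
  obj_zero := (congrArg G.obj F.obj_zero).trans G.obj_zero
  obj_add X Y h _ :=
    (congrArg G.obj (F.obj_add X Y h (F.disjoint_obj h))).trans (G.obj_add _ _ _ _)
  map_addHom f g h h' k k' :=
    (map_mk_congr G.toFunctor (F.map_addHom f g h h' (F.disjoint_obj h) (F.disjoint_obj h'))).trans
      (G.map_addHom _ _ _ _ _ _)

end ParFunctor

/-- Bundled small parsummable categories. -/
structure ParSumCat : Type (max (u + 1) (v + 1)) where
  carrier : Type u
  [cat : Category.{v} carrier]
  [par : ParSummable.{v} carrier]

attribute [instance] ParSumCat.cat ParSumCat.par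

/-- The category `ParSumCat` of small parsummable categories and their morphisms. -/
instance : Category ParSumCat.{v, u} where
  Hom C D := ParFunctor C.carrier D.carrier
  id C := ParFunctor.id C.carrier
  comp F G := F.comp G

/-! ### Generalized sums in parsummable categories -/

/-- The injections in the list have pairwise disjoint images. -/
abbrev PD (φ : List Inj) : Prop := φ.Pairwise fun u v : Inj => Disjoint (Set.range u) (Set.range v)

/-- The union of the images of the injections in the list. -/
def im (φ : List Inj) : Set ℕ+ := {i | ∃ u ∈ φ, i ∈ Set.range u}

theorem im_cons (u : Inj) (φ : List Inj) : im (u :: φ) = Set.range u ∪ im φ := by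
  ext i; simp [im]

theorem im_append (φ θ : List Inj) : im (φ ++ θ) = im φ ∪ im θ := by
  ext i; simp [im, or_and_right, exists_or]

theorem pd_cons {u : Inj} {φ : List Inj} : PD (u :: φ) ↔ Disjoint (Set.range u) (im φ) ∧ PD φ := by
  rw [PD, List.pairwise_cons]
  refine and_congr_left fun _ => ⟨fun h => Set.disjoint_left.mpr ?_, fun h v hv => ?_⟩
  · rintro i hi ⟨v, hv, hiv⟩
    exact Set.disjoint_left.mp (h v hv) hi hiv
  · exact h.mono_right (fun i hi => ⟨v, hv, hi⟩ : Set.range v ⊆ im φ)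

theorem pd_append {φ θ : List Inj} : PD (φ ++ θ) ↔ PD φ ∧ PD θ ∧ Disjoint (im φ) (im θ) := by
  rw [PD, List.pairwise_append]
  refine and_congr_right fun _ => and_congr_right fun _ => ⟨fun h => Set.disjoint_left.mpr ?_,
    fun h u hu v hv => ?_⟩
  · rintro i ⟨u, hu, hi⟩ ⟨v, hv, hiv⟩
    exact Set.disjoint_left.mp (h u hu v hv) hi hiv
  · exact h.mono (fun i hi => ⟨u, hu, hi⟩ : Set.range u ⊆ im φ)
      (fun i hi => ⟨v, hv, hi⟩ : Set.range v ⊆ im θ)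

section Push
variable {C : Type u} [Category.{v} C] [ParSummable.{v} C]

open ParSummable

theorem add_congr {X Y X' Y' : C} (e : X = X') (e' : Y = Y') (h : Disjoint (supp X) (supp Y)) :
    add X Y h = add X' Y' (e ▸ e' ▸ h) := by subst e; subst e'; rfl

theorem addHom_congr {X Y Z W X' Y' Z' W' : C} {f : X ⟶ Y} {g : Z ⟶ W} {f' : X' ⟶ Y'}
    {g' : Z' ⟶ W'} (e : Arrow.mk f = Arrow.mk f') (e' : Arrow.mk g = Arrow.mk g')
    (h : Disjoint (supp X) (supp Z)) (k : Disjoint (supp Y) (supp W))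
    (h' : Disjoint (supp X') (supp Z')) (k' : Disjoint (supp Y') (supp W')) :
    Arrow.mk (addHom f g h k) = Arrow.mk (addHom f' g' h' k') := by
  cases e; cases e'; rfl

/-- Auxiliary version of `push`, together with a bound on the support. -/
def pushAux : (φ : List Inj) → PD φ → List C → {Y : C // supp Y ⊆ im φ}
  | [], _, _ => ⟨zero, by simp [supp_zero]⟩
  | _ :: _, _, [] => ⟨zero, by simp [supp_zero]⟩
  | u :: φ, h, x :: X =>
    ⟨add ((act u).obj x) (pushAux φ (pd_cons.mp h).2 X).1
      (Disjoint.mono (supp_act_subset u x) (pushAux φ (pd_cons.mp h).2 X).2 (pd_cons.mp h).1), by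
      rw [im_cons]
      exact (supp_add_subset _ _ _).trans (Set.union_subset_union (supp_act_subset u x)
        (pushAux φ (pd_cons.mp h).2 X).2)⟩
  termination_by structural φ => φ

/-- The generalized sum `u₁_*(X₁) + ... + uₘ_*(Xₘ)`, for a list of objects and a list (of the same
length) of injections with pairwise disjoint images. -/
def push (φ : List Inj) (h : PD φ) (X : List C) : C := (pushAux φ h X).1

theorem supp_push (φ : List Inj) (h : PD φ) (X : List C) : supp (push φ h X) ⊆ im φ :=
  (pushAux φ h X).2

theorem push_nil (h : PD []) (X : List C) : push [] h X = zero := rfl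

theorem disjoint_cons {u : Inj} {φ : List Inj} (h : PD (u :: φ)) (x : C) (X : List C) :
    Disjoint (supp ((act u).obj x)) (supp (push φ (pd_cons.mp h).2 X)) :=
  Disjoint.mono (supp_act_subset u x) (supp_push φ _ X) (pd_cons.mp h).1

theorem push_cons {u : Inj} {φ : List Inj} (h : PD (u :: φ)) (x : C) (X : List C) :
    push (u :: φ) h (x :: X) = add ((act u).obj x) (push φ (pd_cons.mp h).2 X)
      (disjoint_cons h x X) := rfl

theorem disjoint_push {φ θ : List Inj} (h : PD φ) (h' : PD θ) (d : Disjoint (im φ) (im θ))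
    (X Y : List C) : Disjoint (supp (push φ h X)) (supp (push θ h' Y)) :=
  d.mono (supp_push φ h X) (supp_push θ h' Y)

theorem push_append (φ θ : List Inj) (X Y : List C) (l : φ.length = X.length) (h : PD (φ ++ θ))
    (hφ : PD φ) (hθ : PD θ) (d : Disjoint (supp (push φ hφ X)) (supp (push θ hθ Y))) :
    push (φ ++ θ) h (X ++ Y) = add (push φ hφ X) (push θ hθ Y) d := by
  induction φ generalizing X with
  | nil =>
    obtain rfl : X = [] := by simpa using l.symm
    exact (zero_add _ _).symm
  | cons u φ ih =>
    obtain ⟨x, X, rfl⟩ : ∃ x X', X = x :: X' := by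
      cases X with
      | nil => simp at l
      | cons x X => exact ⟨x, X, rfl⟩
    have h1 := pd_append.mp h
    rw [im_cons] at h1
    have d2 := (h1.2.2.mono_left Set.subset_union_right)
    have d1 := (h1.2.2.mono_left Set.subset_union_left)
    have e := ih X (by simpa using l) (pd_cons.mp h).2 (pd_cons.mp hφ).2 (disjoint_push _ _ d2 _ _)
    refine (add_congr (X := (act u).obj x) rfl e (disjoint_cons (φ := φ ++ θ) h x (X ++ Y))).trans ?_
    exact (ParSummable.add_assoc _ _ _ (disjoint_cons hφ x X)
      (Disjoint.mono (supp_act_subset u x) (supp_push θ _ Y) d1) _ _ _).symm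

/-- The structure isomorphism `[ψ, φ]` between generalized sums, i.e. the sum of the
morphisms `[vᵢ, uᵢ]` at `Xᵢ`. -/
def brL : (X : List C) → (φ ψ : List Inj) → (hφ : PD φ) → (hψ : PD ψ) → φ.length = X.length →
    ψ.length = X.length → (push φ hφ X ⟶ push ψ hψ X)
  | [], [], [], _, _, _, _ => 𝟙 _
  | x :: X, u :: φ, v :: ψ, hφ, hψ, lφ, lψ =>
    addHom ((br v u).app x) (brL X φ ψ (pd_cons.mp hφ).2 (pd_cons.mp hψ).2 (by simpa using lφ)
      (by simpa using lψ)) (disjoint_cons hφ x X) (disjoint_cons hψ x X)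
  | _ :: _, [], _, _, _, l, _ => by simp at l
  | _ :: _, _ :: _, [], _, _, _, l => by simp at l
  | [], _ :: _, _, _, _, l, _ => by simp at l
  | [], [], _ :: _, _, _, _, l => by simp at l

theorem brL_nil (hφ : PD []) (hψ : PD []) (lφ lψ) :
    brL ([] : List C) [] [] hφ hψ lφ lψ = 𝟙 (push [] hφ []) := by simp [brL]

theorem brL_cons (x : C) (X : List C) (u v : Inj) (φ ψ : List Inj) (hφ : PD (u :: φ))
    (hψ : PD (v :: ψ)) (lφ : (u :: φ).length = (x :: X).length)
    (lψ : (v :: ψ).length = (x :: X).length) (lφ' : φ.length = X.length) (lψ' : ψ.length = X.length) :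
    brL (x :: X) (u :: φ) (v :: ψ) hφ hψ lφ lψ =
      addHom ((br v u).app x) (brL X φ ψ (pd_cons.mp hφ).2 (pd_cons.mp hψ).2 lφ' lψ')
        (disjoint_cons hφ x X) (disjoint_cons hψ x X) := by rw [brL]

theorem brL_self (X : List C) (φ : List Inj) (h h' : PD φ) (l l' : φ.length = X.length) :
    brL X φ φ h h' l l' = 𝟙 _ := by
  induction X generalizing φ with
  | nil =>
    obtain rfl : φ = [] := by simpa using l
    exact brL_nil _ _ _ _
  | cons x X ih =>
    cases φ with
    | nil => simp at l
    | cons u φ =>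
      have l1 : φ.length = X.length := by simpa using l
      rw [brL_cons x X u u φ φ h h' l l' l1 l1, ih, br_self, NatTrans.id_app, addHom_id]
      rfl

theorem brL_comp (X : List C) (φ ψ θ : List Inj) (hφ : PD φ) (hψ : PD ψ) (hθ : PD θ)
    (lφ : φ.length = X.length) (lψ : ψ.length = X.length) (lθ : θ.length = X.length) :
    brL X φ ψ hφ hψ lφ lψ ≫ brL X ψ θ hψ hθ lψ lθ = brL X φ θ hφ hθ lφ lθ := by
  induction X generalizing φ ψ θ with
  | nil =>
    obtain rfl : φ = [] := by simpa using lφ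
    obtain rfl : ψ = [] := by simpa using lψ
    obtain rfl : θ = [] := by simpa using lθ
    rw [brL_nil]; exact Category.id_comp _
  | cons x X ih =>
    cases φ with
    | nil => simp at lφ
    | cons u φ =>
    cases ψ with
    | nil => simp at lψ
    | cons v ψ =>
    cases θ with
    | nil => simp at lθ
    | cons w θ =>
      have l1 : φ.length = X.length := by simpa using lφ
      have l2 : ψ.length = X.length := by simpa using lψ
      have l3 : θ.length = X.length := by simpa using lθ
      rw [brL_cons x X u v φ ψ hφ hψ lφ lψ l1 l2, brL_cons x X v w ψ θ hψ hθ lψ lθ l2 l3,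
        brL_cons x X u w φ θ hφ hθ lφ lθ l1 l3]
      refine (addHom_comp _ _ _ _ _ _ _).symm.trans ?_
      rw [ih, ← br_comp w v u]
      rfl

theorem brL_congr {X X' : List C} {φ φ' ψ ψ' : List Inj} (e : X = X') (e₁ : φ = φ') (e₂ : ψ = ψ')
    (hφ : PD φ) (hψ : PD ψ) (lφ : φ.length = X.length) (lψ : ψ.length = X.length)
    (hφ' : PD φ') (hψ' : PD ψ') (lφ' : φ'.length = X'.length) (lψ' : ψ'.length = X'.length) :
    Arrow.mk (brL X φ ψ hφ hψ lφ lψ) = Arrow.mk (brL X' φ' ψ' hφ' hψ' lφ' lψ') := by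
  subst e; subst e₁; subst e₂; rfl

theorem brL_append (X Y : List C) (φ ψ θ ρ : List Inj) (lφ : φ.length = X.length)
    (lψ : ψ.length = X.length) (lθ : θ.length = Y.length) (lρ : ρ.length = Y.length)
    (h : PD (φ ++ θ)) (h' : PD (ψ ++ ρ)) (l : (φ ++ θ).length = (X ++ Y).length)
    (l' : (ψ ++ ρ).length = (X ++ Y).length) (hφ : PD φ) (hψ : PD ψ) (hθ : PD θ) (hρ : PD ρ)
    (d : Disjoint (supp (push φ hφ X)) (supp (push θ hθ Y)))
    (d' : Disjoint (supp (push ψ hψ X)) (supp (push ρ hρ Y))) :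
    Arrow.mk (brL (X ++ Y) (φ ++ θ) (ψ ++ ρ) h h' l l') =
      Arrow.mk (addHom (brL X φ ψ hφ hψ lφ lψ) (brL Y θ ρ hθ hρ lθ lρ) d d') := by
  induction X generalizing φ ψ with
  | nil =>
    obtain rfl : φ = [] := by simpa using lφ
    obtain rfl : ψ = [] := by simpa using lψ
    rw [brL_nil]
    exact (zero_addHom _ _ _).symm
  | cons x X ih =>
    cases φ with
    | nil => simp at lφ
    | cons u φ =>
    cases ψ with
    | nil => simp at lψ
    | cons v ψ =>
      have l1 : φ.length = X.length := by simpa using lφ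
      have l2 : ψ.length = X.length := by simpa using lψ
      have h1 := (pd_append.mp h).2.2
      have h2 := (pd_append.mp h').2.2
      rw [im_cons] at h1 h2
      have da := h1.mono_left Set.subset_union_left
      have db := h1.mono_left Set.subset_union_right
      have da' := h2.mono_left Set.subset_union_left
      have db' := h2.mono_left Set.subset_union_right
      have e := ih φ ψ l1 l2 (pd_cons.mp h).2 (pd_cons.mp h').2 (by simp [l1, lθ]) (by simp [l2, lρ])
        (pd_cons.mp hφ).2 (pd_cons.mp hψ).2 (disjoint_push _ _ db _ _) (disjoint_push _ _ db' _ _)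
      refine (congrArg Arrow.mk (brL_cons x (X ++ Y) u v (φ ++ θ) (ψ ++ ρ) h h' l l'
        (by simp [l1, lθ]) (by simp [l2, lρ]))).trans ?_
      rw [brL_cons x X u v φ ψ hφ hψ lφ lψ l1 l2]
      have d1 := Disjoint.mono (supp_act_subset u x)
        (supp_add_subset _ _ (disjoint_push (pd_cons.mp hφ).2 hθ db X Y))
        (Set.disjoint_union_right.mpr ⟨(pd_cons.mp hφ).1.mono_right (supp_push φ _ X),
          da.mono_right (supp_push θ hθ Y)⟩)
      have d2 := Disjoint.mono (supp_act_subset v x)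
        (supp_add_subset _ _ (disjoint_push (pd_cons.mp hψ).2 hρ db' X Y))
        (Set.disjoint_union_right.mpr ⟨(pd_cons.mp hψ).1.mono_right (supp_push ψ _ X),
          da'.mono_right (supp_push ρ hρ Y)⟩)
      refine (addHom_congr rfl e _ _ d1 d2).trans ?_
      exact (addHom_assoc _ _ _ (disjoint_cons hφ x X) (Disjoint.mono (supp_act_subset u x)
        (supp_push θ _ Y) da) _ _ _ (disjoint_cons hψ x X) (Disjoint.mono (supp_act_subset v x)
        (supp_push ρ _ Y) da') _ _ _).symm

end Push

section PushMap
variable {C D : Type*} [Category C] [ParSummable C] [Category D] [ParSummable D]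

theorem push_map (F : ParFunctor C D) (φ : List Inj) (h : PD φ) (X : List C)
    (l : φ.length = X.length) : F.obj (push φ h X) = push φ h (X.map F.obj) := by
  induction φ generalizing X with
  | nil => exact F.obj_zero
  | cons u φ ih =>
    cases X with
    | nil => simp at l
    | cons x X =>
      have l1 : φ.length = X.length := by simpa using l
      refine (F.obj_add _ _ _ (F.disjoint_obj (disjoint_cons h x X))).trans ?_
      exact add_congr (F.obj_act u x) (ih (pd_cons.mp h).2 X l1) _

theorem brL_map (F : ParFunctor C D) (X : List C) (φ ψ : List Inj) (hφ : PD φ) (hψ : PD ψ)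
    (lφ : φ.length = X.length) (lψ : ψ.length = X.length)
    (lφ' : φ.length = (X.map F.obj).length) (lψ' : ψ.length = (X.map F.obj).length) :
    Arrow.mk (F.map (brL X φ ψ hφ hψ lφ lψ)) = Arrow.mk (brL (X.map F.obj) φ ψ hφ hψ lφ' lψ') := by
  induction X generalizing φ ψ with
  | nil =>
    obtain rfl : φ = [] := by simpa using lφ
    obtain rfl : ψ = [] := by simpa using lψ
    rw [brL_nil]
    refine Eq.trans ?_ (congrArg Arrow.mk (brL_nil (C := D) hφ hψ rfl rfl).symm)
    rw [F.map_id]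
    exact congrArg (fun Z => Arrow.mk (𝟙 Z)) F.obj_zero
  | cons x X ih =>
    cases φ with
    | nil => simp at lφ
    | cons u φ =>
    cases ψ with
    | nil => simp at lψ
    | cons v ψ =>
      have l1 : φ.length = X.length := by simpa using lφ
      have l2 : ψ.length = X.length := by simpa using lψ
      rw [brL_cons x X u v φ ψ hφ hψ lφ lψ l1 l2]
      refine (F.map_addHom _ _ _ _ (F.disjoint_obj (disjoint_cons hφ x X))
        (F.disjoint_obj (disjoint_cons hψ x X))).trans ?_
      refine Eq.trans ?_ (congrArg Arrow.mk (brL_cons (F.obj x) (X.map F.obj) u v φ ψ hφ hψ lφ' lψ'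
        (by simpa using l1) (by simpa using l2)).symm)
      exact addHom_congr (F.map_br v u x) (ih φ ψ (pd_cons.mp hφ).2 (pd_cons.mp hψ).2 l1 l2 _ _)
        _ _ _ _

end PushMap

/-! ### The permutative category `Σ C` -/

/-- An injection `φ : {1, ..., m} × ω → ω`, where `m` is the length of `X`. It is encoded as the list
of the injections `φ(i, -) : ω → ω`, which have pairwise disjoint images; see `Frame.equiv`. -/
@[ext] structure Frame {α : Type*} (X : List α) where
  list : List Inj
  length_eq : list.length = X.length
  pd : PD list

namespace Frame

section
variable {α : Type*} {X Y : List α}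

/-- The injection `φ(i, -)`. -/
def app (φ : Frame X) (i : Fin X.length) : Inj := φ.list.get (i.cast φ.length_eq.symm)

/-- The injection `e(i, -)`. -/
def row {m : ℕ} (e : Fin m × ℕ+ ↪ ℕ+) (i : Fin m) : Inj :=
  ⟨fun a => e (i, a), fun _ _ h => (Prod.mk.inj (e.injective h)).2⟩

/-- Frames are the same thing as injections `{1, ..., m} × ω → ω`. -/
def equiv (X : List α) : Frame X ≃ (Fin X.length × ℕ+ ↪ ℕ+) where
  toFun φ := ⟨fun p => φ.app p.1 p.2, by
    rintro ⟨i, a⟩ ⟨j, b⟩ h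
    have key : ∀ (i j : Fin X.length), i < j → ∀ a b, φ.app i a ≠ φ.app j b := fun i j hij a b e =>
      Set.disjoint_left.mp (List.pairwise_iff_get.mp φ.pd _ _
        (show i.cast φ.length_eq.symm < j.cast φ.length_eq.symm from hij)) ⟨a, rfl⟩ ⟨b, e.symm⟩
    rcases lt_trichotomy i j with hij | rfl | hij
    · exact absurd h (key i j hij a b)
    · exact Prod.ext rfl ((φ.app i).injective h)
    · exact absurd h.symm (key j i hij b a)⟩
  invFun e := ⟨List.ofFn (row e), by simp, by
      rw [PD, List.pairwise_ofFn]
      intro i j hij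
      refine Set.disjoint_left.mpr ?_
      rintro _ ⟨a, rfl⟩ ⟨b, hb⟩
      exact hij.ne (congrArg Prod.fst (e.injective hb)).symm⟩
  left_inv φ := by
    apply Frame.ext
    refine List.ext_get (by simp [φ.length_eq]) fun n h₁ h₂ => ?_
    rw [List.get_ofFn]
    rfl
  right_inv e := by
    apply DFunLike.ext
    rintro ⟨i, a⟩
    change (List.get (List.ofFn (row e)) _) a = e (i, a)
    rw [List.get_ofFn]
    rfl

/-- The union of the images of the `φ(i, -)`, i.e. the image of `φ`. -/
abbrev image (φ : Frame X) : Set ℕ+ := im φ.list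

/-- The injection `φ + θ` with domain `{1, ..., m + n} × ω`, for injections `φ` and `θ` with disjoint
images and domains `{1, ..., m} × ω` and `{1, ..., n} × ω`. -/
def append (φ : Frame X) (θ : Frame Y) (d : Disjoint φ.image θ.image) : Frame (X ++ Y) :=
  ⟨φ.list ++ θ.list, by simp [φ.length_eq, θ.length_eq], pd_append.mpr ⟨φ.pd, θ.pd, d⟩⟩

theorem image_append (φ : Frame X) (θ : Frame Y) (d : Disjoint φ.image θ.image) :
    (φ.append θ d).image = φ.image ∪ θ.image := im_append _ _

/-- The composite of `φ` with an injection `e : ω → ω`. -/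
def shift (e : Inj) (φ : Frame X) : Frame X :=
  ⟨φ.list.map (e * ·), by simp [φ.length_eq], by
    rw [PD, List.pairwise_map]
    refine φ.pd.imp fun {u v} h => ?_
    refine Set.disjoint_left.mpr ?_
    rintro _ ⟨a, rfl⟩ ⟨b, hb⟩
    exact Set.disjoint_left.mp h ⟨a, rfl⟩ ⟨b, e.injective hb⟩⟩

theorem image_shift (e : Inj) (φ : Frame X) : (φ.shift e).image ⊆ Set.range e := by
  rintro i ⟨u, hu, a, rfl⟩
  obtain ⟨v, -, rfl⟩ := List.mem_map.mp hu
  exact ⟨v a, rfl⟩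

end

/-- The even numbers in `ω`. -/
def e₀ : Inj := ⟨fun i => 2 * i, fun i j h => by simpa using h⟩
/-- The odd numbers in `ω`, except for `1`. -/
def e₁ : Inj := ⟨fun i => 2 * i + 1, fun i j h => by simpa using h⟩

theorem disjoint_e : Disjoint (Set.range e₀) (Set.range e₁) := by
  refine Set.disjoint_left.mpr ?_
  rintro _ ⟨a, rfl⟩ ⟨b, hb⟩
  have h : ((2 * b + 1 : ℕ+) : ℕ) = ((2 * a : ℕ+) : ℕ) := congrArg PNat.val hb
  push_cast at h
  omega

theorem disjoint_shift {α : Type*} {X Y : List α} (φ : Frame X) (θ : Frame Y) :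
    Disjoint (φ.shift e₀).image (θ.shift e₁).image :=
  disjoint_e.mono (image_shift _ _) (image_shift _ _)

/-- Some injection `{1, ..., m} × ω → ω`. -/
def default {α : Type*} : (X : List α) → Frame X
  | [] => ⟨[], rfl, List.Pairwise.nil⟩
  | x :: X => (shift e₀ ⟨[1], rfl, by simp [PD]⟩ : Frame [x]).append ((default X).shift e₁)
      (disjoint_shift _ _)

section
variable {C : Type u} [Category.{v} C] [ParSummable.{v} C] {X Y : List C}

/-- The generalized sum `φ_*(X)`. -/
def sum (φ : Frame X) : C := push φ.list φ.pd X

/-- The structure isomorphism `[ψ, φ]` at `X`. -/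
def br (ψ φ : Frame X) : φ.sum ⟶ ψ.sum :=
  brL X φ.list ψ.list φ.pd ψ.pd φ.length_eq ψ.length_eq

theorem br_self (φ : Frame X) : br φ φ = 𝟙 φ.sum := brL_self _ _ _ _ _ _

theorem br_comp (φ ψ θ : Frame X) : br ψ φ ≫ br θ ψ = br θ φ := brL_comp _ _ _ _ _ _ _ _ _ _

theorem br_comp_assoc (φ ψ θ : Frame X) {Z : C} (h : θ.sum ⟶ Z) :
    br ψ φ ≫ br θ ψ ≫ h = br θ φ ≫ h := by
  rw [← Category.assoc, br_comp]

theorem disjoint_sum {φ : Frame X} {θ : Frame Y} (d : Disjoint φ.image θ.image) :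
    Disjoint (supp φ.sum) (supp θ.sum) := disjoint_push _ _ d _ _

theorem sum_append (φ : Frame X) (θ : Frame Y) (d : Disjoint φ.image θ.image) :
    (φ.append θ d).sum = ParSummable.add φ.sum θ.sum (disjoint_sum d) :=
  push_append _ _ _ _ φ.length_eq _ _ _ _

/-- The sum `f + g` of morphisms between generalized sums. -/
def addF {X' Y' : List C} {φ : Frame X} {ψ : Frame Y} {θ : Frame X'} {ρ : Frame Y'}
    (f : φ.sum ⟶ ψ.sum) (g : θ.sum ⟶ ρ.sum) (d : Disjoint φ.image θ.image)
    (d' : Disjoint ψ.image ρ.image) : (φ.append θ d).sum ⟶ (ψ.append ρ d').sum :=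
  eqToHom (sum_append φ θ d) ≫ ParSummable.addHom f g (disjoint_sum d) (disjoint_sum d') ≫
    eqToHom (sum_append ψ ρ d').symm

section
variable {Z X' Y' Z' : List C} {φ : Frame X} {ψ : Frame Y} {ζ : Frame Z} {θ : Frame X'}
  {ρ : Frame Y'} {η : Frame Z'}

theorem mk_addF (f : φ.sum ⟶ ψ.sum) (g : θ.sum ⟶ ρ.sum) (d : Disjoint φ.image θ.image)
    (d' : Disjoint ψ.image ρ.image) : Arrow.mk (addF f g d d') =
      Arrow.mk (ParSummable.addHom f g (disjoint_sum d) (disjoint_sum d')) := by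
  simp [addF]

theorem addF_comp (f : φ.sum ⟶ ψ.sum) (g : θ.sum ⟶ ρ.sum) (f' : ψ.sum ⟶ ζ.sum)
    (g' : ρ.sum ⟶ η.sum) (d : Disjoint φ.image θ.image) (d' : Disjoint ψ.image ρ.image)
    (d'' : Disjoint ζ.image η.image) :
    addF f g d d' ≫ addF f' g' d' d'' = addF (f ≫ f') (g ≫ g') d d'' := by
  simp [addF, ParSummable.addHom_comp f f' g g' _ (disjoint_sum d') _]

theorem addF_id (d : Disjoint φ.image θ.image) : addF (𝟙 φ.sum) (𝟙 θ.sum) d d = 𝟙 _ := by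
  simp [addF, ParSummable.addHom_id]

theorem addF_br (φ ψ : Frame X) (θ ρ : Frame Y) (d : Disjoint φ.image θ.image)
    (d' : Disjoint ψ.image ρ.image) :
    br (ψ.append ρ d') (φ.append θ d) = addF (br ψ φ) (br ρ θ) d d' :=
  hom_eq ((brL_append X Y φ.list ψ.list θ.list ρ.list φ.length_eq ψ.length_eq θ.length_eq
    ρ.length_eq _ _ _ _ _ _ _ _ (disjoint_sum d) (disjoint_sum d')).trans (mk_addF _ _ _ _).symm)

end
end
end Frame

/-- The objects of `Σ C`: finite sequences of objects of `C`. -/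
@[ext] structure SigmaObj (C : Type u) : Type u where
  toList : List C

namespace SigmaObj

instance {C : Type u} : Monoid (SigmaObj C) where
  mul X Y := ⟨X.toList ++ Y.toList⟩
  one := ⟨[]⟩
  mul_assoc X Y Z := SigmaObj.ext (List.append_assoc _ _ _)
  one_mul X := SigmaObj.ext (List.nil_append _)
  mul_one X := SigmaObj.ext (List.append_nil _)

theorem mul_toList {C : Type u} (X Y : SigmaObj C) : (X * Y).toList = X.toList ++ Y.toList := rfl

end SigmaObj

section Sigma
variable {C : Type u} [Category.{v} C] [ParSummable.{v} C]

/-- The triples `(ψ, f, φ)` representing the morphisms `X ⟶ Y` of `Σ C`. -/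
structure SigmaTriple (X Y : SigmaObj C) : Type v where
  tgt : Frame Y.toList
  src : Frame X.toList
  hom : src.sum ⟶ tgt.sum

/-- `(ψ, f, φ) ∼ (ψ', f', φ')` if and only if `f' = [ψ', ψ] ∘ f ∘ [φ, φ']`. -/
instance sigmaSetoid (X Y : SigmaObj C) : Setoid (SigmaTriple X Y) where
  r t t' := t'.hom = Frame.br t.src t'.src ≫ t.hom ≫ Frame.br t'.tgt t.tgt
  iseqv :=
    { refl := fun t => by simp [Frame.br_self]
      symm := fun {t t'} h => by
        rw [h]; simp [Frame.br_comp, Frame.br_comp_assoc, Frame.br_self]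
      trans := fun {t t' t''} h h' => by
        rw [h', h]; simp [Frame.br_comp, Frame.br_comp_assoc] }

/-- The morphisms `X ⟶ Y` of `Σ C`: equivalence classes `[ψ, f, φ]` of triples. -/
def SigmaHom (X Y : SigmaObj C) : Type v := Quotient (sigmaSetoid X Y)

namespace SigmaHom
variable {X Y Z X' Y' Z' : SigmaObj C}

/-- The morphism `[ψ, f, φ]`. -/
def mk (ψ : Frame Y.toList) (φ : Frame X.toList) (f : φ.sum ⟶ ψ.sum) : SigmaHom X Y :=
  Quotient.mk _ ⟨ψ, φ, f⟩

theorem mk_eq_iff {ψ ψ' : Frame Y.toList} {φ φ' : Frame X.toList} {f : φ.sum ⟶ ψ.sum}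
    {f' : φ'.sum ⟶ ψ'.sum} :
    mk ψ φ f = mk ψ' φ' f' ↔ f' = Frame.br φ φ' ≫ f ≫ Frame.br ψ' ψ :=
  Quotient.eq

theorem exists_mk (α : SigmaHom X Y) (ψ : Frame Y.toList) (φ : Frame X.toList) :
    ∃ f : φ.sum ⟶ ψ.sum, α = mk ψ φ f := by
  obtain ⟨⟨ψ', φ', f'⟩, rfl⟩ := Quotient.exists_rep α
  exact ⟨Frame.br φ' φ ≫ f' ≫ Frame.br ψ ψ', mk_eq_iff.mpr rfl⟩

/-- The composition `[ρ, g, θ] ∘ [ψ, f, φ] = [ρ, g ∘ [θ, ψ] ∘ f, φ]`. -/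
def comp : SigmaHom X Y → SigmaHom Y Z → SigmaHom X Z :=
  Quotient.map₂ (fun t s => ⟨s.tgt, t.src, t.hom ≫ Frame.br s.src t.tgt ≫ s.hom⟩) (by
    intro t t' ht s s' hs
    change _ = _ at ht hs
    change _ = _
    dsimp only
    rw [ht, hs]
    simp [Frame.br_comp, Frame.br_comp_assoc])

theorem comp_mk (ψ : Frame Y.toList) (φ : Frame X.toList) (f : φ.sum ⟶ ψ.sum)
    (ρ : Frame Z.toList) (θ : Frame Y.toList) (g : θ.sum ⟶ ρ.sum) :
    comp (mk ψ φ f) (mk ρ θ g) = mk ρ φ (f ≫ Frame.br θ ψ ≫ g) := rfl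

end SigmaHom

/-- The category `Σ C`. The identity of `X` is `[φ, id, φ]` for any `φ`. -/
instance sigmaCategory : Category.{v} (SigmaObj C) where
  Hom X Y := SigmaHom X Y
  id X := SigmaHom.mk (Frame.default X.toList) (Frame.default X.toList) (𝟙 _)
  comp f g := SigmaHom.comp f g
  id_comp {X Y} f := by
    obtain ⟨f, rfl⟩ := SigmaHom.exists_mk f (Frame.default Y.toList) (Frame.default X.toList)
    rw [SigmaHom.comp_mk]; simp [Frame.br_self]
  comp_id {X Y} f := by
    obtain ⟨f, rfl⟩ := SigmaHom.exists_mk f (Frame.default Y.toList) (Frame.default X.toList)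
    rw [SigmaHom.comp_mk]; simp [Frame.br_self]
  assoc {X Y Z W} f g h := by
    obtain ⟨f, rfl⟩ := SigmaHom.exists_mk f (Frame.default _) (Frame.default _)
    obtain ⟨g, rfl⟩ := SigmaHom.exists_mk g (Frame.default _) (Frame.default _)
    obtain ⟨h, rfl⟩ := SigmaHom.exists_mk h (Frame.default _) (Frame.default _)
    simp [SigmaHom.comp_mk]

namespace SigmaHom
variable {X Y Z X' Y' Z' : SigmaObj C}

/-- The morphism `[ψ, f, φ]`, as a morphism of the category `Σ C`. -/
abbrev mkHom (ψ : Frame Y.toList) (φ : Frame X.toList) (f : φ.sum ⟶ ψ.sum) : X ⟶ Y := mk ψ φ f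

theorem exists_mkHom (α : X ⟶ Y) (ψ : Frame Y.toList) (φ : Frame X.toList) :
    ∃ f : φ.sum ⟶ ψ.sum, α = mkHom ψ φ f := exists_mk α ψ φ

theorem id_mk (φ : Frame X.toList) : 𝟙 X = mkHom φ φ (𝟙 _) :=
  mk_eq_iff.mpr (by simp [Frame.br_comp, Frame.br_self])

theorem mkHom_comp (ψ : Frame Y.toList) (φ : Frame X.toList) (f : φ.sum ⟶ ψ.sum)
    (ρ : Frame Z.toList) (g : ψ.sum ⟶ ρ.sum) :
    mkHom ψ φ f ≫ mkHom ρ ψ g = mkHom ρ φ (f ≫ g) :=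
  (comp_mk ψ φ f ρ ψ g).trans (by rw [Frame.br_self, Category.id_comp])

theorem mk_mkHom {ψ : Frame Y.toList} {φ : Frame X.toList} {f : φ.sum ⟶ ψ.sum}
    {ψ' : Frame Y'.toList} {φ' : Frame X'.toList} {f' : φ'.sum ⟶ ψ'.sum} (eX : X = X') (eY : Y = Y')
    (eψ : ψ.list = ψ'.list) (eφ : φ.list = φ'.list) (ef : Arrow.mk f = Arrow.mk f') :
    Arrow.mk (mkHom ψ φ f) = Arrow.mk (mkHom ψ' φ' f') := by
  subst eX; subst eY
  obtain rfl : ψ = ψ' := Frame.ext eψ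
  obtain rfl : φ = φ' := Frame.ext eφ
  rw [hom_eq ef]

/-- The tensor product of morphisms: `[ψ, f, φ] ⊗ [ρ, g, θ] = [ψ + ρ, f + g, φ + θ]` for
representatives such that the images of `φ` and `θ`, and those of `ψ` and `ρ`, are disjoint;
see `tensor_mk`. Such representatives are obtained from arbitrary ones by composing the injections
with `e₀` and `e₁`. -/
def tensor : SigmaHom X Y → SigmaHom X' Y' → SigmaHom (X * X') (Y * Y') :=
  Quotient.map₂ (fun t s =>
    ⟨(t.tgt.shift Frame.e₀).append (s.tgt.shift Frame.e₁) (Frame.disjoint_shift _ _),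
      (t.src.shift Frame.e₀).append (s.src.shift Frame.e₁) (Frame.disjoint_shift _ _),
      Frame.addF (Frame.br t.src _ ≫ t.hom ≫ Frame.br _ t.tgt)
        (Frame.br s.src _ ≫ s.hom ≫ Frame.br _ s.tgt) _ _⟩) (by
    intro t t' ht s s' hs
    change _ = _ at ht hs
    change _ = _
    dsimp only
    rw [ht, hs]
    rw [Frame.addF_br, Frame.addF_br, Frame.addF_comp, Frame.addF_comp]
    simp [Frame.br_comp, Frame.br_comp_assoc])

theorem tensor_mk (ψ : Frame Y.toList) (φ : Frame X.toList) (f : φ.sum ⟶ ψ.sum)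
    (ρ : Frame Y'.toList) (θ : Frame X'.toList) (g : θ.sum ⟶ ρ.sum)
    (d : Disjoint φ.image θ.image) (d' : Disjoint ψ.image ρ.image) :
    tensor (mk ψ φ f) (mk ρ θ g) = mk (X := X * X') (Y := Y * Y') (ψ.append ρ d') (φ.append θ d)
      (Frame.addF f g d d') := by
  refine mk_eq_iff.mpr ?_
  rw [Frame.addF_br, Frame.addF_br, Frame.addF_comp, Frame.addF_comp]
  simp [Frame.br_comp, Frame.br_comp_assoc, Frame.br_self]

/-- A morphism of `Σ C` that is represented by an identity of `C`. -/
def perm (ψ : Frame Y.toList) (φ : Frame X.toList) (h : φ.sum = ψ.sum) : X ⟶ Y :=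
  mkHom ψ φ (eqToHom h)

theorem perm_comp {ψ : Frame Y.toList} {φ : Frame X.toList} {ρ : Frame Z.toList}
    (h : φ.sum = ψ.sum) (h' : ψ.sum = ρ.sum) : perm ψ φ h ≫ perm ρ ψ h' = perm ρ φ (h.trans h') := by
  simp [perm, mkHom_comp]

theorem perm_self (φ : Frame X.toList) (h : φ.sum = φ.sum) : perm φ φ h = 𝟙 X := (id_mk φ).symm

theorem sum_eq_of_list {X Y : List C} (e : X = Y) {φ : Frame X} {ψ : Frame Y}
    (h : φ.list = ψ.list) : φ.sum = ψ.sum := by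
  subst e; obtain rfl : φ = ψ := Frame.ext h; rfl

theorem eqToHom_eq (e : X = Y) (φ : Frame X.toList) (ψ : Frame Y.toList) (h : φ.list = ψ.list) :
    eqToHom e = perm ψ φ (sum_eq_of_list (congrArg _ e) h) := by
  subst e; obtain rfl : φ = ψ := Frame.ext h; exact (perm_self φ rfl).symm

theorem perm_congr {ψ ψ' : Frame Y.toList} {φ φ' : Frame X.toList} (h : φ.sum = ψ.sum)
    (e : φ.list = φ'.list) (e' : ψ.list = ψ'.list) :
    perm ψ φ h = perm ψ' φ' (((sum_eq_of_list rfl e.symm).trans h).trans (sum_eq_of_list rfl e')) := by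
  obtain rfl : ψ = ψ' := Frame.ext e'
  obtain rfl : φ = φ' := Frame.ext e
  rfl

theorem perm_tensor {ψ : Frame Y.toList} {φ : Frame X.toList} {ρ : Frame Y'.toList}
    {θ : Frame X'.toList} (h : φ.sum = ψ.sum) (h' : θ.sum = ρ.sum) (d : Disjoint φ.image θ.image)
    (d' : Disjoint ψ.image ρ.image) (k : (φ.append θ d).sum = (ψ.append ρ d').sum) :
    tensor (perm ψ φ h) (perm ρ θ h') =
      perm (X := X * X') (Y := Y * Y') (ψ.append ρ d') (φ.append θ d) k := by
  rw [perm, perm, tensor_mk _ _ _ _ _ _ d d', perm]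
  congr 1
  apply hom_eq
  rw [Frame.mk_addF, mk_eqToHom, Frame.sum_append, ia, ← ParSummable.addHom_id]
  exact addHom_congr (mk_eqToHom h) (mk_eqToHom h') _ _ _ _

theorem sum_swap {X Y : List C} (φ : Frame X) (θ : Frame Y) (d : Disjoint φ.image θ.image) :
    (φ.append θ d).sum = (θ.append φ d.symm).sum := by
  rw [Frame.sum_append, Frame.sum_append, ParSummable.add_comm]

/-- The symmetry isomorphism `[θ + φ, id, φ + θ]` of `Σ C`, for any injections `φ` and `θ` with
disjoint images; see `symm_eq`. -/
def symm (X Y : SigmaObj C) : X * Y ⟶ Y * X :=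
  perm (X := X * Y) (Y := Y * X)
    (((Frame.default Y.toList).shift Frame.e₁).append ((Frame.default X.toList).shift Frame.e₀)
      (Frame.disjoint_shift _ _).symm)
    (((Frame.default X.toList).shift Frame.e₀).append ((Frame.default Y.toList).shift Frame.e₁)
      (Frame.disjoint_shift _ _)) (sum_swap _ _ _)

theorem symm_eq (φ : Frame X.toList) (θ : Frame Y.toList) (d : Disjoint φ.image θ.image) :
    symm X Y = perm (X := X * Y) (Y := Y * X) (θ.append φ d.symm) (φ.append θ d)
      (sum_swap φ θ d) := by
  refine mk_eq_iff.mpr ?_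
  rw [Frame.addF_br, Frame.addF_br]
  apply hom_eq
  rw [mk_eqToHom, mk_comp, mk_comp, mk_eqToHom, Frame.mk_addF, Frame.mk_addF,
    ParSummable.addHom_comm, ia_acomp, ← mk_comp, ← ParSummable.addHom_comp, Frame.br_comp,
    Frame.br_comp, Frame.br_self, Frame.br_self, ParSummable.addHom_id]
  · exact congrArg (fun Z => Arrow.mk (𝟙 Z)) ((Frame.sum_append φ θ d).trans
      (ParSummable.add_comm _ _ _))
  · exact (Frame.sum_append _ _ _).trans (ParSummable.add_comm _ _ _)

theorem exists_disjoint (X Y Z : List C) : ∃ (φ : Frame X) (θ : Frame Y) (η : Frame Z),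
    Disjoint φ.image θ.image ∧ Disjoint φ.image η.image ∧ Disjoint θ.image η.image := by
  have h := Frame.disjoint_shift (Frame.default X)
    (((Frame.default Y).shift Frame.e₀).append ((Frame.default Z).shift Frame.e₁)
      (Frame.disjoint_shift _ _))
  have h' := Frame.disjoint_shift ((Frame.default Y).shift Frame.e₀) ((Frame.default Z).shift Frame.e₁)
  refine ⟨(Frame.default X).shift Frame.e₀, ((Frame.default Y).shift Frame.e₀).shift Frame.e₁,
    ((Frame.default Z).shift Frame.e₁).shift Frame.e₁, ?_, ?_, ?_⟩
  · exact Frame.disjoint_shift _ _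
  · exact Frame.disjoint_shift _ _
  · refine Set.disjoint_left.mpr ?_
    rintro i ⟨u, hu, a, rfl⟩ ⟨v, hv, b, hb⟩
    obtain ⟨u', hu', rfl⟩ := List.mem_map.mp hu
    obtain ⟨v', hv', rfl⟩ := List.mem_map.mp hv
    exact Set.disjoint_left.mp (Frame.disjoint_shift (Frame.default Y) (Frame.default Z))
      ⟨u', hu', a, rfl⟩ ⟨v', hv', b, Frame.e₁.injective hb⟩

theorem disjoint_append {X Y Z : List C} {φ : Frame X} {θ : Frame Y} {η : Frame Z}
    (d : Disjoint φ.image θ.image) (h : Disjoint φ.image η.image) (h' : Disjoint θ.image η.image) :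
    Disjoint (φ.append θ d).image η.image := by
  rw [Frame.image_append]; exact Set.disjoint_union_left.mpr ⟨h, h'⟩

theorem disjoint_append' {X Y Z : List C} {φ : Frame X} {θ : Frame Y} {η : Frame Z}
    (d : Disjoint θ.image η.image) (h : Disjoint φ.image θ.image) (h' : Disjoint φ.image η.image) :
    Disjoint φ.image (θ.append η d).image := by
  rw [Frame.image_append]; exact Set.disjoint_union_right.mpr ⟨h, h'⟩

end SigmaHom

open SigmaHom in
/-- `Σ C` is a permutative category. -/
instance sigmaPermutative : PermutativeCategory.{v} (SigmaObj C) where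
  tensorHom f g := SigmaHom.tensor f g
  tensorHom_id X Y := by
    obtain ⟨φ, θ, -, d, -, -⟩ := exists_disjoint X.toList Y.toList Y.toList
    rw [id_mk φ, id_mk θ, tensor_mk _ _ _ _ _ _ d d, Frame.addF_id]
    exact (id_mk (X := X * Y) (φ.append θ d)).symm
  tensorHom_comp {X Y Z X' Y' Z'} f g f' g' := by
    obtain ⟨φ, φ', -, d, -, -⟩ := exists_disjoint X.toList X'.toList X'.toList
    obtain ⟨ψ, ψ', -, d', -, -⟩ := exists_disjoint Y.toList Y'.toList Y'.toList
    obtain ⟨θ, θ', -, d'', -, -⟩ := exists_disjoint Z.toList Z'.toList Z'.toList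
    obtain ⟨f, rfl⟩ := exists_mkHom f ψ φ
    obtain ⟨g, rfl⟩ := exists_mkHom g θ ψ
    obtain ⟨f', rfl⟩ := exists_mkHom f' ψ' φ'
    obtain ⟨g', rfl⟩ := exists_mkHom g' θ' ψ'
    rw [mkHom_comp, mkHom_comp, tensor_mk _ _ _ _ _ _ d d'', tensor_mk _ _ _ _ _ _ d d',
      tensor_mk _ _ _ _ _ _ d' d'', ← Frame.addF_comp _ _ _ _ _ d']
    exact (mkHom_comp (X := X * X') (Y := Y * Y') (Z := Z * Z') _ _ _ _ _).symm
  tensorHom_assoc {X Y X' Y' X'' Y''} f g h := by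
    obtain ⟨φ, φ', φ'', d, d₁, d₂⟩ := exists_disjoint X.toList X'.toList X''.toList
    obtain ⟨ψ, ψ', ψ'', e, e₁, e₂⟩ := exists_disjoint Y.toList Y'.toList Y''.toList
    obtain ⟨f, rfl⟩ := exists_mkHom f ψ φ
    obtain ⟨g, rfl⟩ := exists_mkHom g ψ' φ'
    obtain ⟨h, rfl⟩ := exists_mkHom h ψ'' φ''
    rw [tensor_mk _ _ _ _ _ _ d e, tensor_mk _ _ _ _ _ _ d₂ e₂,
      tensor_mk (X := X * X') (Y := Y * Y') _ _ _ _ _ _ (disjoint_append d d₁ d₂)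
        (disjoint_append e e₁ e₂),
      tensor_mk (X' := X' * X'') (Y' := Y' * Y'') _ _ _ _ _ _ (disjoint_append' d₂ d d₁)
        (disjoint_append' e₂ e e₁)]
    refine mk_mkHom (mul_assoc X X' X'') (mul_assoc Y Y' Y'') (List.append_assoc _ _ _)
      (List.append_assoc _ _ _) ?_
    rw [Frame.mk_addF, Frame.mk_addF]
    have a := Frame.disjoint_sum d
    have a₁ := Frame.disjoint_sum d₁
    have a₂ := Frame.disjoint_sum d₂
    have b := Frame.disjoint_sum e
    have b₁ := Frame.disjoint_sum e₁
    have b₂ := Frame.disjoint_sum e₂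
    have c₁ := Frame.disjoint_sum (disjoint_append d d₁ d₂)
    have c₂ := Frame.disjoint_sum (disjoint_append e e₁ e₂)
    have c₃ := Frame.disjoint_sum (disjoint_append' d₂ d d₁)
    have c₄ := Frame.disjoint_sum (disjoint_append' e₂ e e₁)
    rw [Frame.sum_append] at c₁ c₂ c₃ c₄
    refine (addHom_congr (Frame.mk_addF f g d e) rfl _ _ c₁ c₂).trans ?_
    refine (ParSummable.addHom_assoc f g h a a₁ a₂ c₁ c₃ b b₁ b₂ c₂ c₄).trans ?_
    exact addHom_congr rfl (Frame.mk_addF g h d₂ e₂).symm _ _ _ _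
  id_tensorHom {X Y} f := by
    let o : Frame (1 : SigmaObj C).toList := ⟨[], rfl, List.Pairwise.nil⟩
    obtain ⟨f, rfl⟩ := exists_mkHom f (Frame.default _) (Frame.default _)
    have d : ∀ Z : List C, Disjoint o.image (Frame.default Z).image := fun Z =>
      Set.disjoint_left.mpr (by rintro _ ⟨u, hu, -⟩; simp [o] at hu)
    rw [id_mk o, tensor_mk _ _ _ _ _ _ (d _) (d _)]
    refine mk_mkHom (one_mul _) (one_mul _) (List.nil_append _) (List.nil_append _) ?_
    rw [Frame.mk_addF]
    exact ParSummable.zero_addHom _ _ _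
  tensorHom_id_one {X Y} f := by
    let o : Frame (1 : SigmaObj C).toList := ⟨[], rfl, List.Pairwise.nil⟩
    obtain ⟨f, rfl⟩ := exists_mkHom f (Frame.default _) (Frame.default _)
    have d : ∀ Z : List C, Disjoint (Frame.default Z).image o.image := fun Z =>
      Set.disjoint_right.mpr (by rintro _ ⟨u, hu, -⟩; simp [o] at hu)
    rw [id_mk o, tensor_mk _ _ _ _ _ _ (d _) (d _)]
    refine mk_mkHom (mul_one _) (mul_one _) (List.append_nil _) (List.append_nil _) ?_
    rw [Frame.mk_addF, ParSummable.addHom_comm]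
    exact ParSummable.zero_addHom _ _ _
  τ X Y := SigmaHom.symm X Y
  τ_natural {X Y X' Y'} f g := by
    obtain ⟨φ, φ', -, d, -, -⟩ := exists_disjoint X.toList X'.toList X'.toList
    obtain ⟨ψ, ψ', -, d', -, -⟩ := exists_disjoint Y.toList Y'.toList Y'.toList
    obtain ⟨f, rfl⟩ := exists_mkHom f ψ φ
    obtain ⟨g, rfl⟩ := exists_mkHom g ψ' φ'
    rw [tensor_mk _ _ _ _ _ _ d d', tensor_mk _ _ _ _ _ _ d.symm d'.symm, symm_eq φ φ' d,
      symm_eq ψ ψ' d']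
    refine (mkHom_comp (X := X * X') (Y := Y * Y') (Z := Y' * Y) _ _ _ _ _).trans
      (Eq.trans ?_ (mkHom_comp (X := X * X') (Y := X' * X) (Z := Y' * Y) _ _ _ _ _).symm)
    congr 1
    apply hom_eq
    rw [Arrow.arrow_mk_comp_eqToHom, Arrow.arrow_mk_eqToHom_comp, Frame.mk_addF, Frame.mk_addF,
      ParSummable.addHom_comm]
  τ_one_left X := by
    let o : Frame (1 : SigmaObj C).toList := ⟨[], rfl, List.Pairwise.nil⟩
    have d : Disjoint o.image (Frame.default X.toList).image :=
      Set.disjoint_left.mpr (by rintro _ ⟨u, hu, -⟩; simp [o] at hu)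
    rw [symm_eq o _ d, id_mk (Frame.default X.toList)]
    refine mk_mkHom (one_mul X) (mul_one X) (List.append_nil _) (List.nil_append _) ?_
    rw [mk_eqToHom]
    exact congrArg (fun Z => Arrow.mk (𝟙 Z)) (sum_eq_of_list (List.nil_append _) rfl)
  τ_one_right X := by
    let o : Frame (1 : SigmaObj C).toList := ⟨[], rfl, List.Pairwise.nil⟩
    have d : Disjoint (Frame.default X.toList).image o.image :=
      Set.disjoint_right.mpr (by rintro _ ⟨u, hu, -⟩; simp [o] at hu)
    rw [symm_eq _ o d, id_mk (Frame.default X.toList)]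
    refine mk_mkHom (mul_one X) (one_mul X) (List.nil_append _) (List.append_nil _) ?_
    rw [mk_eqToHom]
    exact congrArg (fun Z => Arrow.mk (𝟙 Z)) (sum_eq_of_list (List.append_nil _) (List.append_nil _))
  τ_τ X Y := by
    obtain ⟨φ, θ, -, d, -, -⟩ := exists_disjoint X.toList Y.toList Y.toList
    rw [symm_eq φ θ d, symm_eq θ φ d.symm, perm_comp, perm_self]
  τ_mul X Y Z := by
    obtain ⟨φ, θ, η, d, d₁, d₂⟩ := exists_disjoint X.toList Y.toList Z.toList
    let p₁ : Frame (X * Y * Z).toList := (φ.append θ d).append η (disjoint_append d d₁ d₂)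
    let p₂ : Frame (X * (Y * Z)).toList := φ.append (θ.append η d₂) (disjoint_append' d₂ d d₁)
    let p₃ : Frame (X * (Z * Y)).toList :=
      φ.append (η.append θ d₂.symm) (disjoint_append' d₂.symm d₁ d)
    let p₄ : Frame (X * Z * Y).toList := (φ.append η d₁).append θ (disjoint_append d₁ d d₂.symm)
    let p₅ : Frame (Z * X * Y).toList :=
      (η.append φ d₁.symm).append θ (disjoint_append d₁.symm d₂.symm d)
    let p₆ : Frame (Z * (X * Y)).toList :=
      η.append (φ.append θ d) (disjoint_append' d d₁.symm d₂.symm)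
    have s : Frame.sum p₁ = Frame.sum p₆ := sum_swap _ _ _
    have e₁ : eqToHom (mul_assoc X Y Z) = perm p₂ p₁ _ :=
      eqToHom_eq (mul_assoc X Y Z) p₁ p₂ (List.append_assoc _ _ _)
    have e₃ : eqToHom (mul_assoc X Z Y).symm = perm p₄ p₃ _ :=
      eqToHom_eq (mul_assoc X Z Y).symm p₃ p₄ (List.append_assoc _ _ _).symm
    have e₅ : eqToHom (mul_assoc Z X Y) = perm p₆ p₅ _ :=
      eqToHom_eq (mul_assoc Z X Y) p₅ p₆ (List.append_assoc _ _ _)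
    have s₂ : Frame.sum p₂ = Frame.sum p₃ := by
      refine (Frame.sum_append _ _ _).trans (Eq.trans ?_ (Frame.sum_append _ _ _).symm)
      exact add_congr rfl (sum_swap _ _ _) _
    have s₄ : Frame.sum p₄ = Frame.sum p₅ := by
      refine (Frame.sum_append _ _ _).trans (Eq.trans ?_ (Frame.sum_append _ _ _).symm)
      exact add_congr (sum_swap _ _ _) rfl _
    have e₂ : SigmaHom.tensor (𝟙 X) (symm Y Z) = perm p₃ p₂ s₂ := by
      rw [symm_eq θ η d₂, ← perm_self φ rfl]
      exact perm_tensor rfl _ _ _ s₂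
    have e₄ : SigmaHom.tensor (symm X Z) (𝟙 Y) = perm p₅ p₄ s₄ := by
      rw [symm_eq φ η d₁, ← perm_self θ rfl]
      exact perm_tensor _ rfl _ _ s₄
    have e₆ : symm (X * Y) Z = perm p₆ p₁ s :=
      symm_eq (X := X * Y) (Y := Z) (φ.append θ d) η _
    rw [e₁, e₂, e₃, e₄, e₅, e₆, perm_comp, perm_comp, perm_comp, perm_comp]

end Sigma

section SigmaFunctor

/-- The underlying injection of a frame only depends on the length of the list. -/
def Frame.map {α β : Type*} (F : α → β) {X : List α} (φ : Frame X) : Frame (X.map F) :=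
  ⟨φ.list, by simp [φ.length_eq], φ.pd⟩

variable {C D : Type*} [Category C] [ParSummable C] [Category D] [ParSummable D]

theorem Frame.sum_map (F : ParFunctor C D) {X : List C} (φ : Frame X) :
    F.obj φ.sum = (φ.map F.obj).sum := push_map F _ _ _ φ.length_eq

/-- The morphism `F f`, for a morphism `f` between generalized sums. -/
def Frame.mapHom (F : ParFunctor C D) {X Y : List C} {φ : Frame X} {ψ : Frame Y}
    (f : φ.sum ⟶ ψ.sum) : (φ.map F.obj).sum ⟶ (ψ.map F.obj).sum :=
  eqToHom (φ.sum_map F).symm ≫ F.map f ≫ eqToHom (ψ.sum_map F)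

theorem Frame.mk_mapHom (F : ParFunctor C D) {X Y : List C} {φ : Frame X} {ψ : Frame Y}
    (f : φ.sum ⟶ ψ.sum) : Arrow.mk (Frame.mapHom F f) = Arrow.mk (F.map f) := by
  simp [Frame.mapHom]

theorem Frame.mapHom_comp (F : ParFunctor C D) {X Y Z : List C} {φ : Frame X} {ψ : Frame Y}
    {θ : Frame Z} (f : φ.sum ⟶ ψ.sum) (g : ψ.sum ⟶ θ.sum) :
    Frame.mapHom F (f ≫ g) = Frame.mapHom F f ≫ Frame.mapHom F g := by
  simp [Frame.mapHom]

theorem Frame.mapHom_br (F : ParFunctor C D) {X : List C} (φ ψ : Frame X) :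
    Frame.mapHom F (Frame.br ψ φ) = Frame.br (ψ.map F.obj) (φ.map F.obj) :=
  hom_eq ((Frame.mk_mapHom F _).trans (brL_map F X _ _ _ _ _ _ _ _))

/-- `Σ(F)` on morphisms: `[ψ, f, φ]` is sent to `[ψ, F f, φ]`. -/
def SigmaHom.map (F : ParFunctor C D) {X Y : SigmaObj C} :
    SigmaHom X Y → SigmaHom (⟨X.toList.map F.obj⟩ : SigmaObj D) ⟨Y.toList.map F.obj⟩ :=
  Quotient.map (fun t => ⟨t.tgt.map F.obj, t.src.map F.obj, Frame.mapHom F t.hom⟩) (by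
    intro t t' ht
    change _ = _ at ht
    change _ = _
    dsimp only
    rw [ht, Frame.mapHom_comp, Frame.mapHom_comp, Frame.mapHom_br, Frame.mapHom_br])

theorem SigmaHom.map_mk (F : ParFunctor C D) {X Y : SigmaObj C} (ψ : Frame Y.toList)
    (φ : Frame X.toList) (f : φ.sum ⟶ ψ.sum) :
    SigmaHom.map F (SigmaHom.mk ψ φ f) = SigmaHom.mk (X := ⟨X.toList.map F.obj⟩)
      (Y := ⟨Y.toList.map F.obj⟩) (ψ.map F.obj) (φ.map F.obj) (Frame.mapHom F f) := rfl

/-- The functor `Σ(F)`. -/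
def sigmaMapFunctor (F : ParFunctor C D) : SigmaObj C ⥤ SigmaObj D where
  obj X := ⟨X.toList.map F.obj⟩
  map f := SigmaHom.map F f
  map_id X := by
    rw [SigmaHom.id_mk (Frame.default X.toList), SigmaHom.map_mk]
    refine Eq.trans ?_ (SigmaHom.id_mk (X := ⟨X.toList.map F.obj⟩)
      ((Frame.default X.toList).map F.obj)).symm
    simp [Frame.mapHom]
  map_comp {X Y Z} f g := by
    obtain ⟨f, rfl⟩ := SigmaHom.exists_mkHom f (Frame.default _) (Frame.default _)
    obtain ⟨g, rfl⟩ := SigmaHom.exists_mkHom g (Frame.default _) (Frame.default _)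
    rw [SigmaHom.mkHom_comp, SigmaHom.map_mk, SigmaHom.map_mk, SigmaHom.map_mk, Frame.mapHom_comp]
    exact (SigmaHom.mkHom_comp (X := ⟨X.toList.map F.obj⟩) (Y := ⟨Y.toList.map F.obj⟩)
      (Z := ⟨Z.toList.map F.obj⟩) _ _ _ _ _).symm

open SigmaHom in
/-- `Σ(F)` is strict symmetric monoidal. -/
def sigmaMap (F : ParFunctor C D) : StrictFunctor (SigmaObj C) (SigmaObj D) where
  toFunctor := sigmaMapFunctor F
  obj_one := rfl
  obj_mul X Y := SigmaObj.ext List.map_append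
  map_tensor {X Y X' Y'} f g := by
    obtain ⟨φ, φ', -, d, -, -⟩ := exists_disjoint X.toList X'.toList X'.toList
    obtain ⟨ψ, ψ', -, d', -, -⟩ := exists_disjoint Y.toList Y'.toList Y'.toList
    obtain ⟨f, rfl⟩ := exists_mkHom f ψ φ
    obtain ⟨g, rfl⟩ := exists_mkHom g ψ' φ'
    have e₁ : (mkHom ψ φ f) ⊗ₚ (mkHom ψ' φ' g) = mkHom (X := X * X') (Y := Y * Y') _ _ _ :=
      tensor_mk ψ φ f ψ' φ' g d d'
    have e₂ := tensor_mk (X := ⟨X.toList.map F.obj⟩) (Y := ⟨Y.toList.map F.obj⟩)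
      (X' := ⟨X'.toList.map F.obj⟩) (Y' := ⟨Y'.toList.map F.obj⟩) (ψ.map F.obj) (φ.map F.obj)
      (Frame.mapHom F f) (ψ'.map F.obj) (φ'.map F.obj) (Frame.mapHom F g) d d'
    rw [e₁]
    refine Eq.trans ?_ (congrArg Arrow.mk e₂).symm
    refine mk_mkHom (SigmaObj.ext List.map_append) (SigmaObj.ext List.map_append) rfl rfl ?_
    have s := Frame.disjoint_sum d
    have s' := Frame.disjoint_sum d'
    refine (Frame.mk_mapHom F _).trans ?_
    refine Eq.trans ?_ (Frame.mk_addF _ _ _ _).symm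
    refine (map_mk_congr F.toFunctor (Frame.mk_addF f g d d')).trans ?_
    refine (F.map_addHom f g s s' (F.disjoint_obj s) (F.disjoint_obj s')).trans ?_
    exact addHom_congr (Frame.mk_mapHom F f).symm (Frame.mk_mapHom F g).symm _ _ _ _
  map_τ X Y := by
    obtain ⟨φ, θ, -, d, -, -⟩ := exists_disjoint X.toList Y.toList Y.toList
    have e₁ : PermutativeCategory.τ X Y = perm (X := X * Y) (Y := Y * X) _ _ _ := symm_eq φ θ d
    have e₂ := symm_eq (X := ⟨X.toList.map F.obj⟩) (Y := ⟨Y.toList.map F.obj⟩) (φ.map F.obj)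
      (θ.map F.obj) d
    rw [e₁]
    refine Eq.trans ?_ (congrArg Arrow.mk e₂).symm
    refine mk_mkHom (SigmaObj.ext List.map_append) (SigmaObj.ext List.map_append) rfl rfl ?_
    refine (Frame.mk_mapHom F _).trans ?_
    rw [eqToHom_map, mk_eqToHom, mk_eqToHom]
    refine congrArg (fun Z => Arrow.mk (𝟙 Z)) ?_
    rw [Frame.sum_map]
    exact sum_eq_of_list List.map_append rfl

end SigmaFunctor

theorem functor_ext {C D : Type*} [Category C] [Category D] {F G : C ⥤ D}
    (h : ∀ X, F.obj X = G.obj X)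
    (h' : ∀ {X Y : C} (f : X ⟶ Y), Arrow.mk (F.map f) = Arrow.mk (G.map f)) : F = G := by
  refine CategoryTheory.Functor.ext h fun X Y f => hom_eq ?_
  rw [h', ← Category.assoc, Arrow.arrow_mk_comp_eqToHom, Arrow.arrow_mk_eqToHom_comp]

/-- The functor `Σ` from parsummable categories to permutative categories. -/
def sigma : ParSumCat.{v, u} ⥤ PermCat.{v, u} where
  obj C := ⟨SigmaObj C.carrier⟩
  map F := sigmaMap F
  map_id C := by
    apply StrictFunctor.ext_functor
    refine functor_ext (fun X => SigmaObj.ext (List.map_id _)) fun {X Y} f => ?_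
    obtain ⟨f, rfl⟩ := SigmaHom.exists_mkHom f (Frame.default _) (Frame.default _)
    exact SigmaHom.mk_mkHom (SigmaObj.ext (List.map_id _)) (SigmaObj.ext (List.map_id _)) rfl rfl
      (Frame.mk_mapHom (ParFunctor.id C.carrier) f)
  map_comp {C D E} F G := by
    apply StrictFunctor.ext_functor
    have e : ∀ X : List C.carrier, X.map (ParFunctor.comp F G).obj = (X.map F.obj).map G.obj :=
      fun X => (List.map_map (f := F.obj) (g := G.obj) (l := X)).symm
    refine functor_ext (fun X => SigmaObj.ext (e _)) fun {X Y} f => ?_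
    obtain ⟨f, rfl⟩ := SigmaHom.exists_mkHom f (Frame.default _) (Frame.default _)
    refine SigmaHom.mk_mkHom (SigmaObj.ext (e _)) (SigmaObj.ext (e _))
      rfl rfl ?_
    refine (Frame.mk_mapHom (ParFunctor.comp F G) f).trans ?_
    exact ((Frame.mk_mapHom G _).trans
      (map_mk_congr G.toFunctor (Frame.mk_mapHom F f))).symm

/-! ### Constructing `EM`-actions -/

section OfCirc
variable {C : Type u} [Category.{v} C]

/-- Naturality squares for isomorphisms that agree up to strict equality. -/
theorem mk_conj {X X' Y Y' Z Z' W W' : C} (i : X ≅ Z) (i' : X' ≅ Z') (j : Y ≅ W) (j' : Y' ≅ W')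
    (f : X ⟶ Y) (f' : X' ⟶ Y') (e : Arrow.mk i.hom = Arrow.mk i'.hom)
    (e' : Arrow.mk j.hom = Arrow.mk j'.hom) (h : Arrow.mk f = Arrow.mk f') :
    Arrow.mk (i.inv ≫ f ≫ j.hom) = Arrow.mk (i'.inv ≫ f' ≫ j'.hom) := by
  obtain rfl := left_eq e
  obtain rfl := right_eq e
  obtain rfl := left_eq e'
  obtain rfl := right_eq e'
  obtain rfl : i = i' := Iso.ext (hom_eq e)
  obtain rfl : j = j' := Iso.ext (hom_eq e')
  obtain rfl := hom_eq h
  rfl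

theorem mk_conj' {X X' Y Z Z' W : C} (i : X ≅ Z) (i' : X' ≅ Z') (j : X ≅ Y) (j' : X' ≅ W)
    (e : Arrow.mk i.hom = Arrow.mk i'.hom) (e' : Arrow.mk j.hom = Arrow.mk j'.hom) :
    Arrow.mk (i.inv ≫ j.hom) = Arrow.mk (i'.inv ≫ j'.hom) := by
  obtain rfl := left_eq e
  obtain rfl := right_eq e
  obtain rfl := right_eq e'
  obtain rfl : i = i' := Iso.ext (hom_eq e)
  obtain rfl : j = j' := Iso.ext (hom_eq e')
  rfl

theorem mk_inv_congr {X Y X' Y' : C} (i : X ≅ Y) (i' : X' ≅ Y')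
    (e : Arrow.mk i.hom = Arrow.mk i'.hom) : Arrow.mk i.inv = Arrow.mk i'.inv := by
  obtain rfl := left_eq e
  obtain rfl := right_eq e
  obtain rfl : i = i' := Iso.ext (hom_eq e)
  rfl

theorem mk_conj'' {X X' Y Y' Z Z' W W' : C} (i : X ≅ Z) (i' : X' ≅ Z') (j : Y ≅ W) (j' : Y' ≅ W')
    (f : Z ⟶ W) (f' : Z' ⟶ W') (e : Arrow.mk i.hom = Arrow.mk i'.hom)
    (e' : Arrow.mk j.hom = Arrow.mk j'.hom) (h : Arrow.mk f = Arrow.mk f') :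
    Arrow.mk (i.hom ≫ f ≫ j.inv) = Arrow.mk (i'.hom ≫ f' ≫ j'.inv) :=
  mk_conj i.symm i'.symm j.symm j'.symm f f' (mk_inv_congr i i' e) (mk_inv_congr j j' e') h

/-- An `EM`-action can be given by an action of `M` on the set of objects together with suitable
isomorphisms `u_∘ : X ≅ u_* X`. A morphism `f : X ⟶ Y` is then sent by `u` to
`u_∘ ∘ f ∘ u_∘⁻¹`, and `[v, u]` is the composite `v_∘ ∘ u_∘⁻¹`. -/
def EMCategory.ofCirc (obj : Inj → C → C) (circ : ∀ (u : Inj) (X : C), X ≅ obj u X)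
    (circ_one : ∀ X, Arrow.mk (circ 1 X).hom = Arrow.mk (𝟙 X))
    (circ_mul : ∀ u v X, Arrow.mk (circ (u * v) X).hom =
      Arrow.mk ((circ v X).hom ≫ (circ u (obj v X)).hom)) : EMCategory C where
  act u :=
    { obj := obj u
      map := fun {X Y} f => (circ u X).inv ≫ f ≫ (circ u Y).hom }
  act_one := functor_ext (fun X => right_eq (circ_one X)) fun {X Y} f => by
    refine (mk_conj (circ 1 X) (Iso.refl X) (circ 1 Y) (Iso.refl Y) f f (circ_one X) (circ_one Y)
      rfl).trans ?_
    simp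
  act_mul u v := functor_ext (fun X => right_eq (circ_mul u v X)) fun {X Y} f => by
    refine (mk_conj (circ (u * v) X) (circ v X ≪≫ circ u (obj v X)) (circ (u * v) Y)
      (circ v Y ≪≫ circ u (obj v Y)) f f (circ_mul u v X) (circ_mul u v Y) rfl).trans ?_
    simp
  br v u := { app := fun X => (circ u X).inv ≫ (circ v X).hom }
  br_self u := by ext X; simp
  br_comp w v u := by ext X; simp
  br_mul v v' u u' X := by
    refine (mk_conj' (circ (u * u') X) (circ u' X ≪≫ circ u (obj u' X)) (circ (v * v') X)
      (circ v' X ≪≫ circ v (obj v' X)) (circ_mul u u' X) (circ_mul v v' X)).trans ?_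
    simp

end OfCirc

/-! ### The parsummable category `Φ C` -/

open PermutativeCategory

/-- The coherence isomorphism `coh`, as an isomorphism. -/
def cohIso {C : Type u} [Category.{v} C] [PermutativeCategory.{v} C] {ι : Type*} [DecidableEq ι]
    (X : ι → C) (l l' : List ι) (h : l.Perm l') : lprod X l ≅ lprod X l' where
  hom := coh X l l' h
  inv := coh X l' l h.symm
  hom_inv_id := by rw [coh_trans, coh_self]
  inv_hom_id := by rw [coh_trans, coh_self]

section
variable {C : Type u} [Category.{v} C] [PermutativeCategory.{v} C]

theorem ca_self {ι : Type*} [DecidableEq ι] (X : ι → C) (l : List ι) (h : l.Perm l) :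
    ca X l l h = ia (lprod X l) := congrArg Arrow.mk (coh_self X l h)

theorem ca_trans {ι : Type*} [DecidableEq ι] (X : ι → C) (l l' l'' : List ι) (h : l.Perm l')
    (h' : l'.Perm l'') : ca X l l' h ⋄ ca X l' l'' h' = ca X l l'' (h.trans h') :=
  (mk_comp _ _).symm.trans (congrArg Arrow.mk (coh_trans X l l' l'' h h'))

theorem ca_fun {ι : Type*} [DecidableEq ι] {X Y : ι → C} (e : X = Y) (l l' : List ι)
    (h : l.Perm l') : ca X l l' h = ca Y l l' h := by subst e; rfl

end

/-- The objects of `Φ C`: sequences of objects of `C` almost all of whose entries are the unit. -/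
@[ext] structure PhiObj (C : Type u) [Monoid C] : Type u where
  fn : ℕ+ → C
  finite : {i | fn i ≠ 1}.Finite

namespace PhiObj

section
variable {C : Type u} [Monoid C]

/-- The finite set of all `i` such that `Xᵢ` is not the unit, as an increasing list. -/
noncomputable def idx (X : PhiObj C) : List ℕ+ := X.finite.toFinset.sort

@[simp] theorem mem_idx (X : PhiObj C) (i : ℕ+) : i ∈ X.idx ↔ X.fn i ≠ 1 := by simp [idx]

theorem nodup_idx (X : PhiObj C) : X.idx.Nodup := Finset.sort_nodup _ _

theorem sorted_idx (X : PhiObj C) : X.idx.Pairwise (· ≤ ·) := Finset.pairwise_sort _ _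

theorem perm_idx (X : PhiObj C) {l : List ℕ+} (h : l.Nodup) (h' : ∀ i, i ∈ l ↔ X.fn i ≠ 1) :
    X.idx.Perm l :=
  (List.perm_ext_iff_of_nodup X.nodup_idx h).mpr fun i => by rw [mem_idx, h']

/-- The tensor product `⨂_{i ∈ ω} Xᵢ`, i.e. the ordered tensor product of all those entries that are
different from the unit. -/
noncomputable def tens (X : PhiObj C) : C := (X.idx.map X.fn).prod

open Classical in
/-- The object `u_* X`. -/
noncomputable def push (u : Inj) (X : PhiObj C) : PhiObj C where
  fn i := if h : ∃ j, u j = i then X.fn h.choose else 1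
  finite := by
    refine (X.finite.image u).subset fun i hi => ?_
    have h : ∃ j, u j = i := by
      by_contra h
      exact hi (dif_neg h)
    refine ⟨h.choose, ?_, h.choose_spec⟩
    exact fun e => hi ((dif_pos h).trans e)

theorem push_apply (u : Inj) (X : PhiObj C) (j : ℕ+) : (push u X).fn (u j) = X.fn j := by
  have h : ∃ k, u k = u j := ⟨j, rfl⟩
  refine (dif_pos h).trans ?_
  rw [u.injective h.choose_spec]

theorem push_of_notMem (u : Inj) (X : PhiObj C) (i : ℕ+) (h : ∀ j, u j ≠ i) :
    (push u X).fn i = 1 := dif_neg (by simpa using h)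

theorem ext_iff_push (u : Inj) (X Y : PhiObj C) :
    Y = push u X ↔ (∀ j, Y.fn (u j) = X.fn j) ∧ ∀ i, (∀ j, u j ≠ i) → Y.fn i = 1 := by
  constructor
  · rintro rfl
    exact ⟨push_apply u X, push_of_notMem u X⟩
  · rintro ⟨h, h'⟩
    ext i
    by_cases hi : ∃ j, u j = i
    · obtain ⟨j, rfl⟩ := hi
      rw [h, push_apply]
    · rw [not_exists] at hi
      rw [h' i hi, push_of_notMem u X i hi]

theorem push_one (X : PhiObj C) : push 1 X = X :=
  ((ext_iff_push 1 X X).mpr ⟨fun _ => rfl, fun i h => absurd rfl (h i)⟩).symm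

theorem push_mul (u v : Inj) (X : PhiObj C) : push (u * v) X = push u (push v X) := by
  refine ((ext_iff_push _ _ _).mpr ⟨fun j => ?_, fun i h => ?_⟩).symm
  · rw [Inj.mul_apply, push_apply, push_apply]
  · by_cases hi : ∃ j, u j = i
    · obtain ⟨j, rfl⟩ := hi
      rw [push_apply]
      exact push_of_notMem v X j fun k hk => h k (by rw [Inj.mul_apply, hk])
    · exact push_of_notMem u _ i (by simpa using hi)

theorem perm_push (u : Inj) (X : PhiObj C) : (X.idx.map u).Perm (push u X).idx := by
  refine (perm_idx _ (X.nodup_idx.map u.injective) fun i => ?_).symm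
  rw [List.mem_map]
  constructor
  · rintro ⟨j, hj, rfl⟩
    rwa [push_apply, ← mem_idx]
  · intro h
    by_cases hi : ∃ j, u j = i
    · obtain ⟨j, rfl⟩ := hi
      exact ⟨j, by rwa [push_apply, ← mem_idx] at h, rfl⟩
    · exact absurd (push_of_notMem u X i (by simpa using hi)) h

end

section
variable {C : Type u} [Category.{v} C] [PermutativeCategory.{v} C]

theorem tens_eq (X : PhiObj C) : X.tens = lprod X.fn X.idx := rfl

theorem tens_push_aux (u : Inj) (X : PhiObj C) : X.tens = lprod (push u X).fn (X.idx.map u) := by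
  rw [tens, lprod, List.map_map]
  exact congrArg List.prod (List.map_congr_left fun j _ => (push_apply u X j).symm)

/-- The coherence isomorphism associated to the bijection `u` from `supp X` to `u(supp X)`. -/
noncomputable def circIso (u : Inj) (X : PhiObj C) : X.tens ≅ (push u X).tens :=
  eqToIso (tens_push_aux u X) ≪≫ cohIso (push u X).fn (X.idx.map u) (push u X).idx (perm_push u X)

theorem mk_circIso (u : Inj) (X : PhiObj C) : Arrow.mk (circIso u X).hom =
    ca (push u X).fn (X.idx.map u) (push u X).idx (perm_push u X) :=
  Arrow.arrow_mk_eqToHom_comp (coh (push u X).fn (X.idx.map u) (push u X).idx (perm_push u X))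
    (tens_push_aux u X)

end
end PhiObj

section PhiCat
variable {C : Type u} [Category.{v} C] [PermutativeCategory.{v} C]

/-- A morphism of `Φ C` is a morphism `⨂ Xᵢ ⟶ ⨂ Yᵢ` of `C`. -/
@[ext] structure PhiHom (X Y : PhiObj C) : Type v where
  hom : X.tens ⟶ Y.tens

/-- The category `Φ C`. -/
noncomputable instance phiCategory : Category.{v} (PhiObj C) where
  Hom X Y := PhiHom X Y
  id X := ⟨𝟙 X.tens⟩
  comp f g := ⟨f.hom ≫ g.hom⟩

namespace PhiObj

@[ext] theorem hom_ext {X Y : PhiObj C} {f g : X ⟶ Y} (h : f.hom = g.hom) : f = g := PhiHom.ext h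
@[simp] theorem comp_hom {X Y Z : PhiObj C} (f : X ⟶ Y) (g : Y ⟶ Z) :
    (f ≫ g).hom = f.hom ≫ g.hom := rfl
@[simp] theorem id_hom (X : PhiObj C) : (𝟙 X : X ⟶ X).hom = 𝟙 X.tens := rfl

theorem mk_hom_congr {X Y X' Y' : PhiObj C} {f : X ⟶ Y} {f' : X' ⟶ Y'}
    (e : Arrow.mk f = Arrow.mk f') : Arrow.mk f.hom = Arrow.mk f'.hom := by
  cases e; rfl

theorem mk_ext {X Y X' Y' : PhiObj C} {f : X ⟶ Y} {f' : X' ⟶ Y'} (eX : X = X') (eY : Y = Y')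
    (e : Arrow.mk f.hom = Arrow.mk f'.hom) : Arrow.mk f = Arrow.mk f' := by
  subst eX; subst eY
  exact congrArg Arrow.mk (PhiHom.ext (hom_eq e))

/-- An isomorphism of `C`, viewed as an isomorphism of `Φ C`. -/
def isoOf {X Y : PhiObj C} (e : X.tens ≅ Y.tens) : X ≅ Y where
  hom := ⟨e.hom⟩
  inv := ⟨e.inv⟩
  hom_inv_id := PhiHom.ext e.hom_inv_id
  inv_hom_id := PhiHom.ext e.inv_hom_id

/-- The isomorphism `u_∘ : X ≅ u_* X`. -/
noncomputable def circ (u : Inj) (X : PhiObj C) : X ≅ push u X := isoOf (circIso u X)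

theorem mk_circ (u : Inj) (X : PhiObj C) : Arrow.mk (circ u X).hom.hom =
    ca (push u X).fn (X.idx.map u) (push u X).idx (perm_push u X) := mk_circIso u X

theorem mk_circ_one (X : PhiObj C) : Arrow.mk (circ 1 X).hom = Arrow.mk (𝟙 X) := by
  refine mk_ext rfl (push_one X) ((mk_circ 1 X).trans ?_)
  refine (ca_congr _ (List.map_id _) (congrArg idx (push_one X)) _).trans ?_
  refine (ca_fun (congrArg fn (push_one X)) _ _ _).trans ?_
  exact ca_self _ _ _

/-- `u_∘` only depends on the values of `u`, and is compatible with relabelling the source. -/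
theorem ca_push (u : Inj) (X : PhiObj C) (l l' : List ℕ+) (h : l.Perm l') :
    ca (push u X).fn (l.map u) (l'.map u) (h.map u) = ca X.fn l l' h :=
  (ca_map u u.injective (push u X).fn l l' h _).trans (ca_fun (funext (push_apply u X)) _ _ _)

theorem mk_circ_mul (u v : Inj) (X : PhiObj C) : Arrow.mk (circ (u * v) X).hom =
    Arrow.mk ((circ v X).hom ≫ (circ u (push v X)).hom) := by
  refine mk_ext rfl (push_mul u v X) ((mk_circ _ X).trans ?_)
  rw [comp_hom, mk_comp, mk_circ, mk_circ, ← ca_push u (push v X), ca_trans]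
  refine (ca_fun (congrArg fn (push_mul u v X)) _ _ _).trans ?_
  exact ca_congr _ (List.map_map (f := v) (g := u)).symm (congrArg idx (push_mul u v X)) _

noncomputable instance phiEM : EMCategory (PhiObj C) :=
  EMCategory.ofCirc push circ mk_circ_one mk_circ_mul

theorem act_obj (u : Inj) (X : PhiObj C) : (act u).obj X = push u X := rfl
theorem act_map (u : Inj) {X Y : PhiObj C} (f : X ⟶ Y) :
    (act u).map f = (circ u X).inv ≫ f ≫ (circ u Y).hom := rfl
theorem br_app (v u : Inj) (X : PhiObj C) :
    (br v u).app X = (circ u X).inv ≫ (circ v X).hom := rfl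

theorem supportedOn_iff (X : PhiObj C) (A : Finset ℕ+) :
    SupportedOn X A ↔ ∀ i, X.fn i ≠ 1 → i ∈ A := by
  constructor
  · intro h i hi
    by_contra hiA
    obtain ⟨u, hu, hu'⟩ := Inj.exists_avoid A {i}
    have e := h u hu
    apply hi
    rw [← e]
    refine push_of_notMem u X i fun j hj => ?_
    by_cases hjA : j ∈ A
    · rw [hu j hjA] at hj
      exact hiA (hj ▸ hjA)
    · exact hu' j hjA (Finset.mem_union_right _ (by simp [hj]))
  · intro h u hu
    refine ((ext_iff_push u X X).mpr ⟨fun j => ?_, fun i hi => ?_⟩).symm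
    · by_cases hj : j ∈ A
      · rw [hu j hj]
      · have h1 : X.fn j = 1 := by
          by_contra h1
          exact hj (h j h1)
        rw [h1]
        by_contra h2
        have h3 := h _ h2
        exact hj (u.injective (hu _ h3) ▸ h3)
    · by_contra h1
      exact hi i (hu i (h i h1))

/-- The support of an object of `Φ C` consists of all those `i` for which `Xᵢ` is not the unit. -/
theorem supp_eq (X : PhiObj C) : supp X = {i | X.fn i ≠ 1} := by
  refine Set.Subset.antisymm (fun i hi => ?_) fun i hi A hA => (supportedOn_iff X A).mp hA i hi
  have := hi X.finite.toFinset ((supportedOn_iff _ _).mpr fun j hj => by simpa using hj)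
  simpa using this

theorem disjoint_iff {X Y : PhiObj C} :
    Disjoint (supp X) (supp Y) ↔ ∀ i, X.fn i ≠ 1 → Y.fn i = 1 := by
  rw [supp_eq, supp_eq, Set.disjoint_left]
  simp

end PhiObj
end PhiCat

section PhiSum
variable {C : Type u} [Category.{v} C] [PermutativeCategory.{v} C]

namespace PhiObj

/-- The zero object of `Φ C`. -/
def zero : PhiObj C := ⟨fun _ => 1, by simp⟩

open Classical in
/-- The sum of two objects; it is only considered if their supports are disjoint. -/
noncomputable def add (X Y : PhiObj C) : PhiObj C where
  fn i := if X.fn i = 1 then Y.fn i else X.fn i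
  finite := by
    refine (X.finite.union Y.finite).subset fun i hi => ?_
    by_cases h : X.fn i = 1
    · exact Or.inr (by simpa [h] using hi)
    · exact Or.inl h

/-- The condition that `X` and `Y` have disjoint supports. -/
abbrev Dis (X Y : PhiObj C) : Prop := Disjoint (supp X) (supp Y)

theorem add_left {X Y : PhiObj C} {i : ℕ+} (h : X.fn i ≠ 1) : (add X Y).fn i = X.fn i := if_neg h

theorem add_of_one {X Y : PhiObj C} {i : ℕ+} (h : X.fn i = 1) : (add X Y).fn i = Y.fn i := if_pos h

theorem add_right {X Y : PhiObj C} (d : Dis X Y) {i : ℕ+} (h : Y.fn i ≠ 1) :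
    (add X Y).fn i = Y.fn i := if_pos (by by_contra h'; exact h (disjoint_iff.mp d i h'))

theorem add_ne_one {X Y : PhiObj C} (d : Dis X Y) {i : ℕ+} :
    (add X Y).fn i ≠ 1 ↔ X.fn i ≠ 1 ∨ Y.fn i ≠ 1 := by
  by_cases h : X.fn i = 1
  · rw [add_of_one h]; simp [h]
  · rw [add_left h]; simp [h]

theorem add_comm' {X Y : PhiObj C} (d : Dis X Y) : add X Y = add Y X := by
  ext i
  by_cases h : X.fn i = 1
  · by_cases h' : Y.fn i = 1
    · rw [add_of_one h, add_of_one h', h, h']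
    · rw [add_right d h', add_left h']
  · rw [add_left h, add_right d.symm h]

theorem add_assoc' (X Y Z : PhiObj C) : add (add X Y) Z = add X (add Y Z) := by
  ext i
  by_cases h : X.fn i = 1
  · rw [add_of_one (Y := add Y Z) h]
    by_cases h' : Y.fn i = 1
    · rw [add_of_one (X := Y) h', add_of_one]
      rw [add_of_one h, h']
    · rw [add_left (X := Y) h', add_left] <;> rw [add_of_one h]
      exact h'
  · rw [add_left (Y := add Y Z) h, add_left] <;> rw [add_left h]
    exact h

theorem zero_add' (X : PhiObj C) : add zero X = X := by
  ext i; exact if_pos rfl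

theorem push_add (u : Inj) (X Y : PhiObj C) : push u (add X Y) = add (push u X) (push u Y) := by
  refine ((ext_iff_push _ _ _).mpr ⟨fun j => ?_, fun i h => ?_⟩).symm
  · by_cases h : X.fn j = 1
    · rw [add_of_one h, add_of_one (by rwa [push_apply]), push_apply]
    · rw [add_left h, add_left (by rwa [push_apply]), push_apply]
  · rw [add_of_one (push_of_notMem u X i h), push_of_notMem u Y i h]

theorem add_fn_left {X Y : PhiObj C} (i : ℕ+) (h : i ∈ X.idx) : (add X Y).fn i = X.fn i :=
  add_left ((mem_idx X i).mp h)

theorem add_fn_right {X Y : PhiObj C} (d : Dis X Y) (i : ℕ+) (h : i ∈ Y.idx) :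
    (add X Y).fn i = Y.fn i := add_right d ((mem_idx Y i).mp h)

theorem idx_disjoint {X Y : PhiObj C} (d : Dis X Y) : ∀ i ∈ X.idx, i ∉ Y.idx := fun i h h' =>
  (mem_idx Y i).mp h' (disjoint_iff.mp d i ((mem_idx X i).mp h))

theorem perm_add {X Y : PhiObj C} (d : Dis X Y) : (add X Y).idx.Perm (X.idx ++ Y.idx) := by
  refine perm_idx _ (List.nodup_append'.mpr ⟨X.nodup_idx, Y.nodup_idx, idx_disjoint d⟩) fun i => ?_
  rw [List.mem_append, mem_idx, mem_idx, add_ne_one d]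

theorem lprod_fun {ι : Type*} {X Y : ι → C} {l : List ι} (e : ∀ i ∈ l, X i = Y i) :
    lprod X l = lprod Y l := congrArg List.prod (List.map_congr_left e)

theorem tens_add_aux {X Y : PhiObj C} (d : Dis X Y) :
    lprod (add X Y).fn (X.idx ++ Y.idx) = X.tens * Y.tens := by
  rw [lprod_append, lprod_fun add_fn_left, lprod_fun (add_fn_right d)]
  rfl

/-- The coherence isomorphism from `⨂ (X + Y)ᵢ` to `⨂ Xᵢ ⊗ ⨂ Yᵢ` that permutes the factors. -/
noncomputable def split (X Y : PhiObj C) (d : Dis X Y) : (add X Y).tens ≅ X.tens * Y.tens :=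
  cohIso (add X Y).fn (add X Y).idx (X.idx ++ Y.idx) (perm_add d) ≪≫ eqToIso (tens_add_aux d)

theorem mk_split (X Y : PhiObj C) (d : Dis X Y) : Arrow.mk (split X Y d).hom =
    ca (add X Y).fn (add X Y).idx (X.idx ++ Y.idx) (perm_add d) :=
  Arrow.arrow_mk_comp_eqToHom (coh (add X Y).fn (add X Y).idx (X.idx ++ Y.idx) (perm_add d))
    (tens_add_aux d)

theorem mk_split_inv (X Y : PhiObj C) (d : Dis X Y) : Arrow.mk (split X Y d).inv =
    ca (add X Y).fn (X.idx ++ Y.idx) (add X Y).idx (perm_add d).symm :=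
  Arrow.arrow_mk_eqToHom_comp (coh (add X Y).fn (X.idx ++ Y.idx) (add X Y).idx (perm_add d).symm)
    (tens_add_aux d).symm

/-- The sum of morphisms: the conjugate of `f ⊗ g` by the coherence isomorphisms `split`. -/
noncomputable def addHom {X Y X' Y' : PhiObj C} (f : X ⟶ Y) (g : X' ⟶ Y') (d : Dis X X')
    (d' : Dis Y Y') : add X X' ⟶ add Y Y' :=
  PhiHom.mk ((split X X' d).hom ≫ (f.hom ⊗ₚ g.hom) ≫ (split Y Y' d').inv)

theorem mk_addHom {X Y X' Y' : PhiObj C} (f : X ⟶ Y) (g : X' ⟶ Y') (d : Dis X X') (d' : Dis Y Y') :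
    Arrow.mk (addHom f g d d').hom =
      ca (add X X').fn (add X X').idx (X.idx ++ X'.idx) (perm_add d) ⋄
        (Arrow.mk f.hom * Arrow.mk g.hom) ⋄
        ca (add Y Y').fn (Y.idx ++ Y'.idx) (add Y Y').idx (perm_add d').symm := by
  refine (mk_comp _ _).trans ?_
  rw [mk_split, mk_comp, mk_split_inv, mk_tensor]

theorem addHom_id (X Y : PhiObj C) (d : Dis X Y) : addHom (𝟙 X) (𝟙 Y) d d = 𝟙 (add X Y) := by
  apply hom_ext
  simp [addHom, tensorHom_id]

theorem addHom_comp {X Y Z X' Y' Z' : PhiObj C} (f : X ⟶ Y) (g : Y ⟶ Z) (f' : X' ⟶ Y')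
    (g' : Y' ⟶ Z') (d : Dis X X') (d' : Dis Y Y') (d'' : Dis Z Z') :
    addHom (f ≫ g) (f' ≫ g') d d'' = addHom f f' d d' ≫ addHom g g' d' d'' := by
  apply hom_ext
  simp [addHom, tensorHom_comp]

theorem addHom_congr {X Y Z W X' Y' Z' W' : PhiObj C} {f : X ⟶ Y} {g : Z ⟶ W} {f' : X' ⟶ Y'}
    {g' : Z' ⟶ W'} (e : Arrow.mk f = Arrow.mk f') (e' : Arrow.mk g = Arrow.mk g')
    (h : Dis X Z) (k : Dis Y W) (h' : Dis X' Z') (k' : Dis Y' W') :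
    Arrow.mk (addHom f g h k) = Arrow.mk (addHom f' g' h' k') := by
  cases e; cases e'; rfl

/-- The sum of isomorphisms. -/
noncomputable def addIso {X Y X' Y' : PhiObj C} (e : X ≅ Y) (e' : X' ≅ Y') (d : Dis X X')
    (d' : Dis Y Y') : add X X' ≅ add Y Y' where
  hom := addHom e.hom e'.hom d d'
  inv := addHom e.inv e'.inv d' d
  hom_inv_id := by rw [← addHom_comp, e.hom_inv_id, e'.hom_inv_id, addHom_id]
  inv_hom_id := by rw [← addHom_comp, e.inv_hom_id, e'.inv_hom_id, addHom_id]

/-- The isomorphisms `u_∘` are additive. -/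
theorem circ_add (u : Inj) (X Y : PhiObj C) (d : Dis X Y) (d' : Dis (push u X) (push u Y)) :
    Arrow.mk (circ u (add X Y)).hom =
      Arrow.mk (addIso (circ u X) (circ u Y) d d').hom := by
  refine mk_ext rfl (push_add u X Y) ((mk_circ u _).trans (Eq.trans ?_ (mk_addHom _ _ d d').symm))
  have e := push_add u X Y
  have eX : ∀ i ∈ X.idx.map u, (push u X).fn i = (push u (add X Y)).fn i := fun i hi => by
    obtain ⟨j, hj, rfl⟩ := List.mem_map.mp hi
    rw [push_apply, push_apply, add_fn_left j hj]
  have eY : ∀ i ∈ Y.idx.map u, (push u Y).fn i = (push u (add X Y)).fn i := fun i hi => by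
    obtain ⟨j, hj, rfl⟩ := List.mem_map.mp hi
    rw [push_apply, push_apply, add_fn_right d j hj]
  rw [mk_circ, mk_circ, ca_congr_fun _ _ _ _ eX, ca_congr_fun _ _ _ _ eY, ← coh_append _ _ _ _ _ _ _
    ((perm_push u X).append (perm_push u Y)), ca_fun (congrArg fn e.symm),
    ca_congr _ rfl (congrArg idx e.symm), ca_trans, ← ca_push u (add X Y),
    ca_congr _ rfl List.map_append, ca_trans]

theorem act_addHom (u : Inj) {X Y X' Y' : PhiObj C} (f : X ⟶ Y) (g : X' ⟶ Y') (d : Dis X X')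
    (d' : Dis Y Y') (k : Dis (push u X) (push u X')) (k' : Dis (push u Y) (push u Y')) :
    Arrow.mk ((act u).map (addHom f g d d')) =
      Arrow.mk (addHom ((act u).map f) ((act u).map g) k k') := by
  refine (mk_conj _ _ _ _ _ _ (circ_add u X X' d k) (circ_add u Y Y' d' k') rfl).trans ?_
  exact congrArg Arrow.mk ((addHom_comp (circ u X).inv (f ≫ (circ u Y).hom) (circ u X').inv
    (g ≫ (circ u Y').hom) k d k').trans (congrArg (fun z => addHom _ _ k d ≫ z)
      (addHom_comp f (circ u Y).hom g (circ u Y').hom d d' k'))).symm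

theorem br_add (v u : Inj) (X Y : PhiObj C) (d : Dis X Y) (k : Dis (push u X) (push u Y))
    (k' : Dis (push v X) (push v Y)) : Arrow.mk ((br v u).app (add X Y)) =
      Arrow.mk (addHom ((br v u).app X) ((br v u).app Y) k k') := by
  refine (mk_conj' _ _ _ _ (circ_add u X Y d k) (circ_add v X Y d k')).trans ?_
  exact congrArg Arrow.mk (addHom_comp (circ u X).inv (circ v X).hom (circ u Y).inv
    (circ v Y).hom k d k').symm

theorem idx_zero : (zero : PhiObj C).idx = [] :=
  List.eq_nil_iff_forall_not_mem.mpr fun i hi => (mem_idx _ i).mp hi rfl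

theorem tens_zero : (zero : PhiObj C).tens = 1 := by rw [tens_eq, idx_zero, lprod_nil]

theorem one_mul_ia (a : Arrow C) : ia 1 * a = a := one_mul a

theorem zero_addHom {X Y : PhiObj C} (f : X ⟶ Y) (d : Dis zero X) (d' : Dis zero Y) :
    Arrow.mk (addHom (𝟙 zero) f d d') = Arrow.mk f := by
  have key : ∀ Z : PhiObj C, (zero : PhiObj C).idx ++ Z.idx = (add zero Z).idx := fun Z => by
    rw [zero_add', idx_zero, List.nil_append]
  have key' : ∀ Z : PhiObj C, lprod (add zero Z).fn (add zero Z).idx = Z.tens :=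
    fun Z => congrArg (fun W : PhiObj C => lprod W.fn W.idx) (zero_add' Z)
  refine mk_ext (zero_add' X) (zero_add' Y) ((mk_addHom _ _ d d').trans ?_)
  rw [ca_congr _ rfl (key X), ca_congr _ (key Y) rfl, ca_self, ca_self, key', key', id_hom, tens_zero,
    one_mul_ia, acomp_ia (X := Y.tens) (a := Arrow.mk f.hom) rfl, ia_acomp (X := X.tens) rfl]

theorem addHom_comm {X Y X' Y' : PhiObj C} (f : X ⟶ Y) (g : X' ⟶ Y') (d : Dis X X')
    (d' : Dis Y Y') : Arrow.mk (addHom f g d d') = Arrow.mk (addHom g f d.symm d'.symm) := by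
  have key : ∀ (Z W : PhiObj C) (k : Dis Z W), (split Z W k).hom ≫ τ _ _ =
      eqToHom (congrArg tens (add_comm' k)) ≫ (split W Z k.symm).hom := fun Z W k => by
    apply hom_eq
    rw [Arrow.arrow_mk_eqToHom_comp, mk_comp, mk_split, mk_split]
    have e : ta Z.tens W.tens = ca (add Z W).fn (Z.idx ++ W.idx) (W.idx ++ Z.idx)
        List.perm_append_comm := by
      rw [coh_swap _ _ _ (idx_disjoint k), lprod_fun add_fn_left, lprod_fun (add_fn_right k)]
      rfl
    refine (congrArg _ e).trans ?_
    rw [ca_trans, ca_fun (congrArg fn (add_comm' k)), ca_congr _ (congrArg idx (add_comm' k)) rfl]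
  refine mk_ext (add_comm' d) (add_comm' d') ?_
  have h : (addHom f g d d').hom = eqToHom (congrArg tens (add_comm' d)) ≫
      (addHom g f d.symm d'.symm).hom ≫ eqToHom (congrArg tens (add_comm' d')).symm := by
    have h1 := key _ _ d
    have h2 := key _ _ d'
    have hτ : IsIso (τ Y.tens Y'.tens) := ⟨τ _ _, τ_τ _ _, τ_τ _ _⟩
    rw [← cancel_mono (split Y Y' d').hom, ← cancel_mono (τ Y.tens Y'.tens)]
    simp only [addHom, Category.assoc, Iso.inv_hom_id, Category.comp_id]
    rw [τ_natural, ← Category.assoc, h1, h2]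
    simp
  rw [h, Arrow.arrow_mk_eqToHom_comp, Arrow.arrow_mk_comp_eqToHom]

/-- The tensor product of isomorphisms. -/
def tensorIso {X Y X' Y' : C} (e : X ≅ Y) (e' : X' ≅ Y') : X * X' ≅ Y * Y' where
  hom := e.hom ⊗ₚ e'.hom
  inv := e.inv ⊗ₚ e'.inv
  hom_inv_id := by rw [← tensorHom_comp, e.hom_inv_id, e'.hom_inv_id, tensorHom_id]
  inv_hom_id := by rw [← tensorHom_comp, e.inv_hom_id, e'.inv_hom_id, tensorHom_id]

theorem addHom_assoc {X Y Z X' Y' Z' : PhiObj C} (f : X ⟶ X') (g : Y ⟶ Y') (k : Z ⟶ Z')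
    (hXY : Dis X Y) (hYZ : Dis Y Z) (h : Dis (add X Y) Z) (h' : Dis X (add Y Z))
    (hXY' : Dis X' Y') (hYZ' : Dis Y' Z') (k₁ : Dis (add X' Y') Z') (k₂ : Dis X' (add Y' Z')) :
    Arrow.mk (addHom (addHom f g hXY hXY') k h k₁) =
      Arrow.mk (addHom f (addHom g k hYZ hYZ') h' k₂) := by
  have key : ∀ (X Y Z : PhiObj C) (hXY : Dis X Y) (hYZ : Dis Y Z) (h : Dis (add X Y) Z)
      (h' : Dis X (add Y Z)), Arrow.mk ((split _ _ h).hom ≫ ((split _ _ hXY).hom ⊗ₚ 𝟙 Z.tens)) =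
        Arrow.mk ((split _ _ h').hom ≫ (𝟙 X.tens ⊗ₚ (split _ _ hYZ).hom)) := by
    intro X Y Z hXY hYZ h h'
    have e := add_assoc' X Y Z
    have e₁ : Arrow.mk ((split X Y hXY).hom ⊗ₚ 𝟙 Z.tens) = ca (add (add X Y) Z).fn
        ((add X Y).idx ++ Z.idx) ((X.idx ++ Y.idx) ++ Z.idx)
        ((perm_add hXY).append (List.Perm.refl _)) := by
      rw [coh_append _ _ _ _ _ (perm_add hXY) (List.Perm.refl _),
        ca_congr_fun _ _ _ _ add_fn_left, ca_congr_fun _ _ _ _ (add_fn_right h), ca_self,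
        mk_tensor, mk_split]
      rfl
    have e₂ : Arrow.mk (𝟙 X.tens ⊗ₚ (split Y Z hYZ).hom) = ca (add X (add Y Z)).fn
        (X.idx ++ (add Y Z).idx) (X.idx ++ (Y.idx ++ Z.idx))
        ((List.Perm.refl _).append (perm_add hYZ)) := by
      rw [coh_append _ _ _ _ _ (List.Perm.refl _) (perm_add hYZ),
        ca_congr_fun _ _ _ _ add_fn_left, ca_congr_fun _ _ _ _ (add_fn_right h'), ca_self,
        mk_tensor, mk_split]
      rfl
    rw [mk_comp, mk_comp, e₁, e₂, mk_split, mk_split, ca_trans, ca_trans,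
      ca_fun (congrArg fn e), ca_congr _ (congrArg idx e) (List.append_assoc _ _ _)]
  refine mk_ext (add_assoc' _ _ _) (add_assoc' _ _ _) ?_
  have e₁ : (addHom (addHom f g hXY hXY') k h k₁).hom =
      (split _ _ h ≪≫ tensorIso (split _ _ hXY) (Iso.refl Z.tens)).hom ≫
        ((f.hom ⊗ₚ g.hom) ⊗ₚ k.hom) ≫
        (split _ _ k₁ ≪≫ tensorIso (split _ _ hXY') (Iso.refl Z'.tens)).inv := by
    simp only [addHom, tensorIso, Iso.trans_hom, Iso.trans_inv, Iso.refl_hom, Iso.refl_inv,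
      Category.assoc]
    rw [← Category.assoc (_ ⊗ₚ k.hom), ← tensorHom_comp, ← Category.assoc (_ ⊗ₚ 𝟙 _),
      ← tensorHom_comp]
    simp
  have e₂ : (addHom f (addHom g k hYZ hYZ') h' k₂).hom =
      (split _ _ h' ≪≫ tensorIso (Iso.refl X.tens) (split _ _ hYZ)).hom ≫
        (f.hom ⊗ₚ (g.hom ⊗ₚ k.hom)) ≫
        (split _ _ k₂ ≪≫ tensorIso (Iso.refl X'.tens) (split _ _ hYZ')).inv := by
    simp only [addHom, tensorIso, Iso.trans_hom, Iso.trans_inv, Iso.refl_hom, Iso.refl_inv,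
      Category.assoc]
    rw [← Category.assoc (f.hom ⊗ₚ _), ← tensorHom_comp, ← Category.assoc (𝟙 _ ⊗ₚ _),
      ← tensorHom_comp]
    simp
  rw [e₁, e₂]
  exact mk_conj'' (split _ _ h ≪≫ tensorIso (split _ _ hXY) (Iso.refl Z.tens))
    (split _ _ h' ≪≫ tensorIso (Iso.refl X.tens) (split _ _ hYZ))
    (split _ _ k₁ ≪≫ tensorIso (split _ _ hXY') (Iso.refl Z'.tens))
    (split _ _ k₂ ≪≫ tensorIso (Iso.refl X'.tens) (split _ _ hYZ')) _ _
    (key _ _ _ hXY hYZ h h') (key _ _ _ hXY' hYZ' k₁ k₂) (tensorHom_assoc _ _ _)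

end PhiObj

open PhiObj in
/-- `Φ C` is a parsummable category. -/
noncomputable instance phiParSummable : ParSummable.{v} (PhiObj C) where
  tame X := ⟨X.finite.toFinset, (supportedOn_iff _ _).mpr fun i hi => by simpa using hi⟩
  zero := zero
  supp_zero := by rw [supp_eq]; simp [zero]
  add X Y _ := add X Y
  addHom f g h h' := PhiObj.addHom f g h h'
  addHom_id X Y h := PhiObj.addHom_id X Y h
  addHom_comp f g f' g' h h' h'' := PhiObj.addHom_comp f g f' g' h h' h''
  act_add u X Y _ _ := push_add u X Y
  act_addHom u _ _ _ _ f g h h' k k' := PhiObj.act_addHom u f g h h' k k'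
  br_add v u X Y h k k' := PhiObj.br_add v u X Y h k k'
  zero_add X _ := zero_add' X
  zero_addHom f h h' := PhiObj.zero_addHom f h h'
  add_comm _ _ h := add_comm' h
  addHom_comm f g h h' := PhiObj.addHom_comm f g h h'
  add_assoc X Y Z _ _ _ _ _ := add_assoc' X Y Z
  addHom_assoc f g k h₁ _ h₂ h h' h₃ _ h₄ k₁ k₂ :=
    PhiObj.addHom_assoc f g k h₁ h₂ h h' h₃ h₄ k₁ k₂

end PhiSum

section PhiFunctor
variable {C D : Type*} [Category C] [PermutativeCategory C] [Category D] [PermutativeCategory D]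

open PermutativeCategory

theorem StrictFunctor.obj_lprod (F : StrictFunctor C D) {ι : Type*} (X : ι → C) (l : List ι) :
    F.obj (lprod X l) = lprod (fun i => F.obj (X i)) l := by
  induction l with
  | nil => rw [lprod_nil, lprod_nil, F.obj_one]
  | cons a l ih => rw [lprod_cons, lprod_cons, F.obj_mul, ih]

namespace StrictFunctor

/-- The map induced by a functor on the set of all morphisms. -/
abbrev ma (F : StrictFunctor C D) (a : Arrow C) : Arrow D := Arrow.mk (F.map a.hom)

theorem ma_acomp (F : StrictFunctor C D) {a b : Arrow C} (h : a.right = b.left) :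
    F.ma (a ⋄ b) = F.ma a ⋄ F.ma b := by
  obtain ⟨X, Y, f, rfl⟩ := Arrow.mk_surjective a
  obtain ⟨Y', Z, g, rfl⟩ := Arrow.mk_surjective b
  obtain rfl : Y = Y' := h
  rw [← mk_comp]
  exact (congrArg Arrow.mk (F.map_comp f g)).trans (mk_comp _ _)

theorem ma_mul (F : StrictFunctor C D) (a b : Arrow C) : F.ma (a * b) = F.ma a * F.ma b :=
  F.map_tensor a.hom b.hom

theorem ma_ia (F : StrictFunctor C D) (X : C) : F.ma (ia X) = ia (F.obj X) :=
  congrArg Arrow.mk (F.map_id X)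

theorem ma_fa (F : StrictFunctor C D) {ι : Type*} [DecidableEq ι] (X : ι → C)
    (a : ι) (l : List ι) (h : a ∈ l) : F.ma (fa X a l h) = fa (fun i => F.obj (X i)) a l h := by
  induction l with
  | nil => simp at h
  | cons b l ih =>
    by_cases hb : b = a
    · subst hb
      rw [fa_self, fa_self, ma_ia, F.obj_lprod]
    · have h1 : a ∈ l := by simpa [Ne.symm hb] using h
      rw [fa_ne X hb _ _ h1, fa_ne _ hb _ _ h1, ma_acomp _ (by simp [mul_assoc]), ma_mul, ma_mul, ma_ia, ma_ia,
        ih h1, F.obj_lprod]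
      exact congrArg (fun z => _ ⋄ (z * _)) (F.map_τ _ _)

theorem ma_ca (F : StrictFunctor C D) {ι : Type*} [DecidableEq ι] (X : ι → C)
    (l l' : List ι) (h : l.Perm l') : F.ma (ca X l l' h) = ca (fun i => F.obj (X i)) l l' h := by
  induction l' generalizing l with
  | nil =>
    obtain rfl := List.perm_nil.mp h
    rw [ca_self, ca_self, ma_ia, F.obj_lprod]
  | cons a t ih =>
    have ha : a ∈ l := h.mem_iff.mpr (by simp)
    have ht : (l.erase a).Perm t := by simpa using h.erase a
    rw [ca_cons X l a t h ha ht, ca_cons _ l a t h ha ht, ma_acomp _ (by simp), ma_mul, ma_fa, ma_ia,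
      ih]

end StrictFunctor

namespace PhiObj

/-- `Φ(F)` on objects. -/
def map (F : StrictFunctor C D) (X : PhiObj C) : PhiObj D where
  fn i := F.obj (X.fn i)
  finite := X.finite.subset fun i hi h => hi (by rw [h, F.obj_one])

theorem map_fn (F : StrictFunctor C D) (X : PhiObj C) (i : ℕ+) :
    (map F X).fn i = F.obj (X.fn i) := rfl

theorem map_one {F : StrictFunctor C D} {X : PhiObj C} {i : ℕ+} (h : X.fn i = 1) :
    (map F X).fn i = 1 := by rw [map_fn, h, F.obj_one]

open Classical in
/-- Whether the `i`-th entry is different from the unit. -/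
noncomputable def nz (X : PhiObj C) (i : ℕ+) : Bool := decide (X.fn i ≠ 1)

theorem nz_iff (X : PhiObj C) (i : ℕ+) : X.nz i = true ↔ X.fn i ≠ 1 := by simp [nz]

theorem nz_one (X : PhiObj C) (i : ℕ+) (h : X.nz i = false) : X.fn i = 1 := by
  by_contra h'
  rw [(nz_iff X i).mpr h'] at h
  exact absurd h (by simp)

theorem idx_eq (X : PhiObj C) {l : List ℕ+} (hl : l.Pairwise (· ≤ ·)) (hl' : l.Nodup)
    (h : ∀ i, X.fn i ≠ 1 → i ∈ l) : X.idx = l.filter X.nz := by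
  refine List.Perm.eq_of_pairwise' X.sorted_idx (hl.sublist List.filter_sublist)
    (perm_idx X (hl'.filter _) fun i => ?_)
  rw [List.mem_filter, nz_iff]
  exact ⟨fun h' => h'.2, fun h' => ⟨h i h', h'⟩⟩

theorem idx_map (F : StrictFunctor C D) (X : PhiObj C) : (map F X).idx = X.idx.filter (map F X).nz :=
  idx_eq _ X.sorted_idx X.nodup_idx fun i hi => by
    rw [mem_idx]; exact fun h => hi (map_one h)

theorem obj_tens (F : StrictFunctor C D) (X : PhiObj C) : F.obj X.tens = (map F X).tens := by
  rw [tens_eq, tens_eq, F.obj_lprod, idx_map, lprod_filter _ _ (nz_one _)]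
  rfl

/-- `Φ(F)` on morphisms. -/
noncomputable def mapHom (F : StrictFunctor C D) {X Y : PhiObj C} (f : X ⟶ Y) : map F X ⟶ map F Y :=
  PhiHom.mk (eqToHom (obj_tens F X).symm ≫ F.map f.hom ≫ eqToHom (obj_tens F Y))

theorem mk_mapHom (F : StrictFunctor C D) {X Y : PhiObj C} (f : X ⟶ Y) :
    Arrow.mk (mapHom F f).hom = Arrow.mk (F.map f.hom) := by
  refine (Arrow.arrow_mk_eqToHom_comp _ _).trans (Arrow.arrow_mk_comp_eqToHom _ _)

theorem map_push (F : StrictFunctor C D) (u : Inj) (X : PhiObj C) :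
    map F (push u X) = push u (map F X) :=
  (ext_iff_push u _ _).mpr ⟨fun j => congrArg F.obj (push_apply u X j),
    fun i h => map_one (push_of_notMem u X i h)⟩

theorem map_add (F : StrictFunctor C D) (X Y : PhiObj C) (d : Dis X Y) :
    map F (add X Y) = add (map F X) (map F Y) := by
  ext i
  by_cases h : X.fn i = 1
  · rw [add_of_one (map_one h), map_fn, add_of_one h, map_fn]
  · rw [map_fn, add_left h]
    have h2 : (map F Y).fn i = 1 := map_one (disjoint_iff.mp d i h)
    by_cases h' : (map F X).fn i = 1
    · rw [add_of_one h', h2, ← h', map_fn]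
    · rw [add_left h', map_fn]

/-- Functors preserve coherence isomorphisms; entries equal to the unit may be dropped. -/
theorem ma_ca_filter (F : StrictFunctor C D) (X : PhiObj C) (l l' : List ℕ+) (h : l.Perm l') :
    F.ma (ca X.fn l l' h) = ca (map F X).fn (l.filter (map F X).nz) (l'.filter (map F X).nz)
      (h.filter _) := by
  rw [F.ma_ca, ca_filter _ _ (nz_one _) l l' h]
  rfl

theorem map_circ (F : StrictFunctor C D) (u : Inj) (X : PhiObj C) :
    Arrow.mk (mapHom F (circ u X).hom) = Arrow.mk (circ u (map F X)).hom := by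
  have e := map_push F u X
  refine mk_ext rfl e ?_
  rw [mk_mapHom]
  refine (map_mk_congr F.toFunctor (mk_circ u X)).trans ((ma_ca_filter F (push u X) _ _ _).trans ?_)
  rw [mk_circ]
  refine (ca_fun (congrArg fn e) _ _ _).trans (ca_congr _ ?_ ?_ _)
  · rw [List.filter_map, idx_map]
    refine congrArg (List.map u) (List.filter_congr fun i _ => ?_)
    rw [Bool.eq_iff_iff, nz_iff]
    rw [Function.comp, nz_iff, map_fn, map_fn, push_apply]
  · rw [← idx_map, e]

/-- `Φ(F)`, as a functor. -/
noncomputable def mapFunctor (F : StrictFunctor C D) : PhiObj C ⥤ PhiObj D where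
  obj := map F
  map f := mapHom F f
  map_id X := by apply hom_ext; simp [mapHom]
  map_comp f g := by apply hom_ext; simp [mapHom]

/-- `Φ(F)` on isomorphisms. -/
noncomputable abbrev mapIso (F : StrictFunctor C D) {X Y : PhiObj C} (e : X ≅ Y) :
    map F X ≅ map F Y := (mapFunctor F).mapIso e

theorem map_split (F : StrictFunctor C D) (X Y : PhiObj C) (d : Dis X Y)
    (d' : Dis (map F X) (map F Y)) :
    Arrow.mk (F.map (split X Y d).hom) = Arrow.mk (split (map F X) (map F Y) d').hom := by
  have e := map_add F X Y d
  refine (map_mk_congr F.toFunctor (mk_split X Y d)).trans ((ma_ca_filter F (add X Y) _ _ _).trans ?_)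
  rw [mk_split]
  refine (ca_fun (congrArg fn e) _ _ _).trans (ca_congr _ ?_ ?_ _)
  · rw [← idx_map, e]
  · rw [List.filter_append, idx_map, idx_map]
    refine congrArg₂ (· ++ ·) (List.filter_congr fun i hi => ?_) (List.filter_congr fun i hi => ?_)
    · rw [Bool.eq_iff_iff, nz_iff, nz_iff, map_fn, add_fn_left i hi, map_fn]
    · rw [Bool.eq_iff_iff, nz_iff, nz_iff, map_fn, add_fn_right d i hi, map_fn]

theorem map_addHom (F : StrictFunctor C D) {X Y X' Y' : PhiObj C} (f : X ⟶ Y) (g : X' ⟶ Y')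
    (d : Dis X X') (d' : Dis Y Y') (k : Dis (map F X) (map F X')) (k' : Dis (map F Y) (map F Y')) :
    Arrow.mk (mapHom F (addHom f g d d')) = Arrow.mk (addHom (mapHom F f) (mapHom F g) k k') := by
  refine mk_ext (map_add F X X' d) (map_add F Y Y' d') ?_
  rw [mk_mapHom]
  have h : Arrow.mk (F.map (f.hom ⊗ₚ g.hom)) =
      Arrow.mk ((mapHom F f).hom ⊗ₚ (mapHom F g).hom) :=
    (F.map_tensor _ _).trans (StrictFunctor.tensor_congr (mk_mapHom F f).symm (mk_mapHom F g).symm)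
  refine Eq.trans ?_ (mk_conj'' (F.mapIso (split X X' d)) (split _ _ k) (F.mapIso (split Y Y' d'))
    (split _ _ k') _ _ (map_split F X X' d k) (map_split F Y Y' d' k') h)
  refine congrArg Arrow.mk ?_
  simp [addHom]

end PhiObj

open PhiObj in
/-- `Φ(F)` is a morphism of parsummable categories. -/
noncomputable def phiMap (F : StrictFunctor C D) : ParFunctor (PhiObj C) (PhiObj D) where
  toFunctor := mapFunctor F
  act_comp u := functor_ext (map_push F u) fun {X Y} f => by
    refine Eq.trans ?_ (mk_conj ((mapFunctor F).mapIso (circ u X)) (circ u (map F X))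
      ((mapFunctor F).mapIso (circ u Y)) (circ u (map F Y)) _ _ (map_circ F u X) (map_circ F u Y) rfl)
    refine congrArg Arrow.mk ?_
    exact ((mapFunctor F).map_comp _ _).trans (congrArg _ ((mapFunctor F).map_comp _ _))
  map_br v u X := by
    refine Eq.trans ?_ (mk_conj' ((mapFunctor F).mapIso (circ u X)) (circ u (map F X))
      ((mapFunctor F).mapIso (circ v X)) (circ v (map F X)) (map_circ F u X) (map_circ F v X))
    exact congrArg Arrow.mk ((mapFunctor F).map_comp _ _)
  obj_zero := PhiObj.ext (funext fun _ => F.obj_one)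
  obj_add X Y d _ := map_add F X Y d
  map_addHom f g d d' k k' := PhiObj.map_addHom F f g d d' k k'

end PhiFunctor

/-- The functor `Φ` from permutative categories to parsummable categories. -/
noncomputable def Phi : PermCat.{v, u} ⥤ ParSumCat.{v, u} where
  obj C := ⟨PhiObj C.carrier⟩
  map F := phiMap F
  map_id C := by
    apply ParFunctor.ext_functor
    refine functor_ext (fun X => rfl) fun {X Y} f => ?_
    exact PhiObj.mk_ext rfl rfl (PhiObj.mk_mapHom (StrictFunctor.id C.carrier) f)
  map_comp {C D E} F G := by
    apply ParFunctor.ext_functor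
    refine functor_ext (fun X => rfl) fun {X Y} f => ?_
    refine PhiObj.mk_ext rfl rfl ((PhiObj.mk_mapHom (StrictFunctor.comp F G) f).trans ?_)
    exact ((PhiObj.mk_mapHom G _).trans
      (map_mk_congr G.toFunctor (PhiObj.mk_mapHom F f))).symm

/-- The isomorphism `u_∘` can be computed by enlarging the index set: if `l` is the list `1, ..., K`
(or any other increasing list), such that `Xᵢ` and `(u_* X)ᵢ` are the unit for all `i` not in `l`, and
if `σ` is a permutation of the entries of `l` such that `σ(i) = u(i)` whenever `Xᵢ` is not the unit,
then `u_∘` is the coherence isomorphism associated to `σ`. -/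
theorem PhiObj.mk_circ_eq {C : Type u} [Category.{v} C] [PermutativeCategory.{v} C] (u : Inj)
    (X : PhiObj C) (l : List ℕ+) (hl : l.Pairwise (· ≤ ·)) (hl' : l.Nodup)
    (h : ∀ i, X.fn i ≠ 1 → i ∈ l) (h' : ∀ i, (push u X).fn i ≠ 1 → i ∈ l) (σ : Equiv.Perm ℕ+)
    (hσ : ∀ i, X.fn i ≠ 1 → σ i = u i) (p : (l.map σ).Perm l) :
    Arrow.mk (circ u X).hom.hom = ca (push u X).fn (l.map σ) l p := by
  have e : ∀ i, (push u X).nz (σ i) = X.nz i := fun i => by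
    rw [Bool.eq_iff_iff, nz_iff, nz_iff]
    constructor
    · intro hi
      by_cases hj : ∃ j, u j = σ i
      · obtain ⟨j, hj⟩ := hj
        rw [← hj, push_apply] at hi
        have := σ.injective ((hσ j hi).trans hj)
        rwa [← this]
      · exact absurd (push_of_notMem u X _ (by simpa using hj)) hi
    · intro hi
      rwa [hσ i hi, push_apply]
  rw [mk_circ, ← ca_filter _ _ (nz_one (push u X)) _ _ p (p.filter _)]
  refine ca_congr _ ?_ (idx_eq _ hl hl' h') _
  rw [List.filter_map, show (push u X).nz ∘ σ = X.nz from funext e, ← idx_eq X hl hl' h]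
  exact List.map_congr_left fun i hi => (hσ i ((mem_idx X i).mp hi)).symm

/-! ### The comparison functor -/

/-- Morphisms of `PermCat` are strict symmetric monoidal functors. -/
abbrev PermCat.strict {C D : PermCat.{v, u}} (F : C ⟶ D) : StrictFunctor C.carrier D.carrier := F

section Comparison
variable {C : Type u} [Category.{v} C] [PermutativeCategory.{v} C]

/-- The injection `φ : {1, ..., m} × ω → ω` is `X`-monotone, for objects `X⁽¹⁾, ..., X⁽ᵐ⁾` of `Φ C`. -/
def Frame.IsMonotone {X : List (PhiObj C)} (φ : Frame X) : Prop :=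
  ∀ (i i' : Fin X.length) (j j' : ℕ+), toLex (i, j) < toLex (i', j') →
    (X.get i).fn j ≠ 1 → (X.get i').fn j' ≠ 1 → φ.app i j < φ.app i' j'

/-- The value of the comparison functor `T` on objects. -/
noncomputable def tObj (X : SigmaObj (PhiObj C)) : C := (X.toList.map PhiObj.tens).prod

/-- The relation `T(α) = g`: there is a representative `(ψ, f, φ)` of `α` such that `φ` and `ψ` are
monotone, and `f` agrees with `g` when viewed as a morphism of `C`. -/
def IsTMap {X Y : SigmaObj (PhiObj C)} (α : X ⟶ Y) (g : tObj X ⟶ tObj Y) : Prop :=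
  ∃ (ψ : Frame Y.toList) (φ : Frame X.toList) (f : φ.sum ⟶ ψ.sum), ψ.IsMonotone ∧ φ.IsMonotone ∧
    α = SigmaHom.mkHom ψ φ f ∧ Arrow.mk f.hom = Arrow.mk g

/-- The strict symmetric monoidal functor `F` is the comparison functor `T`: it has the prescribed
values on objects, and it sends the morphism `[ψ, f, φ]` to `f`, viewed as a morphism of `C`, for
every representative `(ψ, f, φ)` such that `φ` and `ψ` are monotone. -/
structure IsComparison (F : StrictFunctor (SigmaObj (PhiObj C)) C) : Prop where
  obj (X : SigmaObj (PhiObj C)) : F.obj X = tObj X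
  map {X Y : SigmaObj (PhiObj C)} (ψ : Frame Y.toList) (φ : Frame X.toList) (f : φ.sum ⟶ ψ.sum) :
    ψ.IsMonotone → φ.IsMonotone → Arrow.mk (F.map (SigmaHom.mkHom ψ φ f)) = Arrow.mk f.hom

end Comparison

end ParPerm

open ParPerm

/-! The prescription for $T$ refers to monotone representatives only, and these are awkward to
compute with: if $\phi$ and $\theta$ are monotone with disjoint images, then $\phi+\theta$ is
usually not monotone. The proof therefore extends the prescription to arbitrary representatives and
recovers the given one as a special case.

For a tuple $X$ and any injection $\phi$, label the factor $X^{(i)}_j$ by $\phi(i,j)$. The source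
$\bigotimes_i\bigotimes_j X^{(i)}_j$ lists the non-unit factors in the lexicographic order of
$(i,j)$, while the tensor product underlying $\phi_*(X)$ lists them by increasing label. Let
$A_\phi$ be the coherence isomorphism from the first to the second (`assemble`, bundled as
`Frame.asm`). It is built recursively from the isomorphisms $u_\circ$ and `split`, and `mk_assemble`
identifies it with a single `coh`. Put $T[\psi,f,\phi]=A_\psi^{-1}\circ f\circ A_\phi$.

Well-definedness rests on two facts. First, $[\psi,\phi]\circ A_\phi=A_\psi$ (`assemble_brL`), so
the formula only depends on the class of the triple. Second, if $\phi$ is monotone, then the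
lexicographic list of labels is already increasing (`Frame.IsMonotone.pairwise`), so $A_\phi$
permutes nothing and is an identity (`Frame.IsMonotone.mk_asm`); the formula then returns $f$.
Monotone injections exist (`Frame.exists_isMonotone`), so the values on monotone representatives
determine $T$.

The remaining claims are properties of $A_\phi$. Functoriality is cancellation of $A_\psi$ with its
inverse. Compatibility with tensor products holds because $A_{\phi+\theta}$ is $A_\phi\otimes
A_\theta$ followed by the inverse of `split` (`mk_assemble_append`), and $f+g$ is the conjugate of
$f\otimes g$ by `split`. The symmetry of $\Sigma\Phi\mathscr C$ is represented by an identity, so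
its image is $A_{\theta+\phi}^{-1}\circ A_{\phi+\theta}$, the coherence isomorphism of a block
transposition, which is $\tau$ by `coh_swap`. Naturality says that strict functors preserve $A_\phi$
(`map_assemble`). Conjugation by isomorphisms is bijective, so $T$ is fully faithful, and an object
$c$ is the value at a tuple with one member, concentrated in one entry.

Many sources and targets agree only propositionally, so such identities are stated in the set `Arrow
C` of all morphisms; calling $A_\phi$ an identity is meant in this sense. -/

namespace ParPerm

open PermutativeCategory EMCategory

/-! ### Assembly isomorphisms from iterated tensor products to generalized sums. -/

section Assembly
variable {C : Type u} [Category.{v} C] [PermutativeCategory.{v} C]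

/-- The coherence isomorphism from the ordered tensor product of the tuple `X` to the tensor product
of the generalized sum `φ_*(X)`. -/
noncomputable def assemble : (X : List (PhiObj C)) → (φ : List Inj) → (h : PD φ) →
    φ.length = X.length → ((X.map PhiObj.tens).prod ≅ (push φ h X).tens)
  | [], [], _, _ => eqToIso PhiObj.tens_zero.symm
  | x :: X, u :: φ, h, l =>
    -- This follows the recursion of `push`, whose value here is the sum of $u_*x$ and the
    -- generalized sum of the tail.
    PhiObj.tensorIso (PhiObj.circIso u x) (assemble X φ (pd_cons.mp h).2 (by simpa using l)) ≪≫
      (PhiObj.split (PhiObj.push u x) (push φ (pd_cons.mp h).2 X) (disjoint_cons h x X)).symm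
  -- Lists of different lengths are excluded by the length hypothesis.
  | _ :: _, [], _, l => by simp at l
  | [], _ :: _, _, l => by simp at l

theorem assemble_nil (h : PD []) (l : [].length = ([] : List (PhiObj C)).length) :
    assemble ([] : List (PhiObj C)) [] h l = eqToIso PhiObj.tens_zero.symm := by
  rw [assemble]; rfl

theorem assemble_cons (x : PhiObj C) (X : List (PhiObj C)) (u : Inj) (φ : List Inj)
    (h : PD (u :: φ)) (l : (u :: φ).length = (x :: X).length) (l' : φ.length = X.length) :
    assemble (x :: X) (u :: φ) h l =
      PhiObj.tensorIso (PhiObj.circIso u x) (assemble X φ (pd_cons.mp h).2 l') ≪≫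
        (PhiObj.split (PhiObj.push u x) (push φ (pd_cons.mp h).2 X) (disjoint_cons h x X)).symm := by
  rw [assemble]; rfl

/-- The inductive step of `assemble_brL` in abstract form: $i=u_\circ$, $j=v_\circ$, the
isomorphisms $s,t$ are splittings, and $k,k',b$ belong to the tail. The two copies of $s$ cancel,
and so do $i$ and its inverse after interchange of tensor product and composition. -/
theorem tensorHom_conj {A A₁ A₂ B B₁ B₂ P Q : C} (i : A ≅ A₁) (j : A ≅ A₂) (k : B ⟶ B₁)
    (b : B₁ ⟶ B₂) (k' : B ⟶ B₂) (hk : k ≫ b = k') (s : P ≅ A₁ * B₁) (t : Q ≅ A₂ * B₂) :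
    ((i.hom ⊗ₚ k) ≫ s.inv) ≫ s.hom ≫ ((i.inv ≫ j.hom) ⊗ₚ b) ≫ t.inv = (j.hom ⊗ₚ k') ≫ t.inv := by
  rw [Category.assoc, Iso.inv_hom_id_assoc, ← Category.assoc, ← tensorHom_comp,
    Iso.hom_inv_id_assoc, hk]

/-- The structure isomorphisms `[ψ, φ]` are compatible with the assembly isomorphisms. -/
theorem assemble_brL (X : List (PhiObj C)) (φ ψ : List Inj) (hφ : PD φ) (hψ : PD ψ)
    (lφ : φ.length = X.length) (lψ : ψ.length = X.length) :
    (assemble X φ hφ lφ).hom ≫ (brL X φ ψ hφ hψ lφ lψ).hom = (assemble X ψ hψ lψ).hom := by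
  induction X generalizing φ ψ with
  | nil =>
    obtain rfl : φ = [] := by simpa using lφ
    obtain rfl : ψ = [] := by simpa using lψ
    rw [brL_nil]
    -- The empty sum does not depend on any injection, so both assembly isomorphisms are the same
    -- one.
    exact Category.comp_id _
  | cons x X ih =>
    cases φ with
    | nil => simp at lφ
    | cons u φ =>
    cases ψ with
    | nil => simp at lψ
    | cons v ψ =>
      have l1 : φ.length = X.length := by simpa using lφ
      have l2 : ψ.length = X.length := by simpa using lψ
      rw [brL_cons x X u v φ ψ hφ hψ lφ lψ l1 l2, assemble_cons x X u φ hφ lφ l1,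
        assemble_cons x X v ψ hψ lψ l2]
      -- The lemma applies by unfolding: $[v,u]$ is $v_\circ\circ u_\circ^{-1}$, and a sum of
      -- morphisms in $\Phi\mathscr C$ is a tensor product conjugated by `split`.
      exact tensorHom_conj (PhiObj.circIso u x) (PhiObj.circIso v x) _ _ _
        (ih φ ψ (pd_cons.mp hφ).2 (pd_cons.mp hψ).2 l1 l2) (PhiObj.split _ _ (disjoint_cons hφ x X))
        (PhiObj.split _ _ (disjoint_cons hψ x X))

/-! ### Assembly isomorphisms as coherence isomorphisms. -/

/-- The images under `φ` of those indices of the tuple `X` whose entry is not the unit, in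
lexicographic order. -/
noncomputable def lexIdx : List Inj → List (PhiObj C) → List ℕ+
  | u :: φ, x :: X => x.idx.map u ++ lexIdx φ X
  | [], _ => []
  -- A junk value: in a frame the list of injections is as long as the tuple.
  | _ :: _, [] => []

theorem lexIdx_nil (X : List (PhiObj C)) : lexIdx [] X = [] := by rw [lexIdx]

theorem lexIdx_cons (u : Inj) (φ : List Inj) (x : PhiObj C) (X : List (PhiObj C)) :
    lexIdx (u :: φ) (x :: X) = x.idx.map u ++ lexIdx φ X := by rw [lexIdx]

theorem lexIdx_append (φ θ : List Inj) (X Y : List (PhiObj C)) (l : φ.length = X.length) :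
    lexIdx (φ ++ θ) (X ++ Y) = lexIdx φ X ++ lexIdx θ Y := by
  induction φ generalizing X with
  | nil =>
    obtain rfl : X = [] := by simpa using l.symm
    rw [lexIdx_nil]; rfl
  | cons u φ ih =>
    cases X with
    | nil => simp at l
    | cons x X =>
      rw [List.cons_append, List.cons_append, lexIdx_cons, lexIdx_cons, ih X (by simpa using l),
        List.append_assoc]

/-- Both lists enumerate the non-unit positions of the generalized sum, block by block on the left
and in increasing order on the right. This permutation defines the coherence isomorphism that
`mk_assemble` compares with `assemble`. -/
theorem lexIdx_perm (φ : List Inj) (h : PD φ) (X : List (PhiObj C)) (l : φ.length = X.length) :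
    (lexIdx φ X).Perm (push φ h X).idx := by
  induction φ generalizing X with
  | nil =>
    rw [lexIdx_nil]
    exact List.Perm.of_eq PhiObj.idx_zero.symm
  | cons u φ ih =>
    cases X with
    | nil => simp at l
    | cons x X =>
      rw [lexIdx_cons]
      exact ((PhiObj.perm_push u x).append (ih _ X (by simpa using l))).trans
        (PhiObj.perm_add (disjoint_cons h x X)).symm

/-- The coherence isomorphism of a sum of two families with disjoint supports. -/
theorem ca_mul_ca_split {A B : PhiObj C} (d : PhiObj.Dis A B) (l m : List ℕ+) (hl : l.Perm A.idx)
    (hm : m.Perm B.idx) (h : (l ++ m).Perm (PhiObj.add A B).idx) :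
    (ca A.fn l A.idx hl * ca B.fn m B.idx hm) ⋄ ca (PhiObj.add A B).fn (A.idx ++ B.idx)
      (PhiObj.add A B).idx (PhiObj.perm_add d).symm =
      ca (PhiObj.add A B).fn (l ++ m) (PhiObj.add A B).idx h := by
  -- On the labels that occur, $A$ and $B$ each coincide with their sum. After both factors are
  -- rewritten over the one family $A+B$, additivity and transitivity of coherence isomorphisms
  -- apply.
  rw [ca_congr_fun A.fn l A.idx hl fun i hi => (PhiObj.add_fn_left i (hl.mem_iff.mp hi)).symm,
    ca_congr_fun B.fn m B.idx hm fun i hi => (PhiObj.add_fn_right d i (hm.mem_iff.mp hi)).symm,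
    ← coh_append _ _ _ _ _ hl hm (hl.append hm), ca_trans]

/-- Each ingredient of the recursion ($u_\circ$, the inverse of `split`, the tail) is a coherence
isomorphism, and these are closed under tensor products and composition. Since a coherence
isomorphism is determined by its two labelled lists, later identities between assembly isomorphisms
reduce to identities between lists. -/
theorem mk_assemble (X : List (PhiObj C)) (φ : List Inj) (h : PD φ) (l : φ.length = X.length) :
    Arrow.mk (assemble X φ h l).hom =
      ca (push φ h X).fn (lexIdx φ X) (push φ h X).idx (lexIdx_perm φ h X l) := by
  induction X generalizing φ with
  | nil =>
    obtain rfl : φ = [] := by simpa using l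
    -- Without factors both lists are empty, and either side is the identity of the unit object.
    have p : (lexIdx [] ([] : List (PhiObj C))).Perm (PhiObj.zero : PhiObj C).idx := by
      rw [lexIdx_nil, PhiObj.idx_zero]
    have e : ca (PhiObj.zero : PhiObj C).fn (lexIdx [] ([] : List (PhiObj C)))
        (PhiObj.zero : PhiObj C).idx p = 1 := by
      rw [ca_congr PhiObj.zero.fn (lexIdx_nil ([] : List (PhiObj C))) PhiObj.idx_zero, ca_nil]
    rw [assemble_nil]
    exact (mk_eqToHom (PhiObj.tens_zero (C := C)).symm).trans e.symm
  | cons x X ih =>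
    cases φ with
    | nil => simp at l
    | cons u φ =>
      have l1 : φ.length = X.length := by simpa using l
      have p := (lexIdx_perm (u :: φ) h (x :: X) l)
      rw [lexIdx_cons] at p
      rw [ca_congr _ (lexIdx_cons u φ x X) rfl, assemble_cons x X u φ h l l1]
      refine (mk_comp _ _).trans (Eq.trans ?_ (ca_mul_ca_split (disjoint_cons h x X) _ _
        (PhiObj.perm_push u x) (lexIdx_perm φ (pd_cons.mp h).2 X l1) p))
      -- The three arguments express $u_\circ$, the tail and the inverse of `split` as coherence
      -- isomorphisms; `ca_mul_ca_split` has already fused them on the other side.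
      exact congrArg₂ acomp (congrArg₂ (· * ·) (PhiObj.mk_circIso u x) (ih φ _ l1))
        (PhiObj.mk_split_inv _ _ (disjoint_cons h x X))

/-- For `map_assemble`, where the images of the two summands under a functor are only
propositionally equal to the summands formed in the target. -/
theorem mk_split_hom_congr {A B A' B' : PhiObj C} (e : A = A') (e' : B = B') (d : PhiObj.Dis A B)
    (d' : PhiObj.Dis A' B') :
    Arrow.mk (PhiObj.split A B d).hom = Arrow.mk (PhiObj.split A' B' d').hom := by
  subst e; subst e'; rfl

/-- The assembly isomorphisms are additive. -/
theorem mk_assemble_append (X Y : List (PhiObj C)) (φ θ : List Inj) (lφ : φ.length = X.length)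
    (lθ : θ.length = Y.length) (h : PD (φ ++ θ)) (hφ : PD φ) (hθ : PD θ)
    (l : (φ ++ θ).length = (X ++ Y).length)
    (d : PhiObj.Dis (push φ hφ X) (push θ hθ Y)) :
    Arrow.mk (assemble (X ++ Y) (φ ++ θ) h l).hom =
      Arrow.mk (((assemble X φ hφ lφ).hom ⊗ₚ (assemble Y θ hθ lθ).hom) ≫
        (PhiObj.split _ _ d).inv) := by
  have e : push (φ ++ θ) h (X ++ Y) = PhiObj.add (push φ hφ X) (push θ hθ Y) :=
    push_append φ θ X Y lφ h hφ hθ d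
  have p := lexIdx_perm (φ ++ θ) h (X ++ Y) l
  rw [lexIdx_append φ θ X Y lφ, e] at p
  -- No induction is needed: both sides are coherence isomorphisms from the concatenation of the two
  -- lexicographic lists to the increasing list of the sum.
  rw [mk_assemble, mk_comp, mk_tensor, mk_assemble, mk_assemble, PhiObj.mk_split_inv,
    ca_mul_ca_split d _ _ _ _ p, ca_fun (congrArg PhiObj.fn e),
    ca_congr _ (lexIdx_append φ θ X Y lφ) (congrArg PhiObj.idx e)]

end Assembly

/-! ### Strict functors preserve assembly isomorphisms. -/

section AssemblyMap
variable {C D : Type*} [Category C] [PermutativeCategory C] [Category D] [PermutativeCategory D]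

/-- The object part of the naturality of $T$. Entries that $F$ sends to the unit disappear from the
index lists, but `PhiObj.obj_tens` shows that this does not change the tensor product. -/
theorem obj_prod_tens (F : StrictFunctor C D) (X : List (PhiObj C)) :
    F.obj (X.map PhiObj.tens).prod = ((X.map (phiMap F).obj).map PhiObj.tens).prod := by
  induction X with
  | nil => exact F.obj_one
  | cons x X ih => exact (F.obj_mul _ _).trans (congrArg₂ (· * ·) (PhiObj.obj_tens F x) ih)

/-- The assembly isomorphisms are natural in the permutative category. -/
theorem map_assemble (F : StrictFunctor C D) (X : List (PhiObj C)) (φ : List Inj) (h : PD φ)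
    (l : φ.length = X.length) (l' : φ.length = (X.map (phiMap F).obj).length) :
    Arrow.mk (F.map (assemble X φ h l).hom) =
      Arrow.mk (assemble (X.map (phiMap F).obj) φ h l').hom := by
  induction X generalizing φ with
  | nil =>
    obtain rfl : φ = [] := by simpa using l
    have e := assemble_nil (C := D) h l'
    refine Eq.trans ?_ (congrArg (fun i => Arrow.mk (Iso.hom i)) e).symm
    rw [assemble_nil]
    refine (congrArg Arrow.mk (eqToHom_map F.toFunctor PhiObj.tens_zero.symm)).trans ?_
    refine (mk_eqToHom _).trans (Eq.trans ?_
      (mk_eqToHom (PhiObj.tens_zero (C := D)).symm).symm)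
    -- Both arrows are now identities, so only their objects remain to be compared: $F$ of the unit
    -- and the unit.
    exact congrArg (fun Z => Arrow.mk (𝟙 Z)) F.obj_one
  | cons x X ih =>
    cases φ with
    | nil => simp at l
    | cons u φ =>
      have l1 : φ.length = X.length := by simpa using l
      have l2 : φ.length = (X.map (phiMap F).obj).length := by simpa using l1
      -- The recursion is used instead of `mk_assemble`: $F$ may turn non-unit entries into units
      -- and so shorten the index lists. The lemmas `map_circ` and `map_split` already account for
      -- this on each piece.
      have e : push φ (pd_cons.mp h).2 (X.map (phiMap F).obj) =
          PhiObj.map F (push φ (pd_cons.mp h).2 X) :=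
        (push_map (phiMap F) φ (pd_cons.mp h).2 X l1).symm
      rw [assemble_cons x X u φ h l l1]
      refine Eq.trans ?_ (congrArg (fun i => Arrow.mk (Iso.hom i))
        (assemble_cons (PhiObj.map F x) (X.map (phiMap F).obj) u φ h l' l2)).symm
      have d := disjoint_cons h x X
      have d' : PhiObj.Dis (PhiObj.map F (PhiObj.push u x))
          (PhiObj.map F (push φ (pd_cons.mp h).2 X)) := (phiMap F).disjoint_obj d
      have c : Arrow.mk (F.map (PhiObj.circIso u x).hom) =
          Arrow.mk (PhiObj.circIso u (PhiObj.map F x)).hom :=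
        (PhiObj.mk_mapHom F (PhiObj.circ u x).hom).symm.trans
          (PhiObj.mk_hom_congr (PhiObj.map_circ F u x))
      have s := mk_inv_congr (F.mapIso (PhiObj.split _ _ d)) _ (PhiObj.map_split F _ _ d d')
      -- Here the splitting of the pair $(F(u_*x),F(\phi_*X))$ is replaced by that of
      -- $(u_*(Fx),\phi_*(FX))$, along the equalities expressing that $\Phi(F)$ is equivariant and
      -- additive.
      have s' : Arrow.mk (PhiObj.split _ _ d').inv = Arrow.mk (PhiObj.split _ _
          (disjoint_cons (C := PhiObj D) h (PhiObj.map F x) (X.map (phiMap F).obj))).inv := by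
        have e' : PhiObj.map F (PhiObj.push u x) = (act u).obj (PhiObj.map F x) :=
          PhiObj.map_push F u x
        exact mk_inv_congr _ _ (mk_split_hom_congr e' e.symm _ _)
      refine (congrArg Arrow.mk (F.map_comp _ _)).trans ((mk_comp _ _).trans
        (Eq.trans ?_ (mk_comp _ _).symm))
      refine congrArg₂ acomp ?_ (s.trans s')
      refine (F.map_tensor _ _).trans ?_
      exact StrictFunctor.tensor_congr c (ih φ (pd_cons.mp h).2 l1 l2)

end AssemblyMap

/-! ### Monotone injections. -/

section Monotone
variable {C : Type u} [Category.{v} C] [PermutativeCategory.{v} C]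

/-- Recovers a pair $(i,j)$ from a label, as needed to compare labels from different blocks. The
recursion matches the division into $i=0$ and successors. -/
theorem mem_lexIdx {φ : List Inj} {X : List (PhiObj C)} (l : φ.length = X.length) (k : ℕ+) :
    k ∈ lexIdx φ X ↔ ∃ (i : Fin X.length) (j : ℕ+), (X.get i).fn j ≠ 1 ∧
      φ.get (i.cast l.symm) j = k := by
  induction φ generalizing X with
  | nil =>
    obtain rfl : X = [] := by simpa using l.symm
    rw [lexIdx_nil]; simp
  | cons u φ ih =>
    cases X with
    | nil => simp at l
    | cons x X =>
      have l1 : φ.length = X.length := by simpa using l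
      rw [lexIdx_cons, List.mem_append, ih l1, List.mem_map]
      refine Iff.trans (or_congr ?_ ?_) (Fin.exists_fin_succ (n := X.length)
        (P := fun i => ∃ j : ℕ+, ((x :: X).get i).fn j ≠ 1 ∧
          (u :: φ).get (i.cast l.symm) j = k)).symm
      · simp
      · rfl

/-- The images of the indices of a monotone injection are increasing. -/
theorem Frame.IsMonotone.pairwise {X : List (PhiObj C)} {φ : Frame X} (h : φ.IsMonotone) :
    (lexIdx φ.list X).Pairwise (· ≤ ·) := by
  obtain ⟨φ, l, pd⟩ := φ
  induction φ generalizing X with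
  | nil => rw [lexIdx_nil]; exact List.Pairwise.nil
  | cons u φ ih =>
    cases X with
    | nil => simp at l
    | cons x X =>
      have l1 : φ.length = X.length := by simpa using l
      rw [lexIdx_cons, List.pairwise_append]
      refine ⟨?_, ih l1 (pd_cons.mp pd).2 ?_, ?_⟩
      · rw [List.pairwise_map]
        refine x.sorted_idx.imp_of_mem fun {a b} ha hb hab => ?_
        rcases hab.eq_or_lt with rfl | hab
        -- Monotonicity only speaks about strictly smaller pairs, whereas the increasing list of
        -- indices is recorded with $\le$, so equal indices are treated separately.
        · exact le_rfl
        · exact (h (0 : Fin (X.length + 1)) (0 : Fin (X.length + 1)) a b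
            (Prod.Lex.toLex_lt_toLex.mpr (Or.inr ⟨rfl, hab⟩)) ((x.mem_idx a).mp ha)
            ((x.mem_idx b).mp hb)).le
      · intro i i' j j' hij hj hj'
        -- Restriction to the tail: raising both block numbers by one preserves the lexicographic
        -- order.
        refine h i.succ i'.succ j j' ?_ hj hj'
        rw [Prod.Lex.toLex_lt_toLex] at hij ⊢
        exact hij.imp Fin.succ_lt_succ_iff.mpr (And.imp_left (congrArg Fin.succ))
      · intro a ha b hb
        obtain ⟨j, hj, rfl⟩ := List.mem_map.mp ha
        obtain ⟨i', j', hj', rfl⟩ := (mem_lexIdx l1 b).mp hb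
        -- The block number alone decides, since the first block precedes every later one.
        exact (h (0 : Fin (X.length + 1)) i'.succ j j'
          (Prod.Lex.toLex_lt_toLex.mpr (Or.inl (Fin.succ_pos i'))) ((x.mem_idx j).mp hj) hj').le

/-- There are two injections with disjoint images, one of which fixes all numbers up to `N`, while the
other one is increasing and only takes values above `N`. -/
theorem exists_head (N : ℕ+) : ∃ w e : Inj, (∀ j ≤ N, w j = j) ∧ (∀ j, N < e j) ∧
    StrictMono e ∧ Disjoint (Set.range w) (Set.range e) := by
  -- Above $N$ the first injection only takes values $N$ plus an even number and the second one only
  -- values $N$ plus an odd number. Hence the images are disjoint, and all of $1,\dots,N$ can be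
  -- fixed by the first.
  have hw : Function.Injective fun j : ℕ+ => if j ≤ N then j else N + 2 * j := fun i j h => by
    dsimp only at h
    rw [← PNat.coe_inj]
    split_ifs at h with h1 h2 h2 <;> rw [← PNat.coe_inj] at h <;>
      simp only [← PNat.coe_le_coe, PNat.add_coe, PNat.mul_coe, PNat.val_ofNat] at * <;> omega
  have he : StrictMono fun j : ℕ+ => N + 2 * j + 1 := fun i j h => by
    rw [← PNat.coe_lt_coe] at h ⊢
    simp only [PNat.add_coe, PNat.mul_coe, PNat.val_ofNat]
    omega
  refine ⟨⟨_, hw⟩, ⟨_, he.injective⟩, fun j hj => if_pos hj, fun j => ?_, he,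
    Set.disjoint_left.mpr ?_⟩
  · change N < N + 2 * j + 1
    rw [← PNat.coe_lt_coe]
    simp only [PNat.add_coe, PNat.mul_coe, PNat.val_ofNat]
    omega
  · rintro _ ⟨i, rfl⟩ ⟨j, h⟩
    change N + 2 * j + 1 = if i ≤ N then i else N + 2 * i at h
    split_ifs at h with h1 <;> rw [← PNat.coe_inj] at h <;>
      simp only [← PNat.coe_le_coe, PNat.add_coe, PNat.mul_coe, PNat.val_ofNat] at * <;> omega

/-- Only finitely many indices of the first object matter. They are kept in place, and a monotone
injection for the remaining objects is moved beyond all of them by an increasing map, which keeps it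
monotone. -/
theorem Frame.exists_isMonotone (X : List (PhiObj C)) : ∃ φ : Frame X, φ.IsMonotone := by
  induction X with
  | nil => exact ⟨Frame.default [], fun i => i.elim0⟩
  | cons x X ih =>
    obtain ⟨φ, hφ⟩ := ih
    -- A bound for the positions of the non-unit entries of the first object; values of the new
    -- injection at other positions of this block are irrelevant for monotonicity.
    obtain ⟨N, hN⟩ := x.finite.toFinset.exists_le
    obtain ⟨w, e, hw, he, he', d⟩ := exists_head N
    have hN' : ∀ j, x.fn j ≠ 1 → j ≤ N := fun j hj => hN j (by simpa using hj)
    have key : ∀ i, (φ.shift e).app i = e * φ.app i := fun i => by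
      simp [shift, app]; rfl
    refine ⟨⟨w :: (φ.shift e).list, by simp [(φ.shift e).length_eq],
      pd_cons.mpr ⟨d.mono_right (φ.image_shift e), (φ.shift e).pd⟩⟩, ?_⟩
    intro i i' j j' h hj hj'
    rw [Prod.Lex.toLex_lt_toLex] at h
    induction i using Fin.cases with
    | zero =>
      induction i' using Fin.cases with
      | zero =>
        have h1 : j < j' := by simpa using h
        change w j < w j'
        rwa [hw j (hN' j hj), hw j' (hN' j' hj')]
      | succ i' =>
        change w j < (φ.shift e).app i' j'
        rw [hw j (hN' j hj), key]
        -- The bound $N$ separates the first block from all later ones.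
        exact (hN' j hj).trans_lt (he _)
    | succ i =>
      induction i' using Fin.cases with
      -- A later block never precedes the first one.
      | zero => simp at h
      | succ i' =>
        change (φ.shift e).app i j < (φ.shift e).app i' j'
        rw [key, key]
        refine he' (hφ i i' j j' ?_ hj hj')
        rw [Prod.Lex.toLex_lt_toLex]
        exact h.imp Fin.succ_lt_succ_iff.mp (And.imp_left (Fin.succ_injective _ ·))

/-- An ordered list is determined by its entries. This is what turns monotonicity into an equality
of lists. -/
theorem PhiObj.eq_idx (X : PhiObj C) {l : List ℕ+} (h : l.Pairwise (· ≤ ·)) (p : l.Perm X.idx) :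
    l = X.idx := p.eq_of_pairwise' h X.sorted_idx

end Monotone

/-! ### The comparison functor on arbitrary representatives. -/

section Comparison
variable {C : Type u} [Category.{v} C] [PermutativeCategory.{v} C]

/-- The assembly isomorphism of an injection `φ : {1, ..., m} × ω → ω`. -/
noncomputable def Frame.asm {X : SigmaObj (PhiObj C)} (φ : Frame X.toList) :
    tObj X ≅ φ.sum.tens := assemble X.toList φ.list φ.pd φ.length_eq

theorem Frame.asm_br {X : SigmaObj (PhiObj C)} (φ ψ : Frame X.toList) :
    φ.asm.hom ≫ (Frame.br ψ φ).hom = ψ.asm.hom := assemble_brL _ _ _ _ _ _ _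

/-- The inverse form of `Frame.asm_br`. The two lemmas absorb a change of target and of source
representative, respectively. -/
theorem Frame.br_asm {X : SigmaObj (PhiObj C)} (φ ψ : Frame X.toList) :
    (Frame.br ψ φ).hom ≫ ψ.asm.inv = φ.asm.inv := by
  rw [Iso.comp_inv_eq, Iso.eq_inv_comp, Frame.asm_br]

theorem Frame.perm_idx {X : List (PhiObj C)} (φ : Frame X) :
    (lexIdx φ.list X).Perm φ.sum.idx := lexIdx_perm _ φ.pd _ φ.length_eq

theorem Frame.mk_asm {X : SigmaObj (PhiObj C)} (φ : Frame X.toList) : Arrow.mk φ.asm.hom =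
    ca φ.sum.fn (lexIdx φ.list X.toList) φ.sum.idx φ.perm_idx :=
  mk_assemble _ _ _ _

/-- Comparison of the sources in `Frame.mk_asm`: relabelling along $\phi$ leaves the ordered product
unchanged. -/
theorem Frame.lprod_lexIdx {X : SigmaObj (PhiObj C)} (φ : Frame X.toList) :
    lprod φ.sum.fn (lexIdx φ.list X.toList) = tObj X := (left_eq φ.mk_asm).symm

theorem Frame.mk_asm_inv {X : SigmaObj (PhiObj C)} (φ : Frame X.toList) : Arrow.mk φ.asm.inv =
    ca φ.sum.fn φ.sum.idx (lexIdx φ.list X.toList) φ.perm_idx.symm :=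
  mk_inv_congr φ.asm (cohIso _ _ _ _) φ.mk_asm

/-- The assembly isomorphism of a monotone injection is an identity. -/
theorem Frame.IsMonotone.mk_asm {X : SigmaObj (PhiObj C)} {φ : Frame X.toList}
    (h : φ.IsMonotone) : Arrow.mk φ.asm.hom = ia φ.sum.tens := by
  -- By monotonicity the lexicographic list is the increasing one, and the coherence isomorphism
  -- from a list to itself is an identity.
  have e := PhiObj.eq_idx _ h.pairwise φ.perm_idx
  rw [Frame.mk_asm, ca_congr _ e rfl]
  exact ca_self _ _ _

/-- The value of the comparison functor on morphisms. -/
noncomputable def tMap {X Y : SigmaObj (PhiObj C)} : (X ⟶ Y) → (tObj X ⟶ tObj Y) :=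
  Quotient.lift (fun t : SigmaTriple X Y => t.src.asm.hom ≫ t.hom.hom ≫ t.tgt.asm.inv) (by
    intro t t' h
    change t'.hom = _ at h
    -- Equivalent triples differ by $[\phi,\phi']$ on the source and $[\psi',\psi]$ on the target;
    -- these are absorbed by the assembly isomorphisms on either side.
    rw [h, PhiObj.comp_hom, PhiObj.comp_hom, Category.assoc, Category.assoc, Frame.br_asm,
      ← Category.assoc t'.src.asm.hom, Frame.asm_br])

/-- Valid without monotonicity, so representatives may be chosen to suit each computation, for
instance with disjoint images. -/
theorem tMap_mkHom {X Y : SigmaObj (PhiObj C)} (ψ : Frame Y.toList) (φ : Frame X.toList)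
    (f : φ.sum ⟶ ψ.sum) :
    tMap (SigmaHom.mkHom ψ φ f) = φ.asm.hom ≫ f.hom ≫ ψ.asm.inv := rfl

/-- For monotone injections both assembly isomorphisms are identities, so the conjugation
disappears. The equality of arrows also forces the source and target of $f$ in $\mathscr C$ to be
$T(X)$ and $T(Y)$. -/
theorem mk_tMap {X Y : SigmaObj (PhiObj C)} {ψ : Frame Y.toList} {φ : Frame X.toList}
    (hψ : ψ.IsMonotone) (hφ : φ.IsMonotone) (f : φ.sum ⟶ ψ.sum) :
    Arrow.mk (tMap (SigmaHom.mkHom ψ φ f)) = Arrow.mk f.hom := by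
  rw [tMap_mkHom]
  refine (mk_conj'' φ.asm (Iso.refl _) ψ.asm (Iso.refl _) f.hom f.hom hφ.mk_asm hψ.mk_asm
    rfl).trans ?_
  simp

theorem tObj_mul (X Y : SigmaObj (PhiObj C)) : tObj (X * Y) = tObj X * tObj Y := by
  rw [tObj, SigmaObj.mul_toList, List.map_append, List.prod_append]; rfl

/-- With disjoint representatives, the morphism $f+g$ is $f\otimes g$ conjugated by `split`, and the
assembly isomorphisms of the concatenated tuples end with the inverse of `split`. The splittings
cancel, leaving the tensor product of the two conjugates. -/
theorem mk_tMap_tensor {X Y X' Y' : SigmaObj (PhiObj C)} (f : X ⟶ Y) (g : X' ⟶ Y') :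
    Arrow.mk (tMap (f ⊗ₚ g)) = Arrow.mk (tMap f ⊗ₚ tMap g) := by
  obtain ⟨φ, φ', -, d, -, -⟩ := SigmaHom.exists_disjoint X.toList X'.toList X'.toList
  obtain ⟨ψ, ψ', -, d', -, -⟩ := SigmaHom.exists_disjoint Y.toList Y'.toList Y'.toList
  obtain ⟨f, rfl⟩ := SigmaHom.exists_mkHom f ψ φ
  obtain ⟨g, rfl⟩ := SigmaHom.exists_mkHom g ψ' φ'
  have e : (SigmaHom.mkHom ψ φ f) ⊗ₚ (SigmaHom.mkHom ψ' φ' g) =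
      SigmaHom.mkHom (X := X * X') (Y := Y * Y') _ _ _ := SigmaHom.tensor_mk ψ φ f ψ' φ' g d d'
  have a := mk_assemble_append _ _ _ _ φ.length_eq φ'.length_eq (φ.append φ' d).pd φ.pd φ'.pd
    (φ.append φ' d).length_eq (Frame.disjoint_sum d)
  have b := mk_assemble_append _ _ _ _ ψ.length_eq ψ'.length_eq (ψ.append ψ' d').pd ψ.pd ψ'.pd
    (ψ.append ψ' d').length_eq (Frame.disjoint_sum d')
  rw [e, tMap_mkHom, tMap_mkHom, tMap_mkHom]
  -- The assembly isomorphisms of the concatenated tuples are replaced by their decompositions `a`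
  -- and `b`.
  refine (mk_conj'' (Frame.asm (X := X * X') (φ.append φ' d))
    (PhiObj.tensorIso φ.asm φ'.asm ≪≫ (PhiObj.split _ _ (Frame.disjoint_sum d)).symm)
    (Frame.asm (X := Y * Y') (ψ.append ψ' d'))
    (PhiObj.tensorIso ψ.asm ψ'.asm ≪≫ (PhiObj.split _ _ (Frame.disjoint_sum d')).symm) _ _ a b
    (PhiObj.mk_hom_congr (Frame.mk_addF f g d d'))).trans (congrArg Arrow.mk ?_)
  rw [tensorHom_comp, tensorHom_comp]
  -- Unfolds $f+g$, so that each splitting stands next to its inverse.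
  change ((_ ⊗ₚ _) ≫ Iso.inv _) ≫ (Iso.hom _ ≫ (f.hom ⊗ₚ g.hom) ≫ Iso.inv _) ≫
    Iso.hom _ ≫ (_ ⊗ₚ _) = _
  simp only [Category.assoc, Iso.inv_hom_id_assoc]

/-- The symmetry is represented by an identity, so its value passes from the labels of $X$ followed
by those of $Y$, through the increasing order, to the labels of $Y$ followed by those of $X$. By
coherence this is the block transposition, that is, $\tau$. -/
theorem mk_tMap_τ (X Y : SigmaObj (PhiObj C)) :
    Arrow.mk (tMap (τ X Y)) = Arrow.mk (τ (tObj X) (tObj Y)) := by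
  obtain ⟨φ, θ, -, d, -, -⟩ := SigmaHom.exists_disjoint X.toList Y.toList Y.toList
  have e : τ X Y = SigmaHom.perm (X := X * Y) (Y := Y * X) _ _ _ := SigmaHom.symm_eq φ θ d
  let p : Frame (X * Y).toList := φ.append θ d
  let q : Frame (Y * X).toList := θ.append φ d.symm
  have s : p.sum = q.sum := SigmaHom.sum_swap φ θ d
  have hp : p.sum = PhiObj.add φ.sum θ.sum := Frame.sum_append φ θ d
  have lp : lexIdx p.list (X * Y).toList = lexIdx φ.list X.toList ++ lexIdx θ.list Y.toList :=
    lexIdx_append _ _ _ _ φ.length_eq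
  have lq : lexIdx q.list (Y * X).toList = lexIdx θ.list Y.toList ++ lexIdx φ.list X.toList :=
    lexIdx_append _ _ _ _ θ.length_eq
  have h : ∀ {Z W : PhiObj C} (k : Z = W),
      Arrow.mk (eqToHom k : Z ⟶ W).hom = ia Z.tens := by rintro Z _ rfl; rfl
  rw [e]
  change Arrow.mk (p.asm.hom ≫ (eqToHom s).hom ≫ q.asm.inv) = ta _ _
  have dd := Frame.disjoint_sum d
  -- On the labels belonging to $X$ the total sum has the entries of $\phi_*(X)$; `xθ` is the
  -- analogue for $Y$. They identify the two blocks exchanged by `coh_swap`.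
  have xφ : lprod p.sum.fn (lexIdx φ.list X.toList) = tObj X := by
    rw [hp, ← φ.lprod_lexIdx]
    exact PhiObj.lprod_fun fun i hi => PhiObj.add_fn_left i (φ.perm_idx.mem_iff.mp hi)
  have xθ : lprod p.sum.fn (lexIdx θ.list Y.toList) = tObj Y := by
    rw [hp, ← θ.lprod_lexIdx]
    exact PhiObj.lprod_fun fun i hi => PhiObj.add_fn_right dd i (θ.perm_idx.mem_iff.mp hi)
  rw [mk_comp, mk_comp, h, Frame.mk_asm, Frame.mk_asm_inv, ia_acomp (by simp; rw [s]; rfl),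
    -- The two coherence isomorphisms are over the generalized sums of `p` and `q`, which are equal
    -- but not syntactically so. They must be moved to one family before they compose.
    ca_fun (congrArg PhiObj.fn s.symm), ca_congr _ (congrArg PhiObj.idx s.symm) rfl, ca_trans,
    ca_congr _ lp lq, coh_swap, xφ, xθ]
  -- `coh_swap` requires that no label occurs in both blocks, which holds because the images are
  -- disjoint.
  exact fun i hi hi' => PhiObj.idx_disjoint dd i (φ.perm_idx.mem_iff.mp hi) (θ.perm_idx.mem_iff.mp hi')

/-- The comparison functor. -/
noncomputable def comparison (C : Type u) [Category.{v} C] [PermutativeCategory.{v} C] :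
    StrictFunctor (SigmaObj (PhiObj C)) C where
  obj := tObj
  map f := tMap f
  map_id X := by
    rw [SigmaHom.id_mk (Frame.default X.toList), tMap_mkHom]
    simp
  map_comp {X Y Z} f g := by
    obtain ⟨f, rfl⟩ := SigmaHom.exists_mkHom f (Frame.default _) (Frame.default _)
    obtain ⟨g, rfl⟩ := SigmaHom.exists_mkHom g (Frame.default _) (Frame.default _)
    -- Both morphisms are represented with the same injection on the middle object, so its assembly
    -- isomorphism cancels with its inverse.
    rw [SigmaHom.mkHom_comp, tMap_mkHom, tMap_mkHom, tMap_mkHom]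
    simp
  obj_one := rfl
  obj_mul := tObj_mul
  map_tensor := mk_tMap_tensor
  map_τ := mk_tMap_τ

/-! ### Characterization by monotone representatives, and the equivalence. -/

theorem isComparison_comparison : IsComparison (comparison C) where
  obj _ := rfl
  map _ _ f hψ hφ := mk_tMap hψ hφ f

/-- Monotone injections exist for source and target, and every morphism can be represented over any
given pair of injections; hence the prescribed values cover all morphisms. -/
theorem IsComparison.unique {F G : StrictFunctor (SigmaObj (PhiObj C)) C} (hF : IsComparison F)
    (hG : IsComparison G) : F = G := by
  apply StrictFunctor.ext_functor
  refine functor_ext (fun X => (hF.obj X).trans (hG.obj X).symm) fun {X Y} f => ?_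
  obtain ⟨φ, hφ⟩ := Frame.exists_isMonotone X.toList
  obtain ⟨ψ, hψ⟩ := Frame.exists_isMonotone Y.toList
  obtain ⟨f, rfl⟩ := SigmaHom.exists_mkHom f ψ φ
  exact (hF.map ψ φ f hψ hφ).trans (hG.map ψ φ f hψ hφ).symm

/-- Contains both halves of well-definedness. Any monotone representative gives the value of the
conjugation formula, hence independence of the choice; conversely that value is attained because a
monotone representative exists. -/
theorem isTMap_iff {X Y : SigmaObj (PhiObj C)} (α : X ⟶ Y) (g : tObj X ⟶ tObj Y) :
    IsTMap α g ↔ g = tMap α := by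
  constructor
  · rintro ⟨ψ, φ, f, hψ, hφ, rfl, e⟩
    exact hom_eq (e.symm.trans (mk_tMap hψ hφ f).symm)
  · rintro rfl
    obtain ⟨φ, hφ⟩ := Frame.exists_isMonotone X.toList
    obtain ⟨ψ, hψ⟩ := Frame.exists_isMonotone Y.toList
    obtain ⟨f, rfl⟩ := SigmaHom.exists_mkHom α ψ φ
    exact ⟨ψ, φ, f, hψ, hφ, rfl, (mk_tMap hψ hφ f).symm⟩

open Classical in
/-- The object of `Φ C` whose first entry is `c` and whose other entries are the unit. -/
noncomputable def PhiObj.single (c : C) : PhiObj C where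
  fn i := if i = 1 then c else 1
  finite := (Set.finite_singleton 1).subset fun i hi => by
    by_contra h
    exact hi (if_neg h)

theorem PhiObj.tens_single (c : C) : (single c).tens = c := by
  have h : (single c).fn 1 = c := by simp [single]
  -- If $c$ is itself the unit, the index list is empty rather than `[1]`. Writing it as a filter of
  -- `[1]` treats both cases at once, since dropping unit factors does not change the product.
  rw [tens_eq, idx_eq (single c) (l := [1]) (by simp) (by simp) fun i hi => by
    by_contra h'
    exact hi (if_neg (by simpa using h')), lprod_filter _ _ (nz_one _)]
  rw [lprod_cons, lprod_nil, mul_one, h]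

/-- For fixed $\phi$ and $\psi$, morphisms $X\to Y$ of $\Sigma\Phi\mathscr C$ correspond to
morphisms of $\mathscr C$ between the tensor products of $\phi_*(X)$ and $\psi_*(Y)$. On these, $T$
is conjugation by isomorphisms, hence bijective. -/
theorem comparison_isEquivalence : (comparison C).toFunctor.IsEquivalence where
  faithful := ⟨by
    intro X Y f g h
    -- Both morphisms are represented over the same injections, so that equality of the representing
    -- morphisms suffices.
    obtain ⟨f, rfl⟩ := SigmaHom.exists_mkHom f (Frame.default _) (Frame.default _)
    obtain ⟨g, rfl⟩ := SigmaHom.exists_mkHom g (Frame.default _) (Frame.default _)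
    have h' : (Frame.asm _).hom ≫ f.hom ≫ (Frame.asm _).inv =
      (Frame.asm _).hom ≫ g.hom ≫ (Frame.asm _).inv := h
    rw [cancel_epi, cancel_mono] at h'
    rw [PhiObj.hom_ext h']⟩
  full := ⟨by
    intro X Y (g : tObj X ⟶ tObj Y)
    let φ := Frame.default X.toList
    let ψ := Frame.default Y.toList
    -- The preimage is the opposite conjugate of $g$.
    refine ⟨SigmaHom.mkHom ψ φ (PhiHom.mk (φ.asm.inv ≫ g ≫ ψ.asm.hom)), ?_⟩
    change φ.asm.hom ≫ (φ.asm.inv ≫ g ≫ ψ.asm.hom) ≫ ψ.asm.inv = g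
    simp⟩
  -- The value at this one-term tuple equals $c$ strictly; the extra unit factor is the end of the
  -- list product.
  essSurj := ⟨fun c => ⟨⟨[PhiObj.single c]⟩, ⟨eqToIso (by
    change (PhiObj.single c).tens * 1 = c
    rw [mul_one, PhiObj.tens_single])⟩⟩⟩

end Comparison

/-! ### Naturality in the permutative category. -/

section Natural

/-- The comparison functors are natural in the permutative category. -/
theorem comparison_natural {C D : Type u} [Category.{v} C] [PermutativeCategory.{v} C]
    [Category.{v} D] [PermutativeCategory.{v} D] (F : StrictFunctor C D) :
    (sigmaMap (phiMap F)).comp (comparison D) = (comparison C).comp F := by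
  apply StrictFunctor.ext_functor
  refine functor_ext (fun X => (obj_prod_tens F X.toList).symm) fun {X Y} f => ?_
  obtain ⟨f, rfl⟩ := SigmaHom.exists_mkHom f (Frame.default _) (Frame.default _)
  -- $\Sigma\Phi(F)$ keeps the injections of a representative, so the two assembly isomorphisms to
  -- be compared belong to the same $\phi$.
  have a := fun (Z : SigmaObj (PhiObj C)) (φ : Frame Z.toList) =>
    map_assemble F Z.toList φ.list φ.pd φ.length_eq (φ.map (phiMap F).obj).length_eq
  have m : Arrow.mk (Frame.mapHom (phiMap F) f).hom = Arrow.mk (F.map f.hom) :=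
    (PhiObj.mk_hom_congr (Frame.mk_mapHom (phiMap F) f)).trans (PhiObj.mk_mapHom F f)
  refine (mk_conj'' (Frame.asm (X := ⟨X.toList.map (phiMap F).obj⟩)
    ((Frame.default X.toList).map _)) (F.mapIso (Frame.asm (Frame.default X.toList)))
    (Frame.asm (X := ⟨Y.toList.map (phiMap F).obj⟩) ((Frame.default Y.toList).map _))
    (F.mapIso (Frame.asm (Frame.default Y.toList))) _ _ (a X _).symm
    (a Y _).symm m).trans (congrArg Arrow.mk ?_)
  -- What remains is that $F$ applied to a conjugate is the conjugate of the images.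
  exact ((F.map_comp _ _).trans (congrArg _ (F.map_comp _ _))).symm

/-- The natural transformation consisting of the comparison functors. -/
noncomputable def comparisonNatTrans : Phi.{v, u} ⋙ sigma.{v, u} ⟶ 𝟭 PermCat.{v, u} where
  app C := comparison C.carrier
  naturality _ _ F := comparison_natural F

end Natural

end ParPerm

/-- The prescription on morphisms is covered twice: `IsTMap` asks for some monotone representative
and has a unique solution, while `IsComparison` constrains all of them. Uniqueness of the strict
functor also shows that the components of the natural transformation are the intended functors. -/
theorem mainTheorem2 :
    (∀ C : PermCat.{v, u},
      (∀ (X Y : SigmaObj (PhiObj C.carrier)) (α : X ⟶ Y), ∃! g : tObj X ⟶ tObj Y, IsTMap α g) ∧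
      ∃! F : StrictFunctor (SigmaObj (PhiObj C.carrier)) C.carrier, IsComparison F) ∧
    ∃ T : Phi.{v, u} ⋙ sigma.{v, u} ⟶ 𝟭 PermCat.{v, u}, ∀ C : PermCat.{v, u},
      IsComparison (C := C.carrier) (PermCat.strict (T.app C)) ∧
      (PermCat.strict (T.app C)).toFunctor.IsEquivalence :=
  ⟨fun _ => ⟨fun _ _ α => ⟨tMap α, (isTMap_iff α _).mpr rfl, fun _ h => (isTMap_iff α _).mp h⟩,
      comparison _, isComparison_comparison, fun _ h => h.unique isComparison_comparison⟩,
    comparisonNatTrans, fun _ => ⟨isComparison_comparison, comparison_isEquivalence⟩⟩
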